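/- Let $N\ge 1$, let $\Omega\subset\mathbb{R}^{3N}$ be a bounded domain with smooth boundary $\Gamma$, let $T>0$, $I=(0,T)$. Put $H=L_2(\Omega;\mathbb{C})$ with $(\varphi,\psi)_H=\int_\Omega\varphi\overline{\psi}\,dx$, $V=H^1_0(\Omega;\mathbb{C})$, $V'=H^{-1}(\Omega;\mathbb{C})$ (the bounded antilinear functionals on $V$, with $H\hookrightarrow V'$ through $(\cdot,\cdot)_H$), and $\mathbb{U}=L_2(I;H)$. Let $\mathcal{V}:I\times\Omega\to\mathbb{R}$ be a measurable potential with measurable slices, and write $\mathcal{V}(t)$ for multiplication by $\mathcal{V}(t,\cdot)$. Assume that it is (a) uniformly bounded: there is $C_{\mathcal V}<\infty$ with $\|\mathcal{V}(t)\varphi\|_H\le C_{\mathcal V}\|\varphi\|_H$ for all $t\in I$, $\varphi\in H$; (b) uniformly positive: there is $\alpha_{\mathcal V}>0$ with $(\mathcal{V}(t)\varphi,\varphi)_H\ge\alpha_{\mathcal V}\|\varphi\|_H^2$ for all $t\in I$, $\varphi\in H$; (c) differentiable in time with uniformly bounded derivative: there is $C'<\infty$ such that for all $\varphi,\psi\in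 H$ the function $t\mapsto(\mathcal{V}(t)\varphi,\psi)_H$ is differentiable on $I$ with $|\frac{d}{dt}(\mathcal{V}(t)\varphi,\psi)_H|\le C'\|\varphi\|_H\|\psi\|_H$. (Being real-valued, $\mathcal{V}(t)$ is hermitian.) Let $u_0\in V$. Let $D$ be the linear span of the functions $v(t,x)=\theta(t)\varphi(x)$ with $\theta\in C^1([0,T];\mathbb{C})$, $\theta(T)=0$, and $\varphi\in C^2(\Omega;\mathbb{C})\cap C(\overline\Omega;\mathbb{C})$, $\varphi=0$ on $\Gamma$, $\Delta\varphi$ continuously extendable to $\overline\Omega$. For $v\in D$ let $S^*v=\mathrm{i}\,\partial_t v+\frac12\Delta_x v-\mathcal{V}v$, and let $\mathbb{V}\subset\mathbb{U}$ be the closure of $D$ with respect to the norm $\|v\|_{\mathbb{V}}=\|S^*v\|_{\mathbb{U}}$; the maps $v\mapsto S^*v\in\mathbb{U}$ and $v\mapsto v(0)\in H$ extend continuously from $D$ to $\mathbb{V}$. Then there is exactly one ultra-weak solution $u^*\in\mathbb{U}$ of the homogeneous Schrödinger problem with initial value $u_0$, that is, exactly one $u^*\in\mathbb{U}$ with $$(u^*,S^*v)_{\mathbb{U}}=\mathrm{i}\,(u_0,v(0))_H\qquad\text{for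 all }v\in\mathbb{V}.$$ It has the additional regularity $u^*\in L_2(I;V)\cap H^1(I;V')$, and it is norm-preserving: $u^*$ has a representative in $C([0,T];H)$ with $u^*(0)=u_0$ and $\|u^*(t)\|_H=\|u^*(0)\|_H=\|u_0\|_H$ for all $t\in[0,T]$. -/

import Mathlib

open MeasureTheory Set Filter Topology
open scoped ContDiff ENNReal ComplexConjugate

noncomputable section

namespace Schrodinger

/-- `ℝ^d` with its Euclidean norm. -/
abbrev Space (d : ℕ) : Type := EuclideanSpace ℝ (Fin d)

variable {d : ℕ}

/-- `Ω` has a smooth boundary: near each boundary point, `Ω` is the sublevel set `{ρ < 0}` of a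
smooth function `ρ` with non-vanishing differential at that point. -/
def HasSmoothBoundary (Ω : Set (Space d)) : Prop :=
  ∀ x ∈ frontier Ω, ∃ (U : Set (Space d)) (ρ : Space d → ℝ),
    IsOpen U ∧ x ∈ U ∧ ContDiffOn ℝ ∞ ρ U ∧ fderiv ℝ ρ x ≠ 0 ∧ ∀ y ∈ U, (y ∈ Ω ↔ ρ y < 0)

/-! ### Spaces in the space variable -/

/-- `H = L₂(Ω; ℂ)`. Mathlib's inner product is conjugate linear in its first argument, so that
`(φ, ψ)_H = ∫ φ ψ̄` is `inner ℂ ψ φ`. -/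
abbrev H (Ω : Set (Space d)) : Type := Lp ℂ 2 (volume.restrict Ω)

/-- Pairs `(φ, G)`, `φ ∈ L₂(Ω; ℂ)`, `G ∈ L₂(Ω; ℂ)^d`, with `‖(φ, G)‖² = ‖φ‖² + ∑ᵢ ‖Gᵢ‖²`. -/
abbrev H1Ambient (Ω : Set (Space d)) : Type := WithLp 2 (H Ω × PiLp 2 (fun _ : Fin d => H Ω))

/-- The pairs `(φ, ∇φ)`, where `φ` is a smooth function with compact support in `Ω`. -/
def testPairs (Ω : Set (Space d)) : Set (H1Ambient Ω) :=
  {p | ∃ φ : Space d → ℂ, ContDiff ℝ ∞ φ ∧ HasCompactSupport φ ∧ tsupport φ ⊆ Ω ∧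
    p.fst =ᵐ[volume.restrict Ω] φ ∧
    ∀ i : Fin d, p.snd i =ᵐ[volume.restrict Ω]
      fun x => fderiv ℝ φ x (EuclideanSpace.single i (1 : ℝ))}

/-- `H₀¹(Ω; ℂ)`, the closure of `C_c^∞(Ω; ℂ)` in the `H¹`-norm; an element is stored with its
weak gradient. -/
def H01Submodule (Ω : Set (Space d)) : Submodule ℂ (H1Ambient Ω) :=
  (Submodule.span ℂ (testPairs Ω)).topologicalClosure

/-- `V = H₀¹(Ω; ℂ)`. -/
abbrev V (Ω : Set (Space d)) : Type := H01Submodule Ω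

/-- The embedding `V ↪ H`. -/
def embVH (Ω : Set (Space d)) : V Ω →L[ℂ] H Ω :=
  (WithLp.fstL 2 ℂ (H Ω) (PiLp 2 (fun _ : Fin d => H Ω))).comp (H01Submodule Ω).subtypeL

/-- `V' = H⁻¹(Ω; ℂ)`: bounded antilinear functionals on `V`, so that the pairing
`⟨f, φ⟩_{V' × V} = f φ` extends the inner product `(f, φ)_H`. -/
abbrev V' (Ω : Set (Space d)) : Type := V Ω →L⋆[ℂ] ℂ

/-- The embedding `H ↪ V'`, `h ↦ (φ ↦ (h, φ)_H)`. -/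
def embHV' (Ω : Set (Space d)) (h : H Ω) : V' Ω := ((innerSL ℂ).flip h).comp (embVH Ω)

/-! ### Spaces in space and time -/

/-- Lebesgue measure on `I = (0, T)`. -/
abbrev timeMeasure (T : ℝ) : Measure ℝ := volume.restrict (Ioo 0 T)

/-- `𝕌 = L₂(I; H)`. -/
abbrev U (T : ℝ) (Ω : Set (Space d)) : Type := Lp (H Ω) 2 (timeMeasure T)

/-- `u ∈ L₂(I; V)`. -/
def MemL2V {T : ℝ} {Ω : Set (Space d)} (u : U T Ω) : Prop :=
  ∃ w : Lp (V Ω) 2 (timeMeasure T), ∀ᵐ t ∂timeMeasure T, embVH Ω (w t) = u t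

/-- `w` is the weak derivative `∂ₜ u`, as a function on `I` with values in `V'`. -/
def IsWeakTimeDeriv {T : ℝ} {Ω : Set (Space d)} (u : U T Ω)
    (w : Lp (V' Ω) 2 (timeMeasure T)) : Prop :=
  ∀ θ : ℝ → ℂ, ContDiff ℝ ∞ θ → HasCompactSupport θ → tsupport θ ⊆ Ioo 0 T →
    ∫ t in Ioo 0 T, deriv θ t • embHV' Ω (u t) = - ∫ t in Ioo 0 T, θ t • w t

/-- `u ∈ H¹(I; V')` (a function `u ∈ L₂(I; H)` is always in `L₂(I; V')`). -/
def MemH1V' {T : ℝ} {Ω : Set (Space d)} (u : U T Ω) : Prop :=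
  ∃ w : Lp (V' Ω) 2 (timeMeasure T), IsWeakTimeDeriv u w

/-- A function `ψ ∈ C([0, T]; H)` is norm-preserving if `‖ψ(t)‖ = ‖ψ(0)‖` for `t ∈ [0, T]`. -/
def IsNormPreserving {Ω : Set (Space d)} (T : ℝ) (ψ : ℝ → H Ω) : Prop :=
  ContinuousOn ψ (Icc 0 T) ∧ ∀ t ∈ Icc 0 T, ‖ψ t‖ = ‖ψ 0‖

/-! ### The potential -/

/-- The assumptions on the potential `𝒱 : I × Ω → ℝ`, which acts on `H` by multiplication
(and is therefore hermitian). -/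
structure PotentialAssumption (T : ℝ) (Ω : Set (Space d)) (𝒱 : ℝ → Space d → ℝ) : Prop where
  aestronglyMeasurable : AEStronglyMeasurable (Function.uncurry 𝒱)
    ((timeMeasure T).prod (volume.restrict Ω))
  aestronglyMeasurable_slice : ∀ t ∈ Ioo 0 T, AEStronglyMeasurable (𝒱 t) (volume.restrict Ω)
  /-- uniformly bounded: `‖𝒱(t) φ‖ ≤ C ‖φ‖` -/
  bounded : ∃ C : ℝ, ∀ t ∈ Ioo 0 T, ∀ φ : H Ω,
    eLpNorm (fun x => (𝒱 t x : ℂ) * φ x) 2 (volume.restrict Ω) ≤ ENNReal.ofReal (C * ‖φ‖)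
  /-- uniformly positive: `(𝒱(t) φ, φ) ≥ α ‖φ‖²` -/
  positive : ∃ α : ℝ, 0 < α ∧ ∀ t ∈ Ioo 0 T, ∀ φ : H Ω,
    α * ‖φ‖ ^ 2 ≤ ∫ x in Ω, 𝒱 t x * ‖φ x‖ ^ 2
  /-- differentiable in `t`: the forms `(𝒱(t) φ, ψ)` are differentiable on `I`, with uniformly
  bounded derivatives -/
  differentiable : ∃ C : ℝ, ∀ t ∈ Ioo 0 T, ∀ φ ψ : H Ω, ∃ D : ℂ,
    HasDerivAt (fun s => ∫ x in Ω, (𝒱 s x : ℂ) * φ x * conj (ψ x)) D t ∧ ‖D‖ ≤ C * ‖φ‖ * ‖ψ‖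

/-! ### The ultra-weak formulation -/

/-- The operator `S_∘^* v = i ∂ₜ v + ½ Δₓ v - 𝒱 v`, pointwise. -/
def adjointSchrodinger (𝒱 : ℝ → Space d → ℝ) (v : ℝ → Space d → ℂ) (t : ℝ) (x : Space d) : ℂ :=
  Complex.I * deriv (fun s => v s x) t + (1 / 2) * Laplacian.laplacian (v t) x
    - (𝒱 t x : ℂ) * v t x

/-- The temporal factors: `θ ∈ C¹([0, T]; ℂ)` with `θ(T) = 0`. -/
def IsTimeFactor (T : ℝ) (θ : ℝ → ℂ) : Prop :=
  ContDiffOn ℝ 1 θ (Icc 0 T) ∧ θ T = 0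

/-- The spatial factors: `φ ∈ C²(Ω; ℂ) ∩ C₀(Ω̄; ℂ)` with `φ = 0` on the boundary, such that `Δ φ`
extends continuously to `Ω̄`. -/
def IsSpaceFactor (Ω : Set (Space d)) (φ : Space d → ℂ) : Prop :=
  ContDiffOn ℝ 2 φ Ω ∧ ContinuousOn φ (closure Ω) ∧ (∀ x ∈ frontier Ω, φ x = 0) ∧
    ∃ f : Space d → ℂ, ContinuousOn f (closure Ω) ∧ ∀ x ∈ Ω, Laplacian.laplacian φ x = f x

/-- The classical domain `D(S_∘^*)`, the tensor product of the spaces of temporal and of spatial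
factors. -/
def classicalDomain (T : ℝ) (Ω : Set (Space d)) : Submodule ℂ (ℝ → Space d → ℂ) :=
  Submodule.span ℂ {v | ∃ θ φ, IsTimeFactor T θ ∧ IsSpaceFactor Ω φ ∧ v = fun t x => θ t * φ x}

/-- The triples `(v, S_∘^* v, v(0)) ∈ 𝕌 × 𝕌 × H`, `v ∈ D(S_∘^*)`. -/
def classicalTriples (T : ℝ) (Ω : Set (Space d)) (𝒱 : ℝ → Space d → ℝ) :
    Set (U T Ω × U T Ω × H Ω) :=
  {p | ∃ v ∈ classicalDomain T Ω,
    (∀ᵐ t ∂timeMeasure T, p.1 t =ᵐ[volume.restrict Ω] v t) ∧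
    (∀ᵐ t ∂timeMeasure T, p.2.1 t =ᵐ[volume.restrict Ω] adjointSchrodinger 𝒱 v t) ∧
    p.2.2 =ᵐ[volume.restrict Ω] v 0}

/-- The test space `𝕍`, the closure of `D(S_∘^*)` for `‖v‖_𝕍 = ‖S_∘^* v‖_𝕌`. Its elements `v ∈ 𝕌`
are stored with the values `S^* v ∈ 𝕌` and `v(0) ∈ H` of the continuous extensions of `S_∘^*` and of
the evaluation at time `0`: since `‖v‖_𝕌` and `‖v(0)‖_H` are bounded by multiples of `‖S_∘^* v‖_𝕌`
for `v ∈ D(S_∘^*)`, convergence in `‖·‖_𝕍` is convergence of the triples. -/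
def testSpace (T : ℝ) (Ω : Set (Space d)) (𝒱 : ℝ → Space d → ℝ) : Set (U T Ω × U T Ω × H Ω) :=
  closure (classicalTriples T Ω 𝒱)

/-- `u ∈ 𝕌` is an ultra-weak solution: `(u, S^* v)_𝕌 = i (u₀, v(0))_H` for all `v ∈ 𝕍`. -/
def IsUltraWeakSolution {T : ℝ} {Ω : Set (Space d)} (𝒱 : ℝ → Space d → ℝ) (u₀ : H Ω)
    (u : U T Ω) : Prop :=
  ∀ p ∈ testSpace T Ω 𝒱, inner ℂ p.2.1 u = Complex.I * inner ℂ p.2.2 u₀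

end Schrodinger

end

open MeasureTheory Set Filter Topology
open scoped ContDiff ENNReal ComplexConjugate

noncomputable section

namespace Schrodinger

/-! ### Product rule for primitives of integrable functions -/

section ProductRule

variable {E F G : Type*} [NormedAddCommGroup E] [NormedSpace ℝ E]
  [NormedAddCommGroup F] [NormedSpace ℝ F] [NormedAddCommGroup G] [NormedSpace ℝ G]

/-! Let J be the embedding of V in H, let G : H → V solve the Dirichlet problem for -½Δ
(Lax–Milgram, with the Poincaré inequality for coercivity), and put K = J G, a non-negative
symmetric operator on H with dense range. Formally the equation reads i u' = K⁻¹ u + A u, where A(t)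
is multiplication by the potential. Tested with θ(t) K x it contains bounded operators only; this is
`IsWeakSolution`. The proof solves this equation in an abstract Hilbert space and then shows that it
is equivalent to the ultra-weak formulation.

Uniqueness and conservation of the norm. The weak form says that K u is the primitive of -i (u + K A
u) that starts at K u₀ (`map_ae_eq_mildForm`). An operator S commuting with K yields an energy
identity from which the contribution of K⁻¹ has dropped out by symmetry (`norm_sq_map_mildForm`).
With S a difference of Yosida approximations (K + ε)⁻¹ the identity shows that they converge
uniformly in time on K u, and with S a single one it gives the norm of the limit
(`IsWeakSolution.exists_continuous`). Applied to the difference of two solutions, this is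
uniqueness.

Existence. With K⁻¹ replaced by (K + ε)⁻¹ the problem is a linear ODE with bounded coefficients.
Since u₀ lies in V and A is Lipschitz in time, the energy is bounded independently of ε
(`exists_evolution_energy`, `exists_yosida_solution`), and a weak limit in L₂(I; V) is a weak
solution (`exists_weakSolution`). Its time derivative in L₂(I; V') is read off from the equation
(`exists_weakTimeDeriv`).

Equivalence. The ultra-weak formulation tests only with classical functions φ. Each of them equals G
f with f = -½Δφ (`IsDirichletInverse.exists_source`), so weak solutions are ultra-weak. Conversely
these f span a dense subspace of H (`IsDirichletInverse.dense_span_source`), so ultra-weak solutions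
are weak. Regularity up to the boundary beyond continuity is never needed: Weyl's lemma gives
interior smoothness, exterior balls give barriers and hence continuity at the boundary, and the
maximum principle identifies solutions. Density holds because every plane wave e^{ik·x} with k ≠ 0
is the source of a classical solution, so that a vector orthogonal to all sources has a Fourier
transform vanishing off the origin. -/

theorem integrable_bilin_prod {μ : Measure ℝ} [SFinite μ]
    (L : E →L[ℝ] F →L[ℝ] G) {p : ℝ → E} {q : ℝ → F} (hp : Integrable p μ) (hq : Integrable q μ) :
    Integrable (fun z : ℝ × ℝ => L (p z.1) (q z.2)) (μ.prod μ) := by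
  refine (((hp.norm.mul_prod hq.norm).const_mul ‖L‖)).mono' ?_ ?_
  · exact L.aestronglyMeasurable_comp₂ hp.aestronglyMeasurable.comp_fst
      hq.aestronglyMeasurable.comp_snd
  · filter_upwards with z
    simpa [mul_assoc] using L.le_opNorm₂ (p z.1) (q z.2)

/-- Fubini on the square, cut along the diagonal, which is null because the measure has no atoms.
The integrands are merely integrable, so this replaces differentiation of a product of primitives.
-/
theorem bilin_integral_integral [CompleteSpace E] [CompleteSpace F] [CompleteSpace G]
    {μ : Measure ℝ} [SFinite μ] [NullSingletonClass μ]
    (L : E →L[ℝ] F →L[ℝ] G) {p : ℝ → E} {q : ℝ → F} (hp : Integrable p μ) (hq : Integrable q μ) :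
    Integrable (fun t => L (p t) (∫ s in Iio t, q s ∂μ)) μ ∧
    Integrable (fun t => L (∫ s in Iio t, p s ∂μ) (q t)) μ ∧
    L (∫ t, p t ∂μ) (∫ t, q t ∂μ) =
      ∫ t, (L (p t) (∫ s in Iio t, q s ∂μ) + L (∫ s in Iio t, p s ∂μ) (q t)) ∂μ := by
  have hF := integrable_bilin_prod L hp hq
  have hF' := hF.swap
  have hA : MeasurableSet {z : ℝ × ℝ | z.2 < z.1} := measurableSet_lt measurable_snd measurable_fst
  have hB : MeasurableSet {z : ℝ × ℝ | z.1 < z.2} := measurableSet_lt measurable_fst measurable_snd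
  have i1 := hF.indicator hA
  have i2 := hF'.indicator hA
  have e1 : ∀ t, ∫ s, ({z : ℝ × ℝ | z.2 < z.1}.indicator (fun z => L (p z.1) (q z.2))) (t, s) ∂μ
      = L (p t) (∫ s in Iio t, q s ∂μ) := by
    intro t
    rw [← (L (p t)).integral_comp_comm hq.integrableOn, ← integral_indicator measurableSet_Iio]
    rfl
  have e2 : ∀ t, ∫ s, ({z : ℝ × ℝ | z.2 < z.1}.indicator
      ((fun z : ℝ × ℝ => L (p z.1) (q z.2)) ∘ Prod.swap)) (t, s) ∂μ
      = L (∫ s in Iio t, p s ∂μ) (q t) := by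
    intro t
    have := (L.flip (q t)).integral_comp_comm (hp.integrableOn (s := Iio t))
    simp only [ContinuousLinearMap.flip_apply] at this
    rw [← this, ← integral_indicator measurableSet_Iio]
    rfl
  have j1 := i1.integral_prod_left
  have j2 := i2.integral_prod_left
  simp only [e1] at j1
  simp only [e2] at j2
  refine ⟨j1, j2, ?_⟩
  rw [integral_add j1 j2]
  have k1 := integral_prod _ i1
  have k2 := integral_prod _ i2
  simp only [e1] at k1
  simp only [e2] at k2
  rw [← k1, ← k2]
  have k3 : ∫ z, {z : ℝ × ℝ | z.2 < z.1}.indicator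
      ((fun z : ℝ × ℝ => L (p z.1) (q z.2)) ∘ Prod.swap) z ∂(μ.prod μ) =
      ∫ z, {z : ℝ × ℝ | z.1 < z.2}.indicator (fun z : ℝ × ℝ => L (p z.1) (q z.2)) z ∂(μ.prod μ) :=
        by
    rw [← integral_prod_swap]
    rfl
  rw [k3, ← integral_add i1 (hF.indicator hB)]
  have k4 : L (∫ t, p t ∂μ) (∫ t, q t ∂μ) = ∫ z : ℝ × ℝ, L (p z.1) (q z.2) ∂(μ.prod μ) := by
    rw [integral_prod _ hF]
    have : ∀ t, ∫ s, L (p t) (q s) ∂μ = L.flip (∫ s, q s ∂μ) (p t) := fun t => by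
      rw [(L (p t)).integral_comp_comm hq]; rfl
    simp only [this]
    rw [(L.flip (∫ s, q s ∂μ)).integral_comp_comm hp]; rfl
  rw [k4]
  apply integral_congr_ae
  have hd : ∀ᵐ z ∂(μ.prod μ), z.1 ≠ z.2 := by
    rw [Measure.ae_prod_iff_ae_ae]
    · filter_upwards with t
      have : ∀ᵐ s ∂μ, s ≠ t := by simp [ae_iff]
      filter_upwards [this] with s hs using fun h => hs h.symm
    · exact (measurableSet_eq_fun measurable_fst measurable_snd).compl
  filter_upwards [hd] with z hz
  rcases lt_or_gt_of_ne hz with h | h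
  · simp [indicator, h, not_lt.2 h.le]
  · simp [indicator, h, not_lt.2 h.le]

end ProductRule

/-! ### Norm-preserving linear evolution equations -/

theorem hasDerivWithinAt_re_inner {H : Type*} [NormedAddCommGroup H] [InnerProductSpace ℂ H]
    {u v : ℝ → H} {u' v' : H} {s : Set ℝ} {t : ℝ}
    (hu : HasDerivWithinAt u u' s t) (hv : HasDerivWithinAt v v' s t) :
    HasDerivWithinAt (fun t => (inner ℂ (u t) (v t)).re)
      ((inner ℂ (u t) v').re + (inner ℂ u' (v t)).re) s t := by
  refine (Complex.reCLM.hasFDerivAt.comp_hasDerivWithinAt t (hu.inner ℂ hv)).congr_deriv ?_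
  simp

theorem hasDerivWithinAt_norm_sq {H : Type*} [NormedAddCommGroup H] [InnerProductSpace ℂ H]
    {u : ℝ → H} {u' : H} {s : Set ℝ} {t : ℝ} (hu : HasDerivWithinAt u u' s t) :
    HasDerivWithinAt (fun t => ‖u t‖ ^ 2) (2 * (inner ℂ (u t) u').re) s t := by
  have h := hasDerivWithinAt_re_inner hu hu
  have e : (inner ℂ u' (u t)).re = (inner ℂ (u t) u').re := inner_re_symm (𝕜 := ℂ) _ _
  rw [e, ← two_mul] at h
  have e2 : (fun t => (inner ℂ (u t) (u t)).re) = fun t => ‖u t‖ ^ 2 := by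
    funext t
    exact inner_self_eq_norm_sq (𝕜 := ℂ) (u t)
  rwa [e2] at h

section ODE

variable {H : Type*} [NormedAddCommGroup H] [InnerProductSpace ℂ H] [CompleteSpace H]

/-- Picard–Lindelöf yields a solution on the whole interval at once if the vector field is bounded,
so the linear field is first cut off at large norm. The cut-off multiplies it by a real scalar and
therefore preserves skewness; the norm stays constant and the cut-off is never active along the
solution. -/
theorem exists_isometric_evolution {T : ℝ} (hT : 0 < T) (B : ℝ → H →L[ℂ] H)
    (hB : ContinuousOn B (Icc 0 T)) (hskew : ∀ t ∈ Icc 0 T, ∀ x, (inner ℂ x (B t x)).re = 0)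
    (x₀ : H) :
    ∃ u : ℝ → H, u 0 = x₀ ∧ (∀ t ∈ Icc 0 T, ‖u t‖ = ‖x₀‖) ∧
      ∀ t ∈ Icc 0 T, HasDerivWithinAt u (B t (u t)) (Icc 0 T) t := by
  obtain ⟨M, hM⟩ := (isCompact_Icc (a := (0 : ℝ)) (b := T)).exists_bound_of_continuousOn hB
  have hM0 : 0 ≤ M := (norm_nonneg _).trans (hM 0 ⟨le_rfl, hT.le⟩)
  set R : ℝ := ‖x₀‖ + 1 with hR
  have hR0 : 0 < R := by rw [hR]; positivity
  -- This factor is 1 on the ball of radius R and 0 outside the ball of radius 2R.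
  let c : H → ℝ := fun x => max 0 (min 1 (2 - ‖x‖ / R))
  have hc0 : ∀ x, 0 ≤ c x := fun x => le_max_left _ _
  have hc1 : ∀ x, c x ≤ 1 := fun x => max_le zero_le_one (min_le_left _ _)
  have hcx : ∀ x, c x * ‖x‖ ≤ 2 * R := by
    intro x
    rcases le_total ‖x‖ (2 * R) with h | h
    · exact (mul_le_of_le_one_left (norm_nonneg _) (hc1 x)).trans h
    · have : 2 - ‖x‖ / R ≤ 0 := by
        rw [sub_nonpos, le_div_iff₀ hR0]; exact h
      have : c x = 0 := max_eq_left ((min_le_right _ _).trans this)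
      rw [this, zero_mul]; positivity
  have hcl : ∀ x y, |c x - c y| ≤ ‖x - y‖ / R := by
    intro x y
    calc |c x - c y| ≤ |min 1 (2 - ‖x‖ / R) - min 1 (2 - ‖y‖ / R)| := by
          simpa using abs_max_sub_max_le_max (0 : ℝ) (min 1 (2 - ‖x‖ / R)) 0 (min 1 (2 - ‖y‖ / R))
      _ ≤ |(2 - ‖x‖ / R) - (2 - ‖y‖ / R)| := by
          simpa using abs_min_sub_min_le_max (1 : ℝ) (2 - ‖x‖ / R) 1 (2 - ‖y‖ / R)
      _ = |‖y‖ - ‖x‖| / R := by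
          rw [← abs_of_pos hR0, ← abs_div, abs_of_pos hR0]; congr 1; ring
      _ ≤ ‖x - y‖ / R := by
          gcongr
          rw [norm_sub_rev]
          exact abs_norm_sub_norm_le y x
  let f : ℝ → H → H := fun t x => B t ((c x : ℂ) • x)
  -- Maximal speed times T: the solution cannot leave the ball of radius a before time T.
  set a : ℝ := M * (2 * R) * T with ha
  have ha0 : 0 ≤ a := by positivity
  set K : ℝ := M * ((‖x₀‖ + a) / R + 1) with hK
  have hK0 : 0 ≤ K := by positivity
  have hpl : IsPicardLindelof f (⟨0, le_rfl, hT.le⟩ : Icc (0 : ℝ) T) x₀ ⟨a, ha0⟩ 0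
      ⟨M * (2 * R), by positivity⟩ ⟨K, hK0⟩ := by
    refine ⟨?_, ?_, ?_, ?_⟩
    · intro t ht
      refine LipschitzOnWith.of_dist_le_mul fun x hx y hy => ?_
      have hx' : ‖x‖ ≤ ‖x₀‖ + a := by
        have := norm_le_norm_add_norm_sub' x x₀
        have h2 : ‖x - x₀‖ ≤ a := by rw [← dist_eq_norm]; exact hx
        linarith
      rw [dist_eq_norm, dist_eq_norm, ← map_sub]
      have e : (c x : ℂ) • x - (c y : ℂ) • y = ((c x - c y : ℝ) : ℂ) • x + (c y : ℂ) • (x - y) := by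
        push_cast; module
      have h1 : ‖(c x : ℂ) • x - (c y : ℂ) • y‖ ≤ ((‖x₀‖ + a) / R + 1) * ‖x - y‖ := by
        rw [e]
        refine (norm_add_le _ _).trans ?_
        rw [norm_smul, norm_smul, Complex.norm_real, Complex.norm_real, Real.norm_eq_abs,
          Real.norm_eq_abs, abs_of_nonneg (hc0 y)]
        have h3 : |c x - c y| * ‖x‖ ≤ ‖x - y‖ / R * (‖x₀‖ + a) := by gcongr; exact hcl x y
        have h4 : c y * ‖x - y‖ ≤ 1 * ‖x - y‖ := by gcongr; exact hc1 y
        calc _ ≤ ‖x - y‖ / R * (‖x₀‖ + a) + 1 * ‖x - y‖ := add_le_add h3 h4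
          _ = _ := by ring
      calc _ ≤ ‖B t‖ * ‖(c x : ℂ) • x - (c y : ℂ) • y‖ := (B t).le_opNorm _
        _ ≤ M * (((‖x₀‖ + a) / R + 1) * ‖x - y‖) := by gcongr; exact hM t ht
        _ = K * ‖x - y‖ := by rw [hK]; ring
    · intro x _
      exact hB.clm_apply continuousOn_const
    · intro t ht x _
      calc _ ≤ ‖B t‖ * ‖(c x : ℂ) • x‖ := (B t).le_opNorm _
        _ ≤ M * (2 * R) := by
          gcongr
          · exact hM t ht
          · rw [norm_smul, Complex.norm_real, Real.norm_eq_abs, abs_of_nonneg (hc0 x)]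
            exact hcx x
    · simp only [sub_zero, sub_self]
      rw [max_eq_left hT.le]
      change M * (2 * R) * T ≤ a - 0
      simp [ha]
  obtain ⟨u, hu0, hu⟩ := hpl.exists_eq_forall_mem_Icc_hasDerivWithinAt₀
  have hcont : ContinuousOn u (Icc 0 T) := fun t ht => (hu t ht).continuousWithinAt
  have hnorm : ∀ t ∈ Icc 0 T, ‖u t‖ ^ 2 = ‖u 0‖ ^ 2 := by
    apply constant_of_has_deriv_right_zero
    · exact (hcont.norm.pow 2)
    · intro t ht
      have h1 : HasDerivWithinAt u (f t (u t)) (Ici t) t :=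
        (hu t ⟨ht.1, ht.2.le⟩).mono_of_mem_nhdsWithin (Icc_mem_nhdsGE_of_mem ht)
      have h2 := hasDerivWithinAt_norm_sq h1
      have h3 : 2 * (inner ℂ (u t) (f t (u t))).re = 0 := by
        have := hskew t ⟨ht.1, ht.2.le⟩ (u t)
        simp [f, this]
      rwa [h3] at h2
  have hnorm' : ∀ t ∈ Icc 0 T, ‖u t‖ = ‖x₀‖ := fun t ht => by
    have := hnorm t ht
    rw [hu0] at this
    exact (pow_left_inj₀ (norm_nonneg _) (norm_nonneg _) two_ne_zero).1 this
  refine ⟨u, hu0, hnorm', fun t ht => ?_⟩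
  have hc : c (u t) = 1 := by
    have : (1 : ℝ) ≤ 2 - ‖u t‖ / R := by
      have : ‖u t‖ / R ≤ 1 := by
        rw [div_le_one hR0, hnorm' t ht, hR]; linarith
      linarith
    simp [c, min_eq_left this]
  have := hu t ht
  simpa [f, hc] using this

end ODE

/-! ### Yosida approximations of the inverse of a positive operator -/

/-- Bounded operators that are symmetric, non-negative and have dense range. -/
structure IsPosDense {H : Type*} [NormedAddCommGroup H] [InnerProductSpace ℂ H]
    (K : H →L[ℂ] H) : Prop where
  symm : ∀ x y, inner ℂ (K x) y = inner ℂ x (K y)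
  nonneg : ∀ x, 0 ≤ (inner ℂ (K x) x).re
  dense : DenseRange K

/-- `(K + ε)⁻¹`, the Yosida approximation of `K⁻¹`. -/
def yosida {H : Type*} [NormedAddCommGroup H] [InnerProductSpace ℂ H]
    (K : H →L[ℂ] H) (ε : ℝ) : H →L[ℂ] H :=
  Ring.inverse (K + (ε : ℂ) • ContinuousLinearMap.id ℂ H)

theorem im_inner_self_eq_zero_of_symm {H : Type*} [NormedAddCommGroup H] [InnerProductSpace ℂ H]
    {S : H →L[ℂ] H} (hS : ∀ x y, inner ℂ (S x) y = inner ℂ x (S y)) (x : H) :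
    (inner ℂ x (S x)).im = 0 := by
  have h := inner_conj_symm (𝕜 := ℂ) x (S x)
  rw [hS] at h
  exact Complex.conj_eq_iff_im.1 h

namespace IsPosDense

variable {H : Type*} [NormedAddCommGroup H] [InnerProductSpace ℂ H] [CompleteSpace H]
  {K : H →L[ℂ] H}

/-- Lax–Milgram: non-negativity of K makes K + ε coercive with constant ε. -/
theorem isUnit_add (hK : IsPosDense K) {ε : ℝ} (hε : 0 < ε) : IsUnit
    (K + (ε : ℂ) • ContinuousLinearMap.id ℂ H) := by
  refine ContinuousLinearMap.isUnit_of_forall_le_norm_inner_map _ (c := ⟨ε, hε.le⟩) hε fun x => ?_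
  have h := hK.nonneg x
  refine le_trans ?_ (Complex.re_le_norm _)
  have : (inner ℂ x x).re = ‖x‖ ^ 2 := inner_self_eq_norm_sq (𝕜 := ℂ) x
  change ‖x‖ ^ 2 * ε ≤ _
  simp only [add_apply, smul_apply,
    ContinuousLinearMap.id_apply, inner_add_left, inner_smul_left, Complex.conj_ofReal,
    Complex.add_re, Complex.re_ofReal_mul, this]
  linarith

theorem map_yosida_add (hK : IsPosDense K) {ε : ℝ} (hε : 0 < ε) (x : H) : K (yosida K ε x) +
    (ε : ℂ) • yosida K ε x = x := by
  have := Ring.mul_inverse_cancel _ (hK.isUnit_add hε)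
  simpa [yosida] using congrArg (fun S : H →L[ℂ] H => S x) this

theorem yosida_map_add (hK : IsPosDense K) {ε : ℝ} (hε : 0 < ε) (x : H) : yosida K ε (K x) +
    (ε : ℂ) • yosida K ε x = x := by
  have := Ring.inverse_mul_cancel _ (hK.isUnit_add hε)
  simpa [yosida] using congrArg (fun S : H →L[ℂ] H => S x) this

theorem map_yosida (hK : IsPosDense K) {ε : ℝ} (hε : 0 < ε) (x : H) : K (yosida K ε x) = yosida K ε
    (K x) := by
  have h1 := hK.map_yosida_add hε x
  have h2 := hK.yosida_map_add hε x
  exact add_right_cancel (h1.trans h2.symm)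

theorem yosida_symm (hK : IsPosDense K) {ε : ℝ} (hε : 0 < ε) (x y : H) : inner ℂ (yosida K ε x) y =
    inner ℂ x (yosida K ε y) := by
  have h1 := congrArg (fun z => inner ℂ (yosida K ε x) z) (hK.map_yosida_add hε y)
  have h2 := congrArg (fun z => inner ℂ z (yosida K ε y)) (hK.map_yosida_add hε x)
  simp only [inner_add_left, inner_add_right, inner_smul_left, inner_smul_right, hK.symm,
    Complex.conj_ofReal] at h1 h2
  exact h1.symm.trans h2

/-- Expand the square of x = K y + ε y with y = (K + ε)⁻¹ x; the cross term is non-negative. -/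
theorem norm_sq_ge (hK : IsPosDense K) {ε : ℝ} (hε : 0 < ε) (x : H) :
    ‖K (yosida K ε x)‖ ^ 2 + (ε * ‖yosida K ε x‖) ^ 2 ≤ ‖x‖ ^ 2 := by
  conv_rhs => rw [← hK.map_yosida_add hε x]
  have h := norm_add_sq (𝕜 := ℂ) (K (yosida K ε x)) ((ε : ℂ) • yosida K ε x)
  rw [h, norm_smul, Complex.norm_real, Real.norm_eq_abs, abs_of_pos hε]
  have : 0 ≤ RCLike.re (inner ℂ (K (yosida K ε x)) ((ε : ℂ) • yosida K ε x)) := by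
    rw [inner_smul_right]
    change 0 ≤ (_ : ℂ).re
    rw [Complex.re_ofReal_mul]
    exact mul_nonneg hε.le (hK.nonneg _)
  linarith

theorem norm_map_yosida_le (hK : IsPosDense K) {ε : ℝ} (hε : 0 < ε) (x : H) : ‖K (yosida K ε x)‖ ≤
    ‖x‖ := by
  have := hK.norm_sq_ge hε x
  exact (sq_le_sq₀ (by positivity) (norm_nonneg _)).1 (by linarith [sq_nonneg (ε * ‖yosida K ε x‖)])

/-- On the range of K the error is ε K (K + ε)⁻¹ y up to sign, of size at most ε ‖y‖. Density of the
range and the uniform contraction bound do the rest. -/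
theorem tendsto_map_yosida (hK : IsPosDense K) {ε : ℕ → ℝ} (hpos : ∀ n, 0 < ε n)
    (hlim : Tendsto ε atTop (𝓝 0)) (x : H) :
    Tendsto (fun n => K (yosida K (ε n) x)) atTop (𝓝 x) := by
  rw [Metric.tendsto_atTop]
  intro δ hδ
  obtain ⟨y, hy⟩ := hK.dense.exists_dist_lt x (show 0 < δ / 3 by positivity)
  have h1 : Tendsto (fun n => ε n * ‖y‖) atTop (𝓝 0) := by simpa using hlim.mul_const ‖y‖
  obtain ⟨N, hN⟩ := (h1.eventually (gt_mem_nhds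
    (show 0 < δ / 3 by positivity))).exists_forall_of_atTop
  refine ⟨N, fun n hn => ?_⟩
  have hy' : ‖x - K y‖ < δ / 3 := by rwa [← dist_eq_norm]
  have e : K (yosida K (ε n) x) - x =
      K (yosida K (ε n) (x - K y)) - (x - K y) - (ε n : ℂ) • K (yosida K (ε n) y) := by
    have := hK.map_yosida_add (hpos n) (K y)
    simp only [map_sub]
    rw [← hK.map_yosida (hpos n) y] at this ⊢
    rw [eq_sub_of_add_eq' this]
    abel
  rw [dist_eq_norm, e]
  have h2 := hK.norm_map_yosida_le (hpos n) (x - K y)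
  have h3 := hK.norm_map_yosida_le (hpos n) y
  have h4 : ‖(ε n : ℂ) • K (yosida K (ε n) y)‖ ≤ ε n * ‖y‖ := by
    rw [norm_smul, Complex.norm_real, Real.norm_eq_abs, abs_of_pos (hpos n)]
    exact mul_le_mul_of_nonneg_left h3 (hpos n).le
  have h5 := hN n hn
  calc _ ≤ ‖K (yosida K (ε n) (x - K y))‖ + ‖x - K y‖ + ‖(ε n : ℂ) • K (yosida K (ε n) y)‖ :=
        (norm_sub_le _ _).trans (by gcongr; exact norm_sub_le _ _)
    _ < δ := by linarith

end IsPosDense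

/-! ### Weak solutions of abstract Schrödinger equations -/

section Abstract

variable {H : Type*} [NormedAddCommGroup H] [InnerProductSpace ℂ H]

/-- A family of symmetric operators on `(0, T)` that is Lipschitz in the operator norm and
bounded. -/
structure IsLipschitzPotential (T : ℝ) (A : ℝ → H →L[ℂ] H) (C M : ℝ) : Prop where
  lipschitz : ∀ s ∈ Ioo 0 T, ∀ t ∈ Ioo 0 T, ‖A s - A t‖ ≤ C * |s - t|
  symm : ∀ t ∈ Ioo 0 T, ∀ x y, inner ℂ (A t x) y = inner ℂ x (A t y)
  bound : ∀ t ∈ Ioo 0 T, ‖A t‖ ≤ M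

/-- The weak form of `i u' = K⁻¹ u + A u`, `u(0) = u₀`, tested with `θ(t) K x`. -/
def IsWeakSolution (T : ℝ) (K : H →L[ℂ] H) (A : ℝ → H →L[ℂ] H) (u₀ : H) (u : ℝ → H) : Prop :=
  ∀ θ : ℝ → ℂ, IsTimeFactor T θ → ∀ x : H,
    ∫ t in Ioo 0 T, inner ℂ ((Complex.I * deriv θ t) • K x - θ t • x - θ t • A t (K x)) (u t)
      = Complex.I * inner ℂ (θ 0 • K x) u₀

theorem IsLipschitzPotential.continuousOn {T C M : ℝ} {A : ℝ → H →L[ℂ] H}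
    (hA : IsLipschitzPotential T A C M) : ContinuousOn A (Ioo 0 T) := by
  have : LipschitzOnWith (Real.toNNReal C) A (Ioo 0 T) :=
    LipschitzOnWith.of_dist_le_mul fun s hs t ht => by
      rw [dist_eq_norm, Real.dist_eq]
      exact (hA.lipschitz s hs t ht).trans (by gcongr; exact Real.le_coe_toNNReal C)
  exact this.continuousOn

theorem IsLipschitzPotential.memLp {T C M : ℝ} {A : ℝ → H →L[ℂ] H}
    (hA : IsLipschitzPotential T A C M) {u : ℝ → H} (hu : MemLp u 2 (timeMeasure T)) :
    MemLp (fun t => A t (u t)) 2 (timeMeasure T) := by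
  have hm : AEStronglyMeasurable A (timeMeasure T) :=
    hA.continuousOn.aestronglyMeasurable measurableSet_Ioo
  refine (hu.norm.const_mul M).of_le ?_ ?_
  · exact (ContinuousLinearMap.id ℂ (H →L[ℂ] H)).aestronglyMeasurable_comp₂ hm
      hu.aestronglyMeasurable
  · filter_upwards [ae_restrict_mem measurableSet_Ioo] with t ht
    refine ((A t).le_of_opNorm_le (hA.bound t ht) _).trans (le_abs_self _)

theorem restrict_Iio_timeMeasure {T t : ℝ} (ht : t ≤ T) :
    (timeMeasure T).restrict (Iio t) = volume.restrict (Ioo 0 t) := by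
  rw [Measure.restrict_restrict measurableSet_Iio]
  congr 1
  ext s
  simp only [mem_inter_iff, mem_Iio, mem_Ioo]
  constructor
  · rintro ⟨h1, h2, _⟩; exact ⟨h2, h1⟩
  · rintro ⟨h1, h2⟩; exact ⟨h2, h1, h2.trans_le ht⟩

theorem setIntegral_Iio_timeMeasure {E : Type*} [NormedAddCommGroup E] [NormedSpace ℝ E]
    {T t : ℝ} (h0 : 0 ≤ t) (ht : t ≤ T) (f : ℝ → E) :
    ∫ s in Iio t, f s ∂(timeMeasure T) = ∫ s in (0 : ℝ)..t, f s := by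
  rw [restrict_Iio_timeMeasure ht, intervalIntegral.integral_of_le h0, integral_Ioc_eq_integral_Ioo]

/-- The right-hand side of `(K u)' = -i (u + K A u)`. -/
def weakDerivative (K : H →L[ℂ] H) (A : ℝ → H →L[ℂ] H) (u : ℝ → H) (t : ℝ) : H :=
  -Complex.I • (u t + K (A t (u t)))

/-- The function `K u₀ - i ∫₀ᵗ (u + K A u)`. -/
def mildForm (T : ℝ) (K : H →L[ℂ] H) (A : ℝ → H →L[ℂ] H) (u₀ : H) (u : ℝ → H) (t : ℝ) : H :=
  K u₀ + ∫ s in Iio t, weakDerivative K A u s ∂(timeMeasure T)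

variable {T C M : ℝ} {A : ℝ → H →L[ℂ] H} {K : H →L[ℂ] H} {u : ℝ → H} {u₀ : H}

theorem memLp_weakDerivative (hA : IsLipschitzPotential T A C M)
    (hu : MemLp u 2 (timeMeasure T)) : MemLp (weakDerivative K A u) 2 (timeMeasure T) :=
  (hu.add (K.comp_memLp' (hA.memLp hu))).const_smul _

theorem integrable_weakDerivative (hA : IsLipschitzPotential T A C M)
    (hu : MemLp u 2 (timeMeasure T)) : Integrable (weakDerivative K A u) (timeMeasure T) :=
  (memLp_weakDerivative hA hu).integrable one_le_two

theorem continuousOn_mildForm (hA : IsLipschitzPotential T A C M)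
    (hu : MemLp u 2 (timeMeasure T)) : ContinuousOn (mildForm T K A u₀ u) (Icc 0 T) := by
  refine continuousOn_const.add ?_
  have h : IntegrableOn (weakDerivative K A u) (Icc 0 T) :=
    (integrableOn_Icc_iff_integrableOn_Ioo).2 (integrable_weakDerivative hA hu)
  refine (intervalIntegral.continuousOn_primitive h).congr fun t ht => ?_
  rw [restrict_Iio_timeMeasure ht.2]
  exact integral_Ioc_eq_integral_Ioo.symm

variable [CompleteSpace H]

/-- Turns an arbitrary test function ζ into an admissible temporal factor: the antiderivative based
at T vanishes there. -/
theorem isTimeFactor_primitive {ζ : ℝ → ℝ} (hζ : Continuous ζ) (T : ℝ) :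
    IsTimeFactor T (fun t => ((∫ s in T..t, ζ s : ℝ) : ℂ)) ∧
    ∀ t, deriv (fun t => ((∫ s in T..t, ζ s : ℝ) : ℂ)) t = ζ t := by
  have h : ∀ t, HasDerivAt (fun t => ((∫ s in T..t, ζ s : ℝ) : ℂ)) (ζ t : ℂ) t := fun t =>
    (hζ.integral_hasStrictDerivAt T t).hasDerivAt.ofReal_comp
  have hd : ∀ t, deriv (fun t => ((∫ s in T..t, ζ s : ℝ) : ℂ)) t = ζ t := fun t => (h t).deriv
  refine ⟨⟨?_, by simp⟩, hd⟩
  refine ContDiff.contDiffOn (contDiff_one_iff_deriv.2 ⟨fun t => (h t).differentiableAt, ?_⟩)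
  rw [funext hd]
  exact Complex.continuous_ofReal.comp hζ

/-- The lemma of du Bois-Reymond in integrated form: test with an antiderivative θ of an arbitrary ζ
and move θ off the right-hand side with the product rule for primitives. -/
theorem map_ae_eq_mildForm (hT : 0 < T) (hK : IsPosDense K) (hA : IsLipschitzPotential T A C M)
    (hu : MemLp u 2 (timeMeasure T)) (hsol : IsWeakSolution T K A u₀ u) :
    ∀ᵐ t ∂timeMeasure T, K (u t) = mildForm T K A u₀ u t := by
  have hp := integrable_weakDerivative (K := K) hA hu
  have hui : Integrable u (timeMeasure T) := hu.integrable one_le_two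
  have hKu : Integrable (fun t => K (u t)) (timeMeasure T) := K.integrable_comp hui
  have hg : Integrable (mildForm T K A u₀ u) (timeMeasure T) :=
    ((continuousOn_mildForm hA hu).integrableOn_Icc).mono_set Ioo_subset_Icc_self
  have key : ∀ᵐ t ∂(volume : Measure ℝ), t ∈ Ioo 0 T → K (u t) - mildForm T K A u₀ u t = 0 := by
    refine isOpen_Ioo.ae_eq_zero_of_integral_contDiff_smul_eq_zero
      (IntegrableOn.locallyIntegrableOn (hKu.sub hg)) fun ζ hζ hζc hζs => ?_
    have hζi : Integrable ζ (timeMeasure T) :=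
      (hζ.continuous.integrable_of_hasCompactSupport hζc).restrict
    obtain ⟨hθ, hθ'⟩ := isTimeFactor_primitive hζ.continuous T
    set θ : ℝ → ℂ := fun t => ((∫ s in T..t, ζ s : ℝ) : ℂ) with hθdef
    obtain ⟨k1, k2, k3⟩ := bilin_integral_integral (ContinuousLinearMap.lsmul ℝ ℝ) hζi hp
    simp only [ContinuousLinearMap.lsmul_apply] at k1 k2 k3
    set Z : ℝ := ∫ t, ζ t ∂timeMeasure T with hZ
    -- Rewrites θ through the primitive based at 0, the form in which the product rule is stated; Z
    -- is the total mass of ζ, and θ(0) = -Z.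
    have hθt : ∀ t ∈ Ioo 0 T, θ t = ((∫ s in Iio t, ζ s ∂timeMeasure T : ℝ) : ℂ) - Z := by
      intro t ht
      rw [setIntegral_Iio_timeMeasure ht.1.le ht.2.le, hθdef, hZ, timeMeasure,
        ← integral_Ioc_eq_integral_Ioo, ← intervalIntegral.integral_of_le hT.le, ←
          Complex.ofReal_sub]
      refine congrArg Complex.ofReal ?_
      rw [intervalIntegral.integral_symm t T, ← intervalIntegral.integral_add_adjacent_intervals
        (hζ.continuous.intervalIntegrable 0 t) (hζ.continuous.intervalIntegrable t T)]
      ring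
    have hθ0 : θ 0 = -Z := by
      rw [hθdef, hZ, timeMeasure, ← integral_Ioc_eq_integral_Ioo,
        ← intervalIntegral.integral_of_le hT.le, ← Complex.ofReal_neg]
      exact congrArg Complex.ofReal (intervalIntegral.integral_symm _ _)
    have hζKu : Integrable (fun t => ζ t • K (u t)) (timeMeasure T) := by
      obtain ⟨B, hB⟩ := hζc.exists_bound_of_continuous hζ.continuous
      exact hKu.bdd_smul (𝕜 := ℝ) B hζ.continuous.aestronglyMeasurable (ae_of_all _ hB)
    have k5 : Integrable (fun t => Z • weakDerivative K A u t) (timeMeasure T) := hp.smul Z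
    have k4 : Integrable (fun t => (∫ s in Iio t, ζ s ∂timeMeasure T) • weakDerivative K A u t -
        Z • weakDerivative K A u t) (timeMeasure T) := k2.sub k5
    -- The weak formulation for θ and all x at once, read as a single identity in H.
    have e1 : ∫ t in Ioo 0 T, (ζ t • K (u t) + ((∫ s in Iio t, ζ s ∂timeMeasure T) •
        weakDerivative K A u t - Z • weakDerivative K A u t)) = Z • K u₀ := by
      refine ext_inner_left ℂ fun x => ?_
      have h := hsol θ hθ x
      have h0 := integral_inner (𝕜 := ℂ) (hζKu.add k4) x
      simp only [Pi.add_apply] at h0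
      rw [← h0]
      have h2 : ∫ t in Ioo 0 T, inner ℂ x (ζ t • K (u t) + ((∫ s in Iio t, ζ s ∂timeMeasure T) •
        weakDerivative K A u t - Z • weakDerivative K A u t)) = Complex.I *
        ∫ t in Ioo 0 T,
          inner ℂ ((Complex.I * deriv θ t) • K x - θ t • x - θ t • A t (K x)) (u t) := by
        rw [← integral_const_mul]
        refine setIntegral_congr_fun measurableSet_Ioo fun t ht => ?_
        rw [hθ' t]
        simp only [inner_sub_left, inner_smul_left, map_mul, Complex.conj_I, hA.symm t ht, hK.symm]
        rw [hθt t ht, map_sub, Complex.conj_ofReal, Complex.conj_ofReal, Complex.conj_ofReal]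
        simp only [weakDerivative, ← Complex.coe_smul, inner_add_right, inner_sub_right,
          inner_smul_right]
        linear_combination ((ζ t : ℂ) * inner ℂ x (K (u t))) * Complex.I_mul_I
      rw [h2, h, hθ0]
      simp only [inner_smul_left, map_neg, Complex.conj_ofReal, hK.symm, ← Complex.coe_smul,
        inner_smul_right]
      linear_combination (-(Z : ℂ) * inner ℂ x (K u₀)) * Complex.I_mul_I
    rw [integral_add hζKu k4, integral_sub k2 k5, integral_smul] at e1
    rw [integral_add k1 k2] at k3
    have e2 : ∫ t in Ioo 0 T, ζ t • mildForm T K A u₀ u t = Z • K u₀ +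
        ∫ t in Ioo 0 T, ζ t • ∫ s in Iio t, weakDerivative K A u s ∂timeMeasure T := by
      simp only [mildForm, smul_add]
      rw [integral_add (hζi.smul_const _) k1, integral_smul_const]
    have hζg : Integrable (fun t => ζ t • mildForm T K A u₀ u t) (timeMeasure T) := by
      obtain ⟨B, hB⟩ := hζc.exists_bound_of_continuous hζ.continuous
      exact hg.bdd_smul (𝕜 := ℝ) B hζ.continuous.aestronglyMeasurable (ae_of_all _ hB)
    have e3 : ∫ t in Ioo 0 T, ζ t • (K (u t) - mildForm T K A u₀ u t) = 0 := by
      simp only [smul_sub]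
      rw [integral_sub hζKu hζg, e2, ← e1, k3]
      abel
    rw [← e3]
    refine (setIntegral_eq_integral_of_forall_compl_eq_zero fun t ht => ?_).symm
    have : ζ t = 0 := image_eq_zero_of_notMem_tsupport fun h => ht (hζs h)
    rw [this, zero_smul]
  rw [timeMeasure, ae_restrict_iff' measurableSet_Ioo]
  filter_upwards [key] with t ht h using sub_eq_zero.1 (ht h)

end Abstract

/-! ### Energy identity, continuous representative and uniqueness for the abstract equation -/

section Abstract

variable {H : Type*} [NormedAddCommGroup H] [InnerProductSpace ℂ H]

/-- The real part of the inner product, as a real bilinear map. -/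
def reInnerCLM (H : Type*) [NormedAddCommGroup H] [InnerProductSpace ℂ H] : H →L[ℝ] H →L[ℝ] ℝ :=
  LinearMap.mkContinuous₂
    (LinearMap.mk₂ ℝ (fun x y : H => (inner ℂ x y).re)
      (fun x y z => by simp)
      (fun c x y => by simp [← Complex.coe_smul, mul_comm])
      (fun x y z => by simp)
      (fun c x y => by simp [← Complex.coe_smul, mul_comm])) 1
    (fun x y => by
      simpa using (Complex.abs_re_le_norm _).trans (norm_inner_le_norm (𝕜 := ℂ) x y))

theorem reInnerCLM_apply (x y : H) : reInnerCLM H x y = (inner ℂ x y).re := rfl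

theorem re_inner_comm (x y : H) : (inner ℂ x y).re = (inner ℂ y x).re :=
  inner_re_symm (𝕜 := ℂ) x y

theorem abs_re_inner_le (x y : H) : |(inner ℂ x y).re| ≤ ‖x‖ * ‖y‖ :=
  (Complex.abs_re_le_norm _).trans (norm_inner_le_norm (𝕜 := ℂ) x y)

theorem norm_sq_eq_re_inner (x : H) : ‖x‖ ^ 2 = (inner ℂ x x).re :=
  (inner_self_eq_norm_sq (𝕜 := ℂ) x).symm

theorem norm_sq_primitive [CompleteSpace H] {μ : Measure ℝ} [SFinite μ] [NullSingletonClass μ]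
    {p : ℝ → H} (hp : Integrable p μ) (z : H) :
    ‖z + ∫ s, p s ∂μ‖ ^ 2 = ‖z‖ ^ 2 +
      ∫ t, 2 * (inner ℂ (p t) (z + ∫ s in Iio t, p s ∂μ)).re ∂μ := by
  obtain ⟨k1, k2, k3⟩ := bilin_integral_integral (reInnerCLM H) hp hp
  simp only [reInnerCLM_apply] at k1 k2 k3
  have e : ∀ t, 2 * (inner ℂ (p t) (z + ∫ s in Iio t, p s ∂μ)).re =
      2 * (inner ℂ z (p t)).re + ((inner ℂ (p t) (∫ s in Iio t, p s ∂μ)).re +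
        (inner ℂ (∫ s in Iio t, p s ∂μ) (p t)).re) := by
    intro t
    rw [inner_add_right, Complex.add_re, re_inner_comm (p t) z,
      re_inner_comm (∫ s in Iio t, p s ∂μ) (p t)]
    ring
  have hz : Integrable (fun t => 2 * (inner ℂ z (p t)).re) μ :=
    (((reInnerCLM H z).integrable_comp hp).const_mul 2)
  have k4 : Integrable (fun t => (inner ℂ (p t) (∫ s in Iio t, p s ∂μ)).re +
        (inner ℂ (∫ s in Iio t, p s ∂μ) (p t)).re) μ := k1.add k2
  simp_rw [e]
  rw [integral_add hz k4, ← k3, integral_const_mul]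
  have h4 : ∫ t, (inner ℂ z (p t)).re ∂μ = (inner ℂ z (∫ s, p s ∂μ)).re :=
    (reInnerCLM H z).integral_comp_comm hp
  rw [h4, norm_sq_eq_re_inner, norm_sq_eq_re_inner, inner_add_left, inner_add_right,
    inner_add_right]
  simp only [Complex.add_re]
  rw [re_inner_comm (∫ s, p s ∂μ) z]
  ring

variable {T C M : ℝ} {A : ℝ → H →L[ℂ] H} {K : H →L[ℂ] H} {u : ℝ → H} {u₀ : H}
variable [CompleteSpace H]

/-- Applying S to the primitive gives K S u almost everywhere, while S applied to its derivative is
-i S u - i K S A u. The real part of the pairing of -i S u with K S u vanishes because K is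
symmetric; only the bounded perturbation A survives. -/
theorem norm_sq_map_mildForm (hT : 0 < T) (hK : IsPosDense K) (hA : IsLipschitzPotential T A C M)
    (hu : MemLp u 2 (timeMeasure T)) (hsol : IsWeakSolution T K A u₀ u)
    (S : H →L[ℂ] H) (hSK : ∀ x, K (S x) = S (K x)) (t : ℝ) :
    ‖S (mildForm T K A u₀ u t)‖ ^ 2 = ‖K (S u₀)‖ ^ 2 +
      ∫ s in Iio t, 2 * (inner ℂ (-Complex.I • K (S (A s (u s)))) (K (S (u s)))).re
        ∂(timeMeasure T) := by
  have hp := integrable_weakDerivative (K := K) hA hu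
  have hSp : Integrable (fun s => S (weakDerivative K A u s)) ((timeMeasure T).restrict (Iio t)) :=
    (S.integrable_comp hp).restrict
  have h := norm_sq_primitive hSp (K (S u₀))
  have e1 : S (mildForm T K A u₀ u t) = K (S u₀) +
      ∫ s in Iio t, S (weakDerivative K A u s) ∂(timeMeasure T) := by
    rw [mildForm, map_add, hSK, S.integral_comp_comm hp.restrict]
  rw [e1, h]
  congr 1
  apply integral_congr_ae
  have hKu := map_ae_eq_mildForm hT hK hA hu hsol
  filter_upwards [ae_restrict_of_ae hKu, ae_restrict_mem measurableSet_Iio] with s hs hst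
  have e2 : K (S u₀) + ∫ r in Iio s, S (weakDerivative K A u r)
      ∂((timeMeasure T).restrict (Iio t)) = K (S (u s)) := by
    rw [Measure.restrict_restrict measurableSet_Iio, Iio_inter_Iio, min_eq_left (le_of_lt hst),
      S.integral_comp_comm hp.restrict, hSK, hSK, ← map_add, hs, mildForm]
  rw [e2]
  have e3 : S (weakDerivative K A u s) =
      -Complex.I • S (u s) + -Complex.I • K (S (A s (u s))) := by
    rw [weakDerivative, map_smul, map_add, smul_add, hSK]
  have e4 : (inner ℂ (-Complex.I • S (u s)) (K (S (u s)))).re = 0 := by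
    have := im_inner_self_eq_zero_of_symm hK.symm (S (u s))
    simp [inner_smul_left, this]
  rw [e3, inner_add_left, Complex.add_re, e4, zero_add]

/-- The sequence `1 / (n + 1)`. -/
def seqEps (n : ℕ) : ℝ := 1 / ((n : ℝ) + 1)

theorem seqEps_pos (n : ℕ) : 0 < seqEps n := by unfold seqEps; positivity

theorem tendsto_seqEps : Tendsto seqEps atTop (𝓝 0) := tendsto_one_div_add_atTop_nhds_zero_nat

theorem uniformCauchySeqOn_of_sq_le {E : Type*} [NormedAddCommGroup E] {F : ℕ → ℝ → E} {s : Set ℝ}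
    {β : ℕ → ℝ} (hβ : Tendsto β atTop (𝓝 0))
    (h : ∀ n m, ∀ t ∈ s, ‖F n t - F m t‖ ^ 2 ≤ β n + β m) : UniformCauchySeqOn F atTop s := by
  rw [Metric.uniformCauchySeqOn_iff]
  intro ε hε
  obtain ⟨N, hN⟩ := (hβ.eventually (gt_mem_nhds
    (show 0 < ε ^ 2 / 2 by positivity))).exists_forall_of_atTop
  refine ⟨N, fun m hm n hn t ht => ?_⟩
  rw [dist_eq_norm]
  have := h m n t ht
  exact lt_of_pow_lt_pow_left₀ 2 hε.le (by linarith [hN m hm, hN n hn])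

/-- Weak solutions have a continuous representative of constant norm. -/
theorem IsWeakSolution.exists_continuous (hT : 0 < T) (hK : IsPosDense K)
    (hA : IsLipschitzPotential T A C M) (hu : MemLp u 2 (timeMeasure T))
    (hsol : IsWeakSolution T K A u₀ u) :
    ∃ ψ : ℝ → H, (∀ᵐ t ∂timeMeasure T, ψ t = u t) ∧ ContinuousOn ψ (Icc 0 T) ∧ ψ 0 = u₀ ∧
      ∀ t ∈ Icc 0 T, ‖ψ t‖ = ‖u₀‖ := by
  have hM : 0 ≤ M := (norm_nonneg _).trans (hA.bound (T / 2) ⟨by linarith, by linarith⟩)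
  set B : ℕ → H →L[ℂ] H := fun n => yosida K (seqEps n) with hB
  set g := mildForm T K A u₀ u with hg
  have hAu := hA.memLp hu
  have hJ : ∀ x, Tendsto (fun n => K (B n x)) atTop (𝓝 x) :=
    hK.tendsto_map_yosida seqEps_pos tendsto_seqEps
  have hJ1 : ∀ n x, ‖K (B n x)‖ ≤ ‖x‖ := fun n => hK.norm_map_yosida_le (seqEps_pos n)
  have hKu := map_ae_eq_mildForm hT hK hA hu hsol
  have hu2 : Integrable (fun t => ‖u t‖ ^ 2) (timeMeasure T) := hu.integrable_norm_pow two_ne_zero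
  have hmeasJ : ∀ n, AEStronglyMeasurable (fun t => K (B n (u t))) (timeMeasure T) := fun n =>
    (K.comp (B n)).continuous.comp_aestronglyMeasurable hu.aestronglyMeasurable
  have hmeasA : ∀ n, AEStronglyMeasurable (fun t => K (B n (A t (u t)))) (timeMeasure T) := fun n =>
    (K.comp (B n)).continuous.comp_aestronglyMeasurable hAu.aestronglyMeasurable
  have hAb : ∀ t ∈ Ioo 0 T, ‖A t (u t)‖ ≤ M * ‖u t‖ := fun t ht =>
    (A t).le_of_opNorm_le (hA.bound t ht) _
  -- the error terms
  set β : ℕ → ℝ := fun n => 2 * ‖K (B n u₀) - u₀‖ ^ 2 +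
    ∫ t, 4 * M * ‖u t‖ * ‖K (B n (u t)) - u t‖ ∂timeMeasure T with hβ
  have hβmeas : ∀ n, AEStronglyMeasurable (fun t => 4 * M * ‖u t‖ * ‖K (B n (u t)) - u t‖)
      (timeMeasure T) := fun n =>
    ((hu.aestronglyMeasurable.norm.const_mul _).mul ((hmeasJ n).sub hu.aestronglyMeasurable).norm)
  have hβbound : ∀ n t, ‖4 * M * ‖u t‖ * ‖K (B n (u t)) - u t‖‖ ≤ 8 * M * ‖u t‖ ^ 2 := by
    intro n t
    rw [Real.norm_eq_abs, abs_of_nonneg (by positivity)]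
    have : ‖K (B n (u t)) - u t‖ ≤ 2 * ‖u t‖ :=
      (norm_sub_le _ _).trans (by linarith [hJ1 n (u t)])
    calc _ ≤ 4 * M * ‖u t‖ * (2 * ‖u t‖) := by gcongr
      _ = _ := by ring
  have hβint : ∀ n, Integrable (fun t => 4 * M * ‖u t‖ * ‖K (B n (u t)) - u t‖) (timeMeasure T) :=
    fun n => (hu2.const_mul (8 * M)).mono' (hβmeas n) (ae_of_all _ (hβbound n))
  have hβlim : Tendsto β atTop (𝓝 0) := by
    have h1 : Tendsto (fun n => 2 * ‖K (B n u₀) - u₀‖ ^ 2) atTop (𝓝 0) := by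
      have := (((hJ u₀).sub_const u₀).norm.pow 2).const_mul 2
      simpa using this
    have h2 : Tendsto (fun n => ∫ t, 4 * M * ‖u t‖ * ‖K (B n (u t)) - u t‖ ∂timeMeasure T) atTop
        (𝓝 (∫ t, (0 : ℝ) ∂timeMeasure T)) := by
      refine tendsto_integral_of_dominated_convergence _ hβmeas (hu2.const_mul (8 * M))
        (fun n => ae_of_all _ (hβbound n)) (ae_of_all _ fun t => ?_)
      have := (((hJ (u t)).sub_const (u t)).norm).const_mul (4 * M * ‖u t‖)
      simpa using this
    simpa using h1.add h2
  -- Energy identity with S the difference of two Yosida approximations; its right-hand side no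
  -- longer depends on t after the integral is extended to the whole interval.
  have hcauchy : UniformCauchySeqOn (fun n t => B n (g t)) atTop (Icc 0 T) := by
    refine uniformCauchySeqOn_of_sq_le hβlim fun n m t ht => ?_
    have h := norm_sq_map_mildForm hT hK hA hu hsol (B n - B m)
      (fun x => by
        simp only [sub_apply, map_sub, hB, hK.map_yosida (seqEps_pos _)]) t
    rw [sub_apply, ← hg] at h
    rw [h]
    simp only [sub_apply, map_sub]
    have h1 : ‖K (B n u₀) - K (B m u₀)‖ ^ 2 ≤
        2 * ‖K (B n u₀) - u₀‖ ^ 2 + 2 * ‖K (B m u₀) - u₀‖ ^ 2 := by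
      have : ‖K (B n u₀) - K (B m u₀)‖ ≤ ‖K (B n u₀) - u₀‖ + ‖K (B m u₀) - u₀‖ := by
        rw [← dist_eq_norm, ← dist_eq_norm, ← dist_eq_norm]; exact dist_triangle_right _ _ _
      nlinarith [norm_nonneg (K (B n u₀) - K (B m u₀)),
        sq_nonneg (‖K (B n u₀) - u₀‖ - ‖K (B m u₀) - u₀‖)]
    have h2 : ∫ s in Iio t, 2 * (inner ℂ (-Complex.I • (K (B n (A s (u s))) - K (B m (A s (u s)))))
        (K (B n (u s)) - K (B m (u s)))).re ∂timeMeasure T ≤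
        (∫ t, 4 * M * ‖u t‖ * ‖K (B n (u t)) - u t‖ ∂timeMeasure T) +
        ∫ t, 4 * M * ‖u t‖ * ‖K (B m (u t)) - u t‖ ∂timeMeasure T := by
      rw [← integral_add (hβint n) (hβint m)]
      refine (integral_mono_of_nonneg (f := fun s => |2 * (inner ℂ (-Complex.I •
        (K (B n (A s (u s))) - K (B m (A s (u s))))) (K (B n (u s)) - K (B m (u s)))).re|)
        (ae_of_all _ fun _ => abs_nonneg _) ((hβint n).add (hβint m)).restrict ?_).trans
        (setIntegral_le_integral ((hβint n).add (hβint m)) (ae_of_all _ fun s => by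
          simp only [Pi.zero_apply, Pi.add_apply]; positivity)) |>
            (le_trans (le_trans (le_abs_self _)
            (abs_integral_le_integral_abs)))
      filter_upwards [ae_restrict_of_ae (ae_restrict_mem measurableSet_Ioo)] with s hs
      rw [abs_mul, abs_two]
      have k1 := abs_re_inner_le (-Complex.I • (K (B n (A s (u s))) - K (B m (A s (u s)))))
        (K (B n (u s)) - K (B m (u s)))
      have k2 : ‖-Complex.I • (K (B n (A s (u s))) - K (B m (A s (u s))))‖ ≤ 2 * (M * ‖u s‖) := by
        rw [norm_smul, norm_neg, Complex.norm_I, one_mul]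
        refine (norm_sub_le _ _).trans ?_
        have := hAb s hs
        linarith [hJ1 n (A s (u s)), hJ1 m (A s (u s))]
      have k3 : ‖K (B n (u s)) - K (B m (u s))‖ ≤ ‖K (B n (u s)) - u s‖ + ‖K (B m (u s)) - u s‖ :=
        by
        rw [← dist_eq_norm, ← dist_eq_norm, ← dist_eq_norm]; exact dist_triangle_right _ _ _
      calc _ ≤ 2 * ((2 * (M * ‖u s‖)) * (‖K (B n (u s)) - u s‖ + ‖K (B m (u s)) - u s‖)) := by
            gcongr
            exact k1.trans (by gcongr)
        _ = _ := by simp only [Pi.add_apply]; ring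
    simp only [hβ]
    linarith
  choose! ψ hψ using fun t (ht : t ∈ Icc 0 T) => cauchySeq_tendsto_of_complete
    (hcauchy.cauchySeq ht)
  have hunif := hcauchy.tendstoUniformlyOn_of_tendsto hψ
  have h0 : (0 : ℝ) ∈ Icc 0 T := ⟨le_rfl, hT.le⟩
  refine ⟨ψ, ?_, ?_, ?_, fun t ht => ?_⟩
  · filter_upwards [hKu, ae_restrict_mem measurableSet_Ioo] with t ht htI
    refine tendsto_nhds_unique (hψ t (Ioo_subset_Icc_self htI)) ?_
    refine (hJ (u t)).congr fun n => ?_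
    rw [hg, ← ht, hK.map_yosida (seqEps_pos _)]
  · exact hunif.continuousOn (Eventually.frequently (Eventually.of_forall fun n =>
      (B n).continuous.comp_continuousOn (continuousOn_mildForm hA hu)))
  · refine tendsto_nhds_unique (hψ 0 h0) ((hJ u₀).congr fun n => ?_)
    have : g 0 = K u₀ := by
      rw [hg, mildForm, setIntegral_Iio_timeMeasure le_rfl hT.le]; simp
    rw [this, hK.map_yosida (seqEps_pos _)]
  · have h1 := (hψ t ht).norm.pow 2
    -- Energy identity with S a single Yosida approximation. In the limit the integrand becomes 2 Re
    -- (-i A u, u), which vanishes by symmetry of A.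
    have h2 : Tendsto (fun n => ‖B n (g t)‖ ^ 2) atTop (𝓝 (‖u₀‖ ^ 2 + ∫ s in Iio t,
        2 * (inner ℂ (-Complex.I • A s (u s)) (u s)).re ∂timeMeasure T)) := by
      have e := fun n => norm_sq_map_mildForm hT hK hA hu hsol (B n)
        (hK.map_yosida (seqEps_pos _)) t
      rw [← hg] at e
      simp_rw [e]
      refine ((hJ u₀).norm.pow 2).add ?_
      refine tendsto_integral_of_dominated_convergence (fun s => 2 * M * ‖u s‖ ^ 2) (fun n => ?_)
        ((hu2.const_mul (2 * M)).restrict) (fun n => ?_) (ae_of_all _ fun s => ?_)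
      · exact (((Complex.continuous_re.comp_aestronglyMeasurable
          (((hmeasA n).const_smul _).inner (hmeasJ n))).const_mul 2)).restrict
      · filter_upwards [ae_restrict_of_ae (ae_restrict_mem measurableSet_Ioo)] with s hs
        rw [Real.norm_eq_abs, abs_mul, abs_two]
        have k1 := abs_re_inner_le (-Complex.I • K (B n (A s (u s)))) (K (B n (u s)))
        rw [norm_smul, norm_neg, Complex.norm_I, one_mul] at k1
        have k2 := (hJ1 n (A s (u s))).trans (hAb s hs)
        have k3 := hJ1 n (u s)
        calc _ ≤ 2 * ((M * ‖u s‖) * ‖u s‖) := by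
              gcongr
              exact k1.trans (by gcongr)
          _ = _ := by ring
      · exact (Complex.continuous_re.tendsto _).comp
          (((hJ (A s (u s))).const_smul _).inner (hJ (u s))) |>.const_mul 2
    have h3 : ∫ s in Iio t, 2 * (inner ℂ (-Complex.I • A s (u s)) (u s)).re ∂timeMeasure T = 0 := by
      refine integral_eq_zero_of_ae ?_
      filter_upwards [ae_restrict_of_ae (ae_restrict_mem measurableSet_Ioo)] with s hs
      have := im_inner_self_eq_zero_of_symm (hA.symm s hs) (u s)
      rw [← hA.symm s hs] at this
      simp [inner_smul_left, this]
    rw [h3, add_zero] at h2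
    have := tendsto_nhds_unique h1 h2
    exact (pow_left_inj₀ (norm_nonneg _) (norm_nonneg _) two_ne_zero).1 this

theorem IsTimeFactor.hasDerivAt {T : ℝ} {θ : ℝ → ℂ} (hθ : IsTimeFactor T θ) {t : ℝ}
    (ht : t ∈ Ioo 0 T) : HasDerivAt θ (deriv θ t) t :=
  ((hθ.1.differentiableOn one_ne_zero).differentiableAt (Icc_mem_nhds ht.1 ht.2)).hasDerivAt

theorem IsTimeFactor.continuousOn {T : ℝ} {θ : ℝ → ℂ} (hθ : IsTimeFactor T θ) :
    ContinuousOn θ (Icc 0 T) := hθ.1.continuousOn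

theorem memLp_top_of_continuousOn {E : Type*} [NormedAddCommGroup E] {T : ℝ} {f g : ℝ → E}
    (hf : ContinuousOn f (Icc 0 T)) (hfg : ∀ t ∈ Ioo 0 T, g t = f t) :
    MemLp g ∞ (timeMeasure T) := by
  obtain ⟨C, hC⟩ := isCompact_Icc.exists_bound_of_continuousOn hf
  have h : MemLp f ∞ (timeMeasure T) := by
    refine memLp_top_of_bound ((hf.mono Ioo_subset_Icc_self).aestronglyMeasurable
      measurableSet_Ioo) C ?_
    filter_upwards [ae_restrict_mem measurableSet_Ioo] with t ht using hC t (Ioo_subset_Icc_self ht)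
  refine h.ae_eq ?_
  filter_upwards [ae_restrict_mem measurableSet_Ioo] with t ht using (hfg t ht).symm

theorem IsTimeFactor.memLp {T : ℝ} {θ : ℝ → ℂ} (hθ : IsTimeFactor T θ) :
    MemLp θ ∞ (timeMeasure T) :=
  memLp_top_of_continuousOn hθ.continuousOn fun _ _ => rfl

/-- Outside [0, T] nothing is known about θ, so the bound comes from the one-sided derivative on the
closed interval, which agrees with `deriv` in the interior. -/
theorem IsTimeFactor.memLp_deriv {T : ℝ} (hT : 0 < T) {θ : ℝ → ℂ} (hθ : IsTimeFactor T θ) :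
    MemLp (deriv θ) ∞ (timeMeasure T) :=
  memLp_top_of_continuousOn (hθ.1.continuousOn_derivWithin (uniqueDiffOn_Icc hT) le_rfl)
    fun _ ht => (derivWithin_of_mem_nhds (Icc_mem_nhds ht.1 ht.2)).symm

theorem IsTimeFactor.memLp_test (hT : 0 < T) (hA : IsLipschitzPotential T A C M) {θ : ℝ → ℂ}
    (hθ : IsTimeFactor T θ) (z x y : H) :
    MemLp (fun t => (Complex.I * deriv θ t) • z - θ t • x - θ t • A t y) 2 (timeMeasure T) := by
  have h1 : MemLp (fun t => (Complex.I * deriv θ t) • z) 2 (timeMeasure T) :=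
    MemLp.smul (p := ∞) (q := 2) (f := fun _ => z) (memLp_const _)
      ((hθ.memLp_deriv hT).const_mul Complex.I)
  have h2 : MemLp (fun t => θ t • x) 2 (timeMeasure T) :=
    MemLp.smul (p := ∞) (q := 2) (f := fun _ => x) (memLp_const _) hθ.memLp
  have h3 : MemLp (fun t => θ t • A t y) 2 (timeMeasure T) :=
    MemLp.smul (p := ∞) (q := 2) (hA.memLp (memLp_const _)) hθ.memLp
  exact (h1.sub h2).sub h3

theorem integrable_inner_of_memLp {u v : ℝ → H} (hu : MemLp u 2 (timeMeasure T))
    (hv : MemLp v 2 (timeMeasure T)) : Integrable (fun t => inner ℂ (u t) (v t)) (timeMeasure T) :=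
      by
  refine (hu.norm.integrable_mul hv.norm).mono' (hu.aestronglyMeasurable.inner
    hv.aestronglyMeasurable) (ae_of_all _ fun t => norm_inner_le_norm _ _)

/-- The difference solves the problem with initial value 0, and its norm is constant in time. -/
theorem IsWeakSolution.ae_eq (hT : 0 < T) (hK : IsPosDense K)
    (hA : IsLipschitzPotential T A C M) {v : ℝ → H} (hu : MemLp u 2 (timeMeasure T))
    (hv : MemLp v 2 (timeMeasure T)) (hsu : IsWeakSolution T K A u₀ u)
    (hsv : IsWeakSolution T K A u₀ v) : u =ᵐ[timeMeasure T] v := by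
  have hs : IsWeakSolution T K A 0 (fun t => u t - v t) := by
    intro θ hθ x
    have hθ1 := hθ.memLp_test hT hA (K x) x (K x)
    simp only [inner_sub_right _ (u _), inner_zero_right, mul_zero]
    rw [integral_sub (integrable_inner_of_memLp hθ1 hu) (integrable_inner_of_memLp hθ1 hv),
      hsu θ hθ x, hsv θ hθ x, sub_self]
  obtain ⟨ψ, h1, h2, h3, h4⟩ := hs.exists_continuous hT hK hA (hu.sub hv)
  filter_upwards [h1, ae_restrict_mem measurableSet_Ioo] with t ht htI
  have := h4 t (Ioo_subset_Icc_self htI)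
  rw [norm_zero, norm_eq_zero] at this
  rw [this] at ht
  exact (sub_eq_zero.1 ht.symm)

end Abstract

/-! ### Evolution with a bounded Hamiltonian, and weak compactness -/

section Abstract

variable {H : Type*} [NormedAddCommGroup H] [InnerProductSpace ℂ H] [CompleteSpace H]

/-- Existence and energy estimate for bounded Hamiltonians. -/
theorem exists_evolution_energy {T : ℝ} (hT : 0 < T) {B : H →L[ℂ] H}
    (hB : ∀ x y, inner ℂ (B x) y = inner ℂ x (B y)) {A : ℝ → H →L[ℂ] H} {C M : ℝ}
    (hAl : ∀ s t, ‖A s - A t‖ ≤ C * |s - t|)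
    (hAs : ∀ t x y, inner ℂ (A t x) y = inner ℂ x (A t y)) (hAb : ∀ t, ‖A t‖ ≤ M) (x₀ : H) :
    ∃ u : ℝ → H, u 0 = x₀ ∧ (∀ t ∈ Icc 0 T, ‖u t‖ = ‖x₀‖) ∧
      (∀ t ∈ Icc 0 T, HasDerivWithinAt u (-Complex.I • (B (u t) + A t (u t))) (Icc 0 T) t) ∧
      ∀ t ∈ Icc 0 T, (inner ℂ (u t) (B (u t))).re ≤
        (inner ℂ x₀ (B x₀)).re + (2 * M + C * T) * ‖x₀‖ ^ 2 := by
  have hC : 0 ≤ C := by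
    have := (norm_nonneg _).trans (hAl 0 1)
    simpa using this
  have hAc : Continuous A := by
    have : LipschitzWith (Real.toNNReal C) A :=
      LipschitzWith.of_dist_le_mul fun s t => by
        rw [dist_eq_norm, Real.dist_eq, Real.coe_toNNReal _ hC]
        exact hAl s t
    exact this.continuous
  have hsk : ∀ t x, (inner ℂ x (-Complex.I • (B x + A t x))).re = 0 := by
    intro t x
    have h1 := im_inner_self_eq_zero_of_symm hB x
    have h2 := im_inner_self_eq_zero_of_symm (hAs t) x
    simp [inner_smul_right, h1, h2]
  obtain ⟨u, hu0, hun, hud⟩ := exists_isometric_evolution hT (fun t => -Complex.I • (B + A t))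
    (by fun_prop : Continuous fun t => -Complex.I • (B + A t)).continuousOn
    (fun t _ x => by simpa using hsk t x) x₀
  have hud' : ∀ t ∈ Icc 0 T,
      HasDerivWithinAt u (-Complex.I • (B (u t) + A t (u t))) (Icc 0 T) t := fun t ht => by
    simpa using hud t ht
  have huc : ContinuousOn u (Icc 0 T) := fun t ht => (hud' t ht).continuousWithinAt
  refine ⟨u, hu0, hun, hud', fun t ht => ?_⟩
  have hre : ∀ t ∈ Icc 0 T, |(inner ℂ (u t) (A t (u t))).re| ≤ M * ‖x₀‖ ^ 2 := by
    intro t ht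
    refine (abs_re_inner_le _ _).trans ?_
    have := (A t).le_of_opNorm_le (hAb t) (u t)
    rw [hun t ht] at *
    calc ‖x₀‖ * ‖A t (u t)‖ ≤ ‖x₀‖ * (M * ‖x₀‖) := by gcongr
      _ = _ := by ring
  set Q : ℝ → ℝ := fun t => (inner ℂ (u t) (B (u t) + A t (u t))).re with hQ
  have hQc : ContinuousOn Q (Icc 0 T) :=
    Complex.continuous_re.comp_continuousOn (huc.inner
      ((B.continuous.comp_continuousOn huc).add (hAc.continuousOn.clm_apply huc)))
  -- The energy Q need not be differentiable, since A is only Lipschitz; a bound on its right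
  -- difference quotients is enough.
  have hmain : ∀ ⦃t⦄, t ∈ Icc 0 T → Q t ≤ Q 0 + C * ‖x₀‖ ^ 2 * t := by
    refine image_le_of_liminf_slope_right_le_deriv_boundary hQc
      (B := fun t => Q 0 + C * ‖x₀‖ ^ 2 * t) (B' := fun _ => C * ‖x₀‖ ^ 2) (by simp) (by fun_prop)
      (fun x _ => by
        have := ((hasDerivAt_id x).const_mul (C * ‖x₀‖ ^ 2)).const_add (Q 0)
        simpa using this.hasDerivWithinAt) ?_
    intro x hx r hr
    have hxI : x ∈ Icc 0 T := ⟨hx.1, hx.2.le⟩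
    have hd : HasDerivWithinAt u (-Complex.I • (B (u x) + A x (u x))) (Ici x) x :=
      (hud' x hxI).mono_of_mem_nhdsWithin (Icc_mem_nhdsGE_of_mem hx)
    -- Freeze A at time x. The frozen energy has derivative 0 at x because the Hamiltonian is
    -- symmetric, and unfreezing costs at most C (z - x) ‖x₀‖².
    set S : H →L[ℂ] H := B + A x with hS
    have hSs : ∀ y z, inner ℂ (S y) z = inner ℂ y (S z) := fun y z => by
      simp only [hS, add_apply, inner_add_left, inner_add_right, hB, hAs]
    have hd2 : HasDerivWithinAt (fun z => (inner ℂ (u z) (S (u z))).re) 0 (Ici x) x := by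
      have hSd : HasDerivWithinAt (fun z => S (u z)) (S (-Complex.I • (B (u x) + A x (u x))))
          (Ici x) x :=
        ((S.restrictScalars ℝ).hasFDerivAt).comp_hasDerivWithinAt x hd
      refine (hasDerivWithinAt_re_inner hd hSd).congr_deriv ?_
      have e : B (u x) + A x (u x) = S (u x) := by simp [hS]
      rw [e, ← hSs]
      simp only [inner_smul_left, inner_smul_right]
      simp
    have hsl := (hasDerivWithinAt_iff_tendsto_slope.1 hd2)
    rw [Ici_sdiff_left] at hsl
    have hev := hsl.eventually (gt_mem_nhds (show 0 < r - C * ‖x₀‖ ^ 2 by linarith))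
    have hev2 : ∀ᶠ z in 𝓝[>] x, z ∈ Ioc x T := Ioc_mem_nhdsGT hx.2
    refine (hev.and hev2).frequently.mono fun z ⟨hz, hzI⟩ => ?_
    have hzT : z ∈ Icc 0 T := ⟨hx.1.trans hzI.1.le, hzI.2⟩
    have hpos : 0 < z - x := sub_pos.2 hzI.1
    rw [slope_def_field] at hz ⊢
    have hdiff : Q z - Q x ≤ ((inner ℂ (u z) (S (u z))).re - (inner ℂ (u x) (S (u x))).re) +
        C * (z - x) * ‖x₀‖ ^ 2 := by
      have e1 : Q x = (inner ℂ (u x) (S (u x))).re := by simp [hQ, hS]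
      have e2 : Q z = (inner ℂ (u z) (S (u z))).re + (inner ℂ (u z) ((A z - A x) (u z))).re := by
        simp only [hQ, hS, add_apply, sub_apply, inner_add_right, inner_sub_right, Complex.add_re,
          Complex.sub_re]
        ring
      have e3 : (inner ℂ (u z) ((A z - A x) (u z))).re ≤ C * (z - x) * ‖x₀‖ ^ 2 := by
        refine (le_abs_self _).trans ((abs_re_inner_le _ _).trans ?_)
        have := (A z - A x).le_of_opNorm_le (hAl z x) (u z)
        rw [abs_of_pos hpos] at this
        rw [hun z hzT] at *
        calc ‖x₀‖ * ‖(A z - A x) (u z)‖ ≤ ‖x₀‖ * (C * (z - x) * ‖x₀‖) := by gcongr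
          _ = _ := by ring
      rw [e1, e2]; linarith
    calc (Q z - Q x) / (z - x) ≤ (((inner ℂ (u z) (S (u z))).re - (inner ℂ (u x) (S (u x))).re) +
        C * (z - x) * ‖x₀‖ ^ 2) / (z - x) := by gcongr
      _ = ((inner ℂ (u z) (S (u z))).re - (inner ℂ (u x) (S (u x))).re) / (z - x) +
          C * ‖x₀‖ ^ 2 := by field_simp
      _ < r := by linarith
  have h1 := hmain ht
  have h2 := (abs_le.1 (hre t ht)).1
  have h3 := (abs_le.1 (hre 0 ⟨le_rfl, hT.le⟩)).2
  simp only [hQ, inner_add_right, Complex.add_re, hu0] at h1 h3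
  have h4 : C * ‖x₀‖ ^ 2 * t ≤ C * T * ‖x₀‖ ^ 2 := by
    have := ht.2
    calc C * ‖x₀‖ ^ 2 * t ≤ C * ‖x₀‖ ^ 2 * T := by gcongr
      _ = _ := by ring
  nlinarith

/-- Weak limits along an ultrafilter. -/
theorem exists_weak_limit {x : ℕ → H} {R : ℝ} (hx : ∀ n, ‖x n‖ ≤ R) :
    ∃ y : H, ∀ z : H, Tendsto (fun n => inner ℂ z (x n)) (hyperfilter ℕ) (𝓝 (inner ℂ z y)) := by
  -- Bounded scalars always converge along an ultrafilter. The limits are automatically linear in z,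
  -- so neither separability nor a diagonal sequence is needed.
  have hlim : ∀ z, ∃ c : ℂ, ‖c‖ ≤ R * ‖z‖ ∧
      Tendsto (fun n => inner ℂ (x n) z) (hyperfilter ℕ) (𝓝 c) := by
    intro z
    have hmem : ∀ n, inner ℂ (x n) z ∈ Metric.closedBall (0 : ℂ) (R * ‖z‖) := fun n => by
      rw [mem_closedBall_zero_iff]
      exact (norm_inner_le_norm _ _).trans (by gcongr; exact hx n)
    obtain ⟨c, hc, hc'⟩ := (isCompact_closedBall (0 : ℂ) (R * ‖z‖)).ultrafilter_le_nhds
      ((hyperfilter ℕ).map fun n => inner ℂ (x n) z)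
      (le_principal_iff.2 (Filter.mem_map.2 (Eventually.of_forall hmem)))
    exact ⟨c, by simpa using hc, hc'⟩
  choose ℓ hb hℓ using hlim
  let L : H →L[ℂ] ℂ := LinearMap.mkContinuous
    { toFun := ℓ
      map_add' := fun a b => tendsto_nhds_unique (hℓ (a + b)) (by
        simpa only [inner_add_right] using (hℓ a).add (hℓ b))
      map_smul' := fun c a => tendsto_nhds_unique (hℓ (c • a)) (by
        simpa only [inner_smul_right, RingHom.id_apply, smul_eq_mul] using (hℓ a).const_mul c) } R
          hb
  refine ⟨(InnerProductSpace.toDual ℂ H).symm L, fun z => ?_⟩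
  have h1 : inner ℂ ((InnerProductSpace.toDual ℂ H).symm L) z = ℓ z :=
    InnerProductSpace.toDual_symm_apply
  have h2 := (Complex.continuous_conj.tendsto _).comp (hℓ z)
  rw [← h1, inner_conj_symm] at h2
  refine h2.congr fun n => ?_
  simp [inner_conj_symm]

end Abstract

/-! ### Variational solution operators and the Yosida-regularised problem -/

section Abstract

/-- `G : H → V` solves the variational problem `(D G x, D v) = (x, J v)` for all `v ∈ V`, where
`‖D ·‖` is an equivalent norm on `V`. -/
structure IsSolutionOperator {H V Y : Type*} [NormedAddCommGroup H] [InnerProductSpace ℂ H]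
    [NormedAddCommGroup V] [InnerProductSpace ℂ V] [NormedAddCommGroup Y] [InnerProductSpace ℂ Y]
    (J : V →L[ℂ] H) (D : V →L[ℂ] Y) (G : H →L[ℂ] V) : Prop where
  spec : ∀ x v, inner ℂ (D (G x)) (D v) = inner ℂ x (J v)
  dense : DenseRange J
  coercive : ∃ c : ℝ, ∀ v, ‖v‖ ≤ c * ‖D v‖

variable {H V Y : Type*} [NormedAddCommGroup H] [InnerProductSpace ℂ H] [CompleteSpace H]
  [NormedAddCommGroup V] [InnerProductSpace ℂ V] [CompleteSpace V]
  [NormedAddCommGroup Y] [InnerProductSpace ℂ Y]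
  {J : V →L[ℂ] H} {D : V →L[ℂ] Y} {G : H →L[ℂ] V}

theorem IsSolutionOperator.inner_left (hG : IsSolutionOperator J D G) (x : H) (v : V) :
    inner ℂ (J v) x = inner ℂ (D v) (D (G x)) := by
  rw [← inner_conj_symm, ← hG.spec, inner_conj_symm]

/-- The form (K x, x) equals ‖D G x‖². If x is orthogonal to the range it therefore satisfies D G x
= 0, so x is orthogonal to the dense range of J. -/
theorem IsSolutionOperator.isPosDense (hG : IsSolutionOperator J D G) :
    IsPosDense (J.comp G) := by
  have hsymm : ∀ x y, inner ℂ ((J.comp G) x) y = inner ℂ x ((J.comp G) y) := fun x y => by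
    rw [ContinuousLinearMap.comp_apply, ContinuousLinearMap.comp_apply, hG.inner_left, hG.spec]
  refine ⟨hsymm, fun x => ?_, ?_⟩
  · rw [ContinuousLinearMap.comp_apply, hG.inner_left, ← norm_sq_eq_re_inner]
    positivity
  · have : ((J.comp G).range).topologicalClosure = ⊤ := by
      rw [Submodule.topologicalClosure_eq_top_iff, Submodule.eq_bot_iff]
      intro x hx
      have h1 : inner ℂ ((J.comp G) x) x = 0 := hx _ ⟨x, rfl⟩
      rw [ContinuousLinearMap.comp_apply, hG.inner_left, inner_self_eq_zero] at h1
      have h2 : ∀ v, inner ℂ x (J v) = 0 := fun v => by rw [← hG.spec, h1, inner_zero_left]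
      exact hG.dense.eq_zero_of_inner_left ℂ h2
    exact (Submodule.dense_iff_topologicalClosure_eq_top.2 this)

/-- The clamped time `max τ (min t (T - τ))`. -/
def clampTime (T τ t : ℝ) : ℝ := max τ (min t (T - τ))

/-- The potential is controlled only on the open interval; evaluating it at the clamped time gives a
family defined on all of ℝ with the same bounds. -/
theorem clampTime_mem {T τ : ℝ} (h0 : 0 < τ) (h1 : 2 * τ < T) (t : ℝ) :
    clampTime T τ t ∈ Ioo 0 T :=
  ⟨lt_max_of_lt_left h0, max_lt (by linarith) ((min_le_right _ _).trans_lt (by linarith))⟩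

theorem abs_clampTime_sub_le (T τ s t : ℝ) : |clampTime T τ s - clampTime T τ t| ≤ |s - t| := by
  have h1 := abs_max_sub_max_le_max τ (min s (T - τ)) τ (min t (T - τ))
  have h2 := abs_min_sub_min_le_max s (T - τ) t (T - τ)
  simp only [sub_self, abs_zero] at h1 h2
  rw [max_eq_right (abs_nonneg (min s (T - τ) - min t (T - τ)))] at h1
  rw [max_eq_left (abs_nonneg (s - t))] at h2
  exact h1.trans h2

theorem abs_clampTime_sub_self_le {T τ t : ℝ} (h0 : 0 < τ) (h1 : 2 * τ < T) (ht : t ∈ Ioo 0 T) :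
    |clampTime T τ t - t| ≤ τ := by
  obtain ⟨h2, h3⟩ := ht
  unfold clampTime
  rw [abs_le]
  rcases le_total t (T - τ) with h | h
  · rw [min_eq_left h]
    rcases le_total τ t with h' | h'
    · rw [max_eq_right h']; constructor <;> linarith
    · rw [max_eq_left h']; constructor <;> linarith
  · rw [min_eq_right h, max_eq_right (by linarith)]; constructor <;> linarith

variable {T C M : ℝ} {A : ℝ → H →L[ℂ] H}

/-- The approximate problem with the Yosida approximation of the Hamiltonian. -/
theorem exists_yosida_solution (hT : 0 < T) (hG : IsSolutionOperator J D G)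
    (hA : IsLipschitzPotential T A C M) (v₀ : V) {τ : ℝ} (h0 : 0 < τ) (h1 : 2 * τ < T)
    {ε : ℝ} (hε : 0 < ε) :
    ∃ u : ℝ → H, ContinuousOn u (Icc 0 T) ∧ (∀ t ∈ Icc 0 T, ‖u t‖ = ‖J v₀‖) ∧
      (∀ t ∈ Icc 0 T, ‖D (G (yosida (J.comp G) ε (u t)))‖ ^ 2 + ε * ‖yosida (J.comp G) ε (u t)‖ ^ 2
        ≤
        ‖D v₀‖ ^ 2 + (2 * M + C * T) * ‖J v₀‖ ^ 2) ∧
      ∀ θ : ℝ → ℂ, IsTimeFactor T θ → ∀ x : H,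
        ∫ t in Ioo 0 T, inner ℂ ((Complex.I * deriv θ t) • x - θ t • yosida (J.comp G) ε x -
          θ t • A (clampTime T τ t) x) (u t) = Complex.I * inner ℂ (θ 0 • x) (J v₀) := by
  have hK := hG.isPosDense
  have hC : 0 ≤ C := by
    have := (norm_nonneg _).trans (hA.lipschitz (T / 3) ⟨by linarith, by linarith⟩ (T / 2)
      ⟨by linarith, by linarith⟩)
    refine nonneg_of_mul_nonneg_left this (abs_pos.2 (by linarith))
  set B := yosida (J.comp G) ε with hBdef
  have hBs := hK.yosida_symm hε
  -- Pair x = K B x + ε B x with B x: the energy of the regularised Hamiltonian controls the V-norm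
  -- of G B x and also ε ‖B x‖².
  have hid : ∀ x, inner ℂ x (B x) = ((‖D (G (B x))‖ ^ 2 + ε * ‖B x‖ ^ 2 : ℝ) : ℂ) := by
    intro x
    have h := congrArg (fun z => inner ℂ z (B x)) (hK.map_yosida_add hε x)
    simp only [← hBdef] at h
    rw [← h, inner_add_left, inner_smul_left, ContinuousLinearMap.comp_apply, hG.inner_left,
      inner_self_eq_norm_sq_to_K, inner_self_eq_norm_sq_to_K]
    simp
  obtain ⟨u, hu0, hun, hud, hue⟩ := exists_evolution_energy hT hBs
    (A := fun t => A (clampTime T τ t)) (C := C) (M := M)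
    (fun s t => (hA.lipschitz _ (clampTime_mem h0 h1 s) _ (clampTime_mem h0 h1 t)).trans
      (mul_le_mul_of_nonneg_left (abs_clampTime_sub_le T τ s t) hC))
    (fun t => hA.symm _ (clampTime_mem h0 h1 t)) (fun t => hA.bound _ (clampTime_mem h0 h1 t))
      (J v₀)
  have huc : ContinuousOn u (Icc 0 T) := fun t ht => (hud t ht).continuousWithinAt
  -- This is where the initial value has to lie in V. With y = G B J v₀ the energy equals the real
  -- part of (D v₀, D y) and dominates ‖D y‖², whence ‖D y‖ ≤ ‖D v₀‖.
  have hinit : (inner ℂ (J v₀) (B (J v₀))).re ≤ ‖D v₀‖ ^ 2 := by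
    have e1 := hid (J v₀)
    have e2 := hG.inner_left (B (J v₀)) v₀
    have e3 : (inner ℂ (J v₀) (B (J v₀))).re ≤ ‖D v₀‖ * ‖D (G (B (J v₀)))‖ := by
      rw [e2]; exact (le_abs_self _).trans (abs_re_inner_le _ _)
    have e4 : ‖D (G (B (J v₀)))‖ ^ 2 ≤ (inner ℂ (J v₀) (B (J v₀))).re := by
      rw [e1, Complex.ofReal_re]; nlinarith [sq_nonneg ‖B (J v₀)‖]
    have e5 : ‖D (G (B (J v₀)))‖ ≤ ‖D v₀‖ := by
      by_contra! h
      nlinarith [norm_nonneg (D v₀), norm_nonneg (D (G (B (J v₀))))]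
    exact e3.trans (by rw [sq]; gcongr)
  refine ⟨u, huc, hun, fun t ht => ?_, fun θ hθ x => ?_⟩
  · have := hue t ht
    rw [hid, Complex.ofReal_re] at this
    linarith
  · have hBx : ∀ t ∈ Icc 0 T, inner ℂ x (B (u t)) = inner ℂ (B x) (u t) := fun t _ => (hBs _ _).symm
    set F : ℝ → ℂ := fun t => inner ℂ (θ t • x) (u t) with hF
    set S : ℝ → H := fun t => (Complex.I * deriv θ t) • x - θ t • B x -
          θ t • A (clampTime T τ t) x with hS
    -- The weak form is the fundamental theorem of calculus for F, whose value at T is 0.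
    have hFc : ContinuousOn F (Icc 0 T) := (hθ.continuousOn.smul continuousOn_const).inner huc
    have hFd : ∀ t ∈ Ioo 0 T, HasDerivAt F (Complex.I * inner ℂ (S t) (u t)) t := by
      intro t ht
      have h2 := (hud t (Ioo_subset_Icc_self ht)).hasDerivAt (Icc_mem_nhds ht.1 ht.2)
      have h3 := ((hθ.hasDerivAt ht).smul_const x).inner ℂ h2
      refine h3.congr_deriv ?_
      simp only [hS, inner_sub_left, inner_smul_left, inner_smul_right, inner_add_right, map_mul,
        Complex.conj_I, ← hBs, map_smul, ← hA.symm _ (clampTime_mem h0 h1 t)]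
      linear_combination (conj (deriv θ t) * inner ℂ x (u t)) * Complex.I_mul_I
    have hSi : Integrable (fun t => inner ℂ (S t) (u t)) (timeMeasure T) := by
      have hA' : IsLipschitzPotential T (fun t => A (clampTime T τ t)) C M :=
        ⟨fun s _ t _ => (hA.lipschitz _ (clampTime_mem h0 h1 s) _ (clampTime_mem h0 h1 t)).trans
          (mul_le_mul_of_nonneg_left (abs_clampTime_sub_le T τ s t) hC),
          fun t _ => hA.symm _ (clampTime_mem h0 h1 t), fun t _ => hA.bound _
            (clampTime_mem h0 h1 t)⟩
      exact integrable_inner_of_memLp (hθ.memLp_test hT hA' x (B x) x)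
        ((memLp_top_of_continuousOn huc fun _ _ => rfl).mono_exponent le_top)
    have h4 := intervalIntegral.integral_eq_sub_of_hasDeriv_right_of_le hT.le hFc
      (fun t ht => (hFd t ht).hasDerivWithinAt)
      ((intervalIntegrable_iff_integrableOn_Ioo_of_le hT.le).2 (hSi.const_mul _))
    rw [intervalIntegral.integral_of_le hT.le, integral_Ioc_eq_integral_Ioo,
      integral_const_mul] at h4
    have h5 : F T = 0 := by simp [hF, hθ.2]
    have h6 : F 0 = inner ℂ (θ 0 • x) (J v₀) := by simp [hF, hu0]
    rw [h5, h6] at h4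
    linear_combination (-Complex.I) * h4 + (∫ t in Ioo 0 T, inner ℂ (S t) (u t)) * Complex.I_mul_I

end Abstract

/-! ### Passage to the limit: existence of weak solutions -/

section Abstract

variable {H V Y : Type*} [NormedAddCommGroup H] [InnerProductSpace ℂ H] [CompleteSpace H]
  [NormedAddCommGroup V] [InnerProductSpace ℂ V] [CompleteSpace V]
  [NormedAddCommGroup Y] [InnerProductSpace ℂ Y]
  {J : V →L[ℂ] H} {D : V →L[ℂ] Y} {G : H →L[ℂ] V}
  {T C M : ℝ} {A : ℝ → H →L[ℂ] H}

/-- Existence of weak solutions in `L₂(I; V)`. -/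
theorem exists_weakSolution (hT : 0 < T) (hG : IsSolutionOperator J D G)
    (hA : IsLipschitzPotential T A C M) (v₀ : V) :
    ∃ W : Lp V 2 (timeMeasure T), IsWeakSolution T (J.comp G) A (J v₀) (fun t => J (W t)) := by
  have hK := hG.isPosDense
  have hM : 0 ≤ M := (norm_nonneg _).trans (hA.bound (T / 2) ⟨by linarith, by linarith⟩)
  have hC : 0 ≤ C := by
    have := (norm_nonneg _).trans (hA.lipschitz (T / 3) ⟨by linarith, by linarith⟩ (T / 2)
      ⟨by linarith, by linarith⟩)
    refine nonneg_of_mul_nonneg_left this (abs_pos.2 (by linarith))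
  -- The factor T / 3 ensures 2 τ < T for every n.
  set τ : ℕ → ℝ := fun n => T / 3 * seqEps n with hτ
  have hτ0 : ∀ n, 0 < τ n := fun n => mul_pos (by positivity) (seqEps_pos n)
  have hτ1 : ∀ n, 2 * τ n < T := fun n => by
    have : seqEps n ≤ 1 := by
      unfold seqEps
      rw [div_le_one (by positivity)]
      linarith [(Nat.cast_nonneg n : (0 : ℝ) ≤ n)]
    have : T / 3 * seqEps n ≤ T / 3 * 1 := by gcongr
    simp only [hτ]; linarith
  choose u huc hun hue hus using fun n => exists_yosida_solution hT hG hA v₀ (hτ0 n) (hτ1 n)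
    (seqEps_pos n)
  set E : ℝ := ‖D v₀‖ ^ 2 + (2 * M + C * T) * ‖J v₀‖ ^ 2 with hE
  have hE0 : 0 ≤ E := by positivity
  set y : ℕ → ℝ → H := fun n t => yosida (J.comp G) (seqEps n) (u n t) with hy
  set w : ℕ → ℝ → V := fun n t => G (y n t) with hw
  -- Splits the approximate solution into a part bounded in V and a remainder that the energy bound
  -- shows to be of order √ε in H.
  have hdecomp : ∀ n t, u n t = J (w n t) + (seqEps n : ℂ) • y n t := fun n t =>
    (hK.map_yosida_add (seqEps_pos n) (u n t)).symm
  have hDw : ∀ n, ∀ t ∈ Icc 0 T, ‖D (w n t)‖ ≤ √E := fun n t ht => by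
    refine Real.le_sqrt_of_sq_le ?_
    have := hue n t ht
    nlinarith [mul_nonneg (seqEps_pos n).le (sq_nonneg ‖y n t‖)]
  have hεy : ∀ n, ∀ t ∈ Icc 0 T, ‖(seqEps n : ℂ) • y n t‖ ≤ √(seqEps n * E) := fun n t ht => by
    refine Real.le_sqrt_of_sq_le ?_
    rw [norm_smul, Complex.norm_real, Real.norm_eq_abs, abs_of_pos (seqEps_pos n), mul_pow]
    have h1 := hue n t ht
    have h2 : seqEps n * ‖y n t‖ ^ 2 ≤ E := by nlinarith [sq_nonneg ‖D (w n t)‖]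
    calc seqEps n ^ 2 * ‖y n t‖ ^ 2 = seqEps n * (seqEps n * ‖y n t‖ ^ 2) := by ring
      _ ≤ _ := by gcongr; exact (seqEps_pos n).le
  have hJw : ∀ n, ∀ t ∈ Icc 0 T, ‖J (w n t)‖ ≤ ‖J v₀‖ := fun n t ht => by
    rw [← hun n t ht]
    exact hK.norm_map_yosida_le (seqEps_pos n) (u n t)
  obtain ⟨c, hc⟩ := hG.coercive
  have hwc : ∀ n, ContinuousOn (w n) (Icc 0 T) := fun n =>
    G.continuous.comp_continuousOn ((yosida (J.comp G) (seqEps n)).continuous.comp_continuousOn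
      (huc n))
  have hwL : ∀ n, MemLp (w n) 2 (timeMeasure T) := fun n =>
    (memLp_top_of_continuousOn (hwc n) fun _ _ => rfl).mono_exponent le_top
  have hwb : ∀ n, ∀ t ∈ Icc 0 T, ‖w n t‖ ≤ |c| * √E := fun n t ht =>
    (hc _).trans (mul_le_mul (le_abs_self c) (hDw n t ht) (norm_nonneg _) (abs_nonneg _))
  obtain ⟨W, hW⟩ := exists_weak_limit (x := fun n => (hwL n).toLp (w n))
    (R := (measureUnivNNReal (timeMeasure T) : ℝ) ^ (2 : ℝ≥0∞).toReal⁻¹ * (|c| * √E)) (fun n => by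
      refine Lp.norm_le_of_ae_bound (by positivity) ?_
      filter_upwards [(hwL n).coeFn_toLp, ae_restrict_mem measurableSet_Ioo] with t ht htI
      rw [ht]
      exact hwb n t (Ioo_subset_Icc_self htI))
  refine ⟨W, fun θ hθ x => ?_⟩
  obtain ⟨Θ, hΘ⟩ := isCompact_Icc.exists_bound_of_continuousOn hθ.continuousOn
  obtain ⟨Θ', hΘ'⟩ := isCompact_Icc.exists_bound_of_continuousOn
    (hθ.1.continuousOn_derivWithin (uniqueDiffOn_Icc hT) le_rfl)
  have hθ0 : 0 ≤ Θ := (norm_nonneg _).trans (hΘ 0 ⟨le_rfl, hT.le⟩)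
  have hθ'0 : 0 ≤ Θ' := (norm_nonneg _).trans (hΘ' 0 ⟨le_rfl, hT.le⟩)
  have hΘd : ∀ t ∈ Ioo 0 T, ‖deriv θ t‖ ≤ Θ' := fun t ht => by
    rw [← derivWithin_of_mem_nhds (Icc_mem_nhds ht.1 ht.2)]
    exact hΘ' t (Ioo_subset_Icc_self ht)
  set K := J.comp G with hKdef
  set S : ℝ → H := fun t => (Complex.I * deriv θ t) • K x - θ t • x - θ t • A t (K x) with hS
  have hSL : MemLp S 2 (timeMeasure T) := hθ.memLp_test hT hA (K x) x (K x)
  -- weak convergence of the left-hand sides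
  set J' : H →L[ℂ] V := ContinuousLinearMap.adjoint J with hJ'
  have hSL' : MemLp (fun t => J' (S t)) 2 (timeMeasure T) := J'.comp_memLp' hSL
  have hlim1 : Tendsto (fun n => ∫ t in Ioo 0 T, inner ℂ (S t) (J (w n t))) (hyperfilter ℕ)
      (𝓝 (∫ t in Ioo 0 T, inner ℂ (S t) (J (W t)))) := by
    have h := hW (hSL'.toLp _)
    simp only [L2.inner_def] at h
    have e1 : ∫ t in Ioo 0 T, inner ℂ ((hSL'.toLp _ : Lp V 2 (timeMeasure T)) t) (W t) =
        ∫ t in Ioo 0 T, inner ℂ (S t) (J (W t)) := by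
      apply integral_congr_ae
      filter_upwards [hSL'.coeFn_toLp] with t ht
      rw [ht, hJ', ContinuousLinearMap.adjoint_inner_left]
    have e2 : ∀ n, ∫ t in Ioo 0 T, inner ℂ ((hSL'.toLp _ : Lp V 2 (timeMeasure T)) t)
        (((hwL n).toLp (w n) : Lp V 2 (timeMeasure T)) t) =
        ∫ t in Ioo 0 T, inner ℂ (S t) (J (w n t)) := by
      intro n
      apply integral_congr_ae
      filter_upwards [hSL'.coeFn_toLp, (hwL n).coeFn_toLp] with t ht ht2
      rw [ht, ht2, hJ', ContinuousLinearMap.adjoint_inner_left]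
    rw [e1] at h
    exact h.congr e2
  -- the approximate equations
  set δ : ℕ → ℝ := fun n => (Θ' * ‖K x‖ + Θ * (M * ‖K x‖)) * √(seqEps n * E) +
      Θ * (C * τ n * ‖K x‖) * ‖J v₀‖ with hδ
  have hlim2 : Tendsto (fun n => ∫ t in Ioo 0 T, inner ℂ (S t) (J (w n t))) atTop
      (𝓝 (Complex.I * inner ℂ (θ 0 • K x) (J v₀))) := by
    have hδ0 : Tendsto (fun n => δ n * T) atTop (𝓝 0) := by
      have h1 : Tendsto (fun n => √(seqEps n * E)) atTop (𝓝 0) := by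
        have := (Real.continuous_sqrt.tendsto _).comp (tendsto_seqEps.mul_const E)
        simpa [Function.comp_def] using this
      have h2 : Tendsto τ atTop (𝓝 0) := by simpa using tendsto_seqEps.const_mul (T / 3)
      have h3 := ((h1.const_mul (Θ' * ‖K x‖ + Θ * (M * ‖K x‖))).add
        ((((h2.const_mul C).mul_const ‖K x‖).const_mul Θ).mul_const ‖J v₀‖)).mul_const T
      simpa using h3
    rw [tendsto_iff_norm_sub_tendsto_zero]
    refine squeeze_zero (fun _ => norm_nonneg _) (fun n => ?_) hδ0
    have hA' : IsLipschitzPotential T (fun t => A (clampTime T (τ n) t)) C M :=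
      ⟨fun s _ t _ => (hA.lipschitz _ (clampTime_mem (hτ0 n) (hτ1 n) s) _
          (clampTime_mem (hτ0 n) (hτ1 n) t)).trans
          (mul_le_mul_of_nonneg_left (abs_clampTime_sub_le T (τ n) s t) hC),
        fun t _ => hA.symm _ (clampTime_mem (hτ0 n) (hτ1 n) t),
        fun t _ => hA.bound _ (clampTime_mem (hτ0 n) (hτ1 n) t)⟩
    have i1 : Integrable (fun t => inner ℂ (S t) (J (w n t))) (timeMeasure T) :=
      integrable_inner_of_memLp hSL (J.comp_memLp' (hwL n))
    have i2 : Integrable (fun t => inner ℂ ((Complex.I * deriv θ t) • K x -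
        θ t • yosida K (seqEps n) (K x) - θ t • A (clampTime T (τ n) t) (K x)) (u n t))
        (timeMeasure T) :=
      integrable_inner_of_memLp (hθ.memLp_test hT hA' (K x) _ (K x))
        ((memLp_top_of_continuousOn (huc n) fun _ _ => rfl).mono_exponent le_top)
    rw [← hus n θ hθ (K x), ← integral_sub i1 i2]
    have hb := norm_setIntegral_le_of_norm_le_const (μ := volume) (s := Ioo 0 T) (C := δ n)
      (f := fun t => inner ℂ (S t) (J (w n t)) - inner ℂ ((Complex.I * deriv θ t) • K x -
        θ t • yosida K (seqEps n) (K x) - θ t • A (clampTime T (τ n) t) (K x)) (u n t))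
      (by simp) (fun t ht => ?_)
    · refine hb.trans (le_of_eq ?_)
      simp [Measure.real, hT.le]
    · have htI := Ioo_subset_Icc_self ht
      -- The Hamiltonian term passes to the limit without error: by symmetry the Yosida
      -- approximation moves to u, where K (K + ε)⁻¹ u is J w.
      have e1 : inner ℂ (θ t • yosida K (seqEps n) (K x)) (u n t) =
          inner ℂ (θ t • x) (J (w n t)) := by
        rw [inner_smul_left, inner_smul_left, hK.yosida_symm (seqEps_pos n), hK.symm]
        rfl
      have e2 : inner ℂ (S t) (J (w n t)) - inner ℂ ((Complex.I * deriv θ t) • K x -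
          θ t • yosida K (seqEps n) (K x) - θ t • A (clampTime T (τ n) t) (K x)) (u n t) =
          inner ℂ (θ t • A (clampTime T (τ n) t) (K x) - (Complex.I * deriv θ t) • K x)
            ((seqEps n : ℂ) • y n t) +
          inner ℂ (θ t • (A (clampTime T (τ n) t) - A t) (K x)) (J (w n t)) := by
        rw [inner_sub_left _ _ (u n t), inner_sub_left _ _ (u n t), e1, hdecomp n t]
        simp only [hS, inner_sub_left, inner_add_right, sub_apply, smul_sub]
        ring
      rw [e2]
      refine (norm_add_le _ _).trans (add_le_add ?_ ?_)
      · refine (norm_inner_le_norm _ _).trans (mul_le_mul ?_ (hεy n t htI) (norm_nonneg _)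
          (by positivity))
        refine (norm_sub_le _ _).trans ?_
        rw [norm_smul, norm_smul, norm_mul, Complex.norm_I, one_mul, add_comm]
        have k1 := (A (clampTime T (τ n) t)).le_of_opNorm_le
          (hA.bound _ (clampTime_mem (hτ0 n) (hτ1 n) t)) (K x)
        have k2 := hΘd t ht
        have k3 := hΘ t htI
        gcongr
      · refine (norm_inner_le_norm _ _).trans (mul_le_mul ?_ (hJw n t htI) (norm_nonneg _)
          (by have := (hτ0 n).le; positivity))
        rw [norm_smul]
        have k1 := (A (clampTime T (τ n) t) - A t).le_of_opNorm_le
          ((hA.lipschitz _ (clampTime_mem (hτ0 n) (hτ1 n) t) _ ht).trans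
            (mul_le_mul_of_nonneg_left (abs_clampTime_sub_self_le (hτ0 n) (hτ1 n) ht) hC)) (K x)
        have k3 := hΘ t htI
        gcongr
  exact tendsto_nhds_unique hlim1 (hlim2.mono_left Nat.hyperfilter_le_atTop)

end Abstract

/-! ### Construction of the solution operator, and the weak time derivative -/

section Abstract

variable {H V Y : Type*} [NormedAddCommGroup H] [InnerProductSpace ℂ H]
  [NormedAddCommGroup V] [InnerProductSpace ℂ V]
  [NormedAddCommGroup Y] [InnerProductSpace ℂ Y]
  {J : V →L[ℂ] H} {D : V →L[ℂ] Y} {G : H →L[ℂ] V}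
  {T C M : ℝ} {A : ℝ → H →L[ℂ] H}

/-- Lax–Milgram: D*D is coercive, hence invertible, and G = (D*D)⁻¹ J*. Injectivity of J makes the
range of J* dense, and an invertible map preserves this. -/
theorem exists_solutionOperator [CompleteSpace H] [CompleteSpace V] [CompleteSpace Y]
    (hinj : ∀ v, J v = 0 → v = 0) (hdense : DenseRange J) {c : ℝ} (hc : ∀ v, ‖v‖ ≤ c * ‖D v‖) :
    ∃ G : H →L[ℂ] V, IsSolutionOperator J D G ∧ DenseRange G := by
  set S : V →L[ℂ] V := (ContinuousLinearMap.adjoint D).comp D with hS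
  have hSi : ∀ v w, inner ℂ (S v) w = inner ℂ (D v) (D w) := fun v w => by
    rw [hS, ContinuousLinearMap.comp_apply, ContinuousLinearMap.adjoint_inner_left]
  have hc' : ∀ v, ‖v‖ ^ 2 * (1 / (c ^ 2 + 1)) ≤ ‖inner ℂ (S v) v‖ := fun v => by
    rw [hSi, inner_self_eq_norm_sq_to_K, mul_one_div, div_le_iff₀ (by positivity)]
    have h1 : ‖v‖ ^ 2 ≤ (c * ‖D v‖) ^ 2 := by
      have := hc v
      gcongr
    have h2 : ‖((‖D v‖ : ℂ)) ^ 2‖ = ‖D v‖ ^ 2 := by simp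
    change _ ≤ ‖((‖D v‖ : ℂ)) ^ 2‖ * _
    rw [h2]
    nlinarith [sq_nonneg ‖D v‖]
  have hu : IsUnit S := S.isUnit_of_forall_le_norm_inner_map
    (c := ⟨1 / (c ^ 2 + 1), by positivity⟩) (by change (0 : ℝ) < _; positivity) hc'
  have hright : ∀ x, S (Ring.inverse S x) = x := fun x =>
    congrArg (fun R : V →L[ℂ] V => R x) (Ring.mul_inverse_cancel _ hu)
  have hleft : ∀ x, Ring.inverse S (S x) = x := fun x =>
    congrArg (fun R : V →L[ℂ] V => R x) (Ring.inverse_mul_cancel _ hu)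
  refine ⟨(Ring.inverse S).comp (ContinuousLinearMap.adjoint J), ⟨fun x v => ?_, hdense, c, hc⟩, ?_⟩
  · rw [← hSi, ContinuousLinearMap.comp_apply (Ring.inverse S), hright,
    ContinuousLinearMap.adjoint_inner_left]
  · have h1 : DenseRange (ContinuousLinearMap.adjoint J) := by
      have : ((ContinuousLinearMap.adjoint J).range).topologicalClosure = ⊤ := by
        rw [Submodule.topologicalClosure_eq_top_iff, Submodule.eq_bot_iff]
        intro v hv
        have h1 : inner ℂ (ContinuousLinearMap.adjoint J (J v)) v = 0 := hv _ ⟨J v, rfl⟩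
        rw [ContinuousLinearMap.adjoint_inner_left, inner_self_eq_zero] at h1
        exact hinj v h1
      exact Submodule.dense_iff_topologicalClosure_eq_top.2 this
    have h2 : DenseRange (Ring.inverse S : V →L[ℂ] V) :=
      Function.Surjective.denseRange fun x => ⟨S x, hleft x⟩
    exact h2.comp h1 (Ring.inverse S : V →L[ℂ] V).continuous

/-- The map `h ↦ (v ↦ (h, L v))` into the bounded antilinear functionals. -/
def dualMap (L : V →L[ℂ] H) : H →L[ℂ] (V →L⋆[ℂ] ℂ) :=
  LinearMap.mkContinuous
    { toFun := fun h => ((innerSL ℂ).flip h).comp L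
      map_add' := fun a b => by ext v; simp
      map_smul' := fun c a => by ext v; simp } ‖L‖ fun h => by
    refine ContinuousLinearMap.opNorm_le_bound _ (by positivity) fun v => ?_
    calc ‖inner ℂ (L v) h‖ ≤ ‖L v‖ * ‖h‖ := norm_inner_le_norm _ _
      _ ≤ (‖L‖ * ‖v‖) * ‖h‖ := by gcongr; exact L.le_opNorm v
      _ = _ := by ring

theorem dualMap_apply (L : V →L[ℂ] H) (h : H) (v : V) : dualMap L h v = inner ℂ (L v) h := rfl

/-- Weak solutions in `L₂(I; V)` have a weak time derivative in `L₂(I; V')`. -/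
theorem exists_weakTimeDeriv [CompleteSpace H] [CompleteSpace V] (hG : IsSolutionOperator J D G)
    (hGd : DenseRange G)
    (hA : IsLipschitzPotential T A C M) {u₀ : H} (W : Lp V 2 (timeMeasure T))
    (hW : IsWeakSolution T (J.comp G) A u₀ (fun t => J (W t))) :
    ∃ w : Lp (V →L⋆[ℂ] ℂ) 2 (timeMeasure T), ∀ θ : ℝ → ℂ, ContDiff ℝ ∞ θ → HasCompactSupport θ →
      tsupport θ ⊆ Ioo 0 T →
      ∫ t in Ioo 0 T, deriv θ t • dualMap J (J (W t)) = - ∫ t in Ioo 0 T, θ t • w t := by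
  have hJW : MemLp (fun t => J (W t)) 2 (timeMeasure T) := J.comp_memLp' (Lp.memLp W)
  -- The equation solved for the time derivative; on V' the Hamiltonian acts as v ↦ (D W, D v),
  -- which needs W in V only.
  set f : ℝ → (V →L⋆[ℂ] ℂ) := fun t =>
    -Complex.I • (dualMap D (D (W t)) + dualMap J (A t (J (W t)))) with hf
  have hfL : MemLp f 2 (timeMeasure T) :=
    (((dualMap D).comp_memLp' (D.comp_memLp' (Lp.memLp W))).add
      ((dualMap J).comp_memLp' (hA.memLp hJW))).const_smul (-Complex.I)
  refine ⟨hfL.toLp f, fun θ hθ hθc hθs => ?_⟩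
  have e0 : ∫ t in Ioo 0 T, θ t • (hfL.toLp f : Lp (V →L⋆[ℂ] ℂ) 2 (timeMeasure T)) t =
      ∫ t in Ioo 0 T, θ t • f t := by
    apply integral_congr_ae
    filter_upwards [hfL.coeFn_toLp] with t ht
    rw [ht]
  rw [e0]
  obtain ⟨B, hB⟩ := hθc.exists_bound_of_continuous hθ.continuous
  have hθ'c : Continuous (deriv θ) := hθ.continuous_deriv (by simp)
  obtain ⟨B', hB'⟩ := (hθc.deriv).exists_bound_of_continuous hθ'c
  have i1 : Integrable (fun t => deriv θ t • dualMap J (J (W t))) (timeMeasure T) :=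
    (((dualMap J).comp_memLp' hJW).integrable one_le_two).bdd_smul B' hθ'c.aestronglyMeasurable
      (ae_of_all _ hB')
  have i2 : Integrable (fun t => θ t • f t) (timeMeasure T) :=
    (hfL.integrable one_le_two).bdd_smul B hθ.continuous.aestronglyMeasurable (ae_of_all _ hB)
  have hzero : ∀ t, t ∉ Ioo 0 T → θ t = 0 := fun t ht =>
    image_eq_zero_of_notMem_tsupport fun h => ht (hθs h)
  -- Conjugated because the weak form is antilinear in its test function while the distributional
  -- derivative is linear in θ.
  have hfactor : IsTimeFactor T (fun t => conj (θ t)) :=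
    ⟨((Complex.conjCLE.contDiff.comp hθ).of_le (by simp)).contDiffOn, by simp [hzero T (by simp)]⟩
  have hderiv : ∀ t, deriv (fun t => conj (θ t)) t = conj (deriv θ t) := fun t =>
    ((Complex.conjCLE.toContinuousLinearMap.hasFDerivAt.comp_hasDerivAt t
      (hθ.differentiable (by simp) t).hasDerivAt)).deriv
  -- It suffices to evaluate the two functionals at vectors G x, which are dense in V; there the
  -- identity is the weak form tested with x.
  have key : ∀ x : H, (∫ t in Ioo 0 T, deriv θ t • dualMap J (J (W t))) (G x) =
      (-∫ t in Ioo 0 T, θ t • f t) (G x) := by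
    intro x
    have h := hW _ hfactor x
    rw [hzero 0 (by simp)] at h
    simp only [map_zero, zero_smul, inner_zero_left, mul_zero] at h
    have h1 : (∫ t in Ioo 0 T, deriv θ t • dualMap J (J (W t))) (G x) =
      ∫ t in Ioo 0 T, deriv θ t * inner ℂ (J (G x)) (J (W t)) := by
      have := (ContinuousLinearMap.apply' ℂ (starRingEnd ℂ) (G x)).integral_comp_comm i1
      simpa [dualMap_apply] using this.symm
    have h2 : (∫ t in Ioo 0 T, θ t • f t) (G x) = ∫ t in Ioo 0 T, θ t * f t (G x) := by
      have := (ContinuousLinearMap.apply' ℂ (starRingEnd ℂ) (G x)).integral_comp_comm i2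
      simpa using this.symm
    have j1 : Integrable (fun t => deriv θ t * inner ℂ (J (G x)) (J (W t))) (timeMeasure T) :=
      (ContinuousLinearMap.apply' ℂ (starRingEnd ℂ) (G x)).integrable_comp i1
    have j2 : Integrable (fun t => θ t * f t (G x)) (timeMeasure T) :=
      (ContinuousLinearMap.apply' ℂ (starRingEnd ℂ) (G x)).integrable_comp i2
    have h3 : ∫ t in Ioo 0 T, (-Complex.I) * (deriv θ t * inner ℂ (J (G x)) (J (W t)) +
        θ t * f t (G x)) = 0 := by
      rw [← h]
      refine setIntegral_congr_fun measurableSet_Ioo fun t ht => ?_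
      simp only [hderiv, hf, inner_sub_left, inner_smul_left, map_mul, Complex.conj_I,
        Complex.conj_conj, smul_apply, add_apply, smul_eq_mul, dualMap_apply,
        hA.symm t ht, ContinuousLinearMap.comp_apply]
      rw [show inner ℂ (D (G x)) (D (W t)) = inner ℂ x (J (W t)) from hG.spec x (W t)]
      linear_combination (θ t * (inner ℂ x (J (W t)) + inner ℂ (J (G x)) (A t (J (W t))))) *
        Complex.I_mul_I
    rw [integral_const_mul, integral_add j1 j2] at h3
    rw [neg_apply, h1, h2]
    have h4 := (mul_eq_zero.1 h3).resolve_left (neg_ne_zero.2 Complex.I_ne_zero)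
    exact eq_neg_of_add_eq_zero_left h4
  exact DFunLike.coe_injective (hGd.equalizer (ContinuousLinearMap.continuous _)
    (ContinuousLinearMap.continuous _) (funext key))

end Abstract

/-! ### Calculus in `ℝ^d` -/

section Calculus

variable {d : ℕ} {F : Type*} [NormedAddCommGroup F] [NormedSpace ℝ F]

/-- The partial derivative `∂ᵢ f`. -/
def pd (i : Fin d) (f : Space d → F) (x : Space d) : F :=
  fderiv ℝ f x (EuclideanSpace.single i (1 : ℝ))

theorem pd_eq_zero_of_notMem_tsupport {i : Fin d} {f : Space d → F} {x : Space d}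
    (hx : x ∉ tsupport f) : pd i f x = 0 := by
  have : f =ᶠ[𝓝 x] fun _ => 0 := notMem_tsupport_iff_eventuallyEq.1 hx
  rw [pd, this.fderiv_eq]; simp

theorem tsupport_pd_subset (i : Fin d) (f : Space d → F) : tsupport (pd i f) ⊆ tsupport f :=
  closure_minimal (fun x hx => by
    by_contra h
    exact hx (pd_eq_zero_of_notMem_tsupport h)) (isClosed_tsupport f)

theorem hasCompactSupport_pd {i : Fin d} {f : Space d → F} (hf : HasCompactSupport f) :
    HasCompactSupport (pd i f) := hf.mono' ((subset_tsupport _).trans (tsupport_pd_subset i f))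

theorem contDiff_pd {n m : WithTop ℕ∞} {i : Fin d} {f : Space d → F} (hf : ContDiff ℝ n f)
    (h : m + 1 ≤ n) : ContDiff ℝ m (pd i f) :=
  (hf.fderiv_right h).clm_apply contDiff_const

theorem contDiffOn_pd {n m : WithTop ℕ∞} {i : Fin d} {f : Space d → F} {Ω : Set (Space d)}
    (hΩ : IsOpen Ω) (hf : ContDiffOn ℝ n f Ω)
    (h : m + 1 ≤ n) : ContDiffOn ℝ m (pd i f) Ω :=
  (hf.fderiv_of_isOpen hΩ h).clm_apply contDiffOn_const

theorem laplacian_eq_sum_pd {f : Space d → F} {x : Space d} (hf : ContDiffAt ℝ 2 f x) :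
    Laplacian.laplacian f x = ∑ i, pd i (pd i f) x := by
  rw [congrFun (InnerProductSpace.laplacian_eq_iteratedFDeriv_orthonormalBasis f
    (EuclideanSpace.basisFun (Fin d) ℝ)) x]
  refine Finset.sum_congr rfl fun i _ => ?_
  have hd : DifferentiableAt ℝ (fderiv ℝ f) x :=
    (hf.fderiv_right (m := 1) (by norm_num)).differentiableAt one_ne_zero
  rw [iteratedFDeriv_two_apply]
  simp only [EuclideanSpace.basisFun_apply, Matrix.cons_val_zero, Matrix.cons_val_one]
  have : pd i f = fun y => fderiv ℝ f y (EuclideanSpace.single i (1 : ℝ)) := rfl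
  rw [this, pd, fderiv_clm_apply hd (by fun_prop)]
  simp

variable {𝕜 : Type*} [RCLike 𝕜] [NormedSpace 𝕜 F]

theorem pd_smul {i : Fin d} {ψ : Space d → 𝕜} {f : Space d → F} {x : Space d}
    (hψ : DifferentiableAt ℝ ψ x) (hf : DifferentiableAt ℝ f x) :
    pd i (fun x => ψ x • f x) x = ψ x • pd i f x + pd i ψ x • f x := by
  have : IsScalarTower ℝ 𝕜 F := inferInstance
  simp only [pd]
  rw [fderiv_fun_smul hψ hf]
  simp

theorem continuous_smul_of_tsupport {Ω : Set (Space d)} (hΩ : IsOpen Ω) {ψ : Space d → 𝕜}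
    {f : Space d → F} (hψ : Continuous ψ) (hψs : tsupport ψ ⊆ Ω) (hf : ContinuousOn f Ω) :
    Continuous (fun x => ψ x • f x) :=
  continuous_of_tsupport fun x hx => by
    have hx' : x ∈ Ω := hψs (closure_mono (Function.support_smul_subset_left ψ f) hx)
    exact hψ.continuousAt.smul (hf.continuousAt (hΩ.mem_nhds hx'))

theorem integrable_smul_of_tsupport {Ω : Set (Space d)} (hΩ : IsOpen Ω) {ψ : Space d → 𝕜}
    {f : Space d → F} (hψ : Continuous ψ) (hψc : HasCompactSupport ψ) (hψs : tsupport ψ ⊆ Ω)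
    (hf : ContinuousOn f Ω) : Integrable (fun x => ψ x • f x) :=
  (continuous_smul_of_tsupport hΩ hψ hψs hf).integrable_of_hasCompactSupport hψc.smul_right

theorem setIntegral_smul_of_tsupport {Ω : Set (Space d)} {ψ : Space d → 𝕜}
    {f : Space d → F} (hψs : tsupport ψ ⊆ Ω) : ∫ x in Ω, ψ x • f x = ∫ x, ψ x • f x :=
  setIntegral_eq_integral_of_forall_compl_eq_zero fun x hx => by
    rw [image_eq_zero_of_notMem_tsupport fun h => hx (hψs h), zero_smul]

/-- Only ψ needs compact support in Ω. The function f may be arbitrarily bad near the boundary,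
since all products vanish there. -/
theorem integral_pd_smul {Ω : Set (Space d)} (hΩ : IsOpen Ω) {ψ : Space d → 𝕜} {f : Space d → F}
    (hψ : ContDiff ℝ 1 ψ) (hψc : HasCompactSupport ψ) (hψs : tsupport ψ ⊆ Ω)
    (hf : ContDiffOn ℝ 1 f Ω) (i : Fin d) :
    ∫ x in Ω, pd i ψ x • f x = - ∫ x in Ω, ψ x • pd i f x := by
  have hpc : Continuous (pd i ψ) := (contDiff_pd (m := 0) hψ (by simp)).continuous
  have hfc : ContinuousOn (pd i f) Ω := (contDiffOn_pd (m := 0) hΩ hf (by simp)).continuousOn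
  have hps := (tsupport_pd_subset i ψ).trans hψs
  have h := integral_bilinear_hasFDerivAt_right_eq_neg_left_of_integrable
    (μ := (volume : Measure (Space d)))
    (B := (ContinuousLinearMap.lsmul ℝ 𝕜 : 𝕜 →L[ℝ] F →L[ℝ] F))
    (f := ψ) (f' := fderiv ℝ ψ) (g := f) (g' := fderiv ℝ f)
    (v := EuclideanSpace.single i (1 : ℝ))
    (integrable_smul_of_tsupport hΩ hpc (hasCompactSupport_pd hψc) hps hf.continuousOn)
    (integrable_smul_of_tsupport hΩ hψ.continuous hψc hψs hfc)
    (integrable_smul_of_tsupport hΩ hψ.continuous hψc hψs hf.continuousOn)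
    (fun x _ => (hψ.differentiable one_ne_zero x).hasFDerivAt)
    (fun x hx => ((hf.contDiffAt (hΩ.mem_nhds (hψs hx))).differentiableAt one_ne_zero).hasFDerivAt)
  rw [setIntegral_smul_of_tsupport hps, setIntegral_smul_of_tsupport hψs, eq_neg_iff_add_eq_zero,
    add_comm, ← eq_neg_iff_add_eq_zero]
  exact h

theorem integral_laplacian_smul {Ω : Set (Space d)} (hΩ : IsOpen Ω) {ψ : Space d → 𝕜}
    {f : Space d → F}
    (hψ : ContDiff ℝ 2 ψ) (hψc : HasCompactSupport ψ) (hψs : tsupport ψ ⊆ Ω)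
    (hf : ContDiffOn ℝ 2 f Ω) :
    ∫ x in Ω, Laplacian.laplacian ψ x • f x = ∫ x in Ω, ψ x • Laplacian.laplacian f x := by
  have h1 : ∀ x, Laplacian.laplacian ψ x • f x = ∑ i, pd i (pd i ψ) x • f x := fun x => by
    rw [laplacian_eq_sum_pd hψ.contDiffAt, Finset.sum_smul]
  have h2 : ∀ x ∈ Ω, ψ x • Laplacian.laplacian f x = ∑ i, ψ x • pd i (pd i f) x := fun x hx => by
    rw [laplacian_eq_sum_pd (hf.contDiffAt (hΩ.mem_nhds hx)), Finset.smul_sum]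
  have hψ1 : ∀ i, ContDiff ℝ 1 (pd i ψ) := fun i => contDiff_pd hψ (by norm_num)
  have hf1 : ∀ i, ContDiffOn ℝ 1 (pd i f) Ω := fun i => contDiffOn_pd hΩ hf (by norm_num)
  have hps := fun i => (tsupport_pd_subset i ψ).trans hψs
  rw [setIntegral_congr_fun hΩ.measurableSet h2]
  simp only [h1]
  rw [integral_finsetSum, integral_finsetSum]
  · refine Finset.sum_congr rfl fun i _ => ?_
    rw [integral_pd_smul hΩ (hψ1 i) (hasCompactSupport_pd hψc) (hps i) (hf.of_le (by norm_num)),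
      integral_pd_smul hΩ (hψ.of_le (by norm_num)) hψc hψs (hf1 i), neg_neg]
  · exact fun i _ => (integrable_smul_of_tsupport hΩ hψ.continuous hψc hψs
      (contDiffOn_pd (m := 0) hΩ (hf1 i) (by simp)).continuousOn).integrableOn
  · exact fun i _ => (integrable_smul_of_tsupport hΩ
      (contDiff_pd (m := 0) (hψ1 i) (by simp)).continuous
      (hasCompactSupport_pd (hasCompactSupport_pd hψc))
      ((tsupport_pd_subset i _).trans (hps i)) hf.continuousOn).integrableOn

theorem pd_radial {χ χ' : ℝ → ℝ} (hχ : ∀ s, HasDerivAt χ (χ' s) s) (c : Space d) (i : Fin d)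
    (x : Space d) :
    pd i (fun y => χ (‖y - c‖ ^ 2)) x = χ' (‖x - c‖ ^ 2) * (2 * (x i - c i)) := by
  have h1 : HasFDerivAt (fun y : Space d => ‖y - c‖ ^ 2) (2 • (innerSL ℝ (x - c))) x := by
    have := ((hasFDerivAt_id x).sub_const c).norm_sq
    simpa using this
  have h2 := (hχ (‖x - c‖ ^ 2)).comp_hasFDerivAt x h1
  have h3 : fderiv ℝ (fun y => χ (‖y - c‖ ^ 2)) x = _ := h2.fderiv
  rw [pd, h3]
  simp [EuclideanSpace.inner_single_right]

/-- Serves three times: for the mollifying kernels of Weyl's lemma, the exponential barriers, and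
the quadratic perturbation in the maximum principle. -/
theorem laplacian_radial {χ χ' χ'' : ℝ → ℝ} (hχ : ∀ s, HasDerivAt χ (χ' s) s)
    (hχ' : ∀ s, HasDerivAt χ' (χ'' s) s) (hs : ContDiff ℝ 2 χ) (c : Space d) (x : Space d) :
    Laplacian.laplacian (fun y => χ (‖y - c‖ ^ 2)) x =
      4 * χ'' (‖x - c‖ ^ 2) * ‖x - c‖ ^ 2 + 2 * d * χ' (‖x - c‖ ^ 2) := by
  have hsm : ContDiff ℝ 2 (fun y : Space d => χ (‖y - c‖ ^ 2)) :=
    hs.comp ((contDiff_id.sub contDiff_const).norm_sq ℝ)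
  rw [laplacian_eq_sum_pd hsm.contDiffAt]
  have h : ∀ i : Fin d, pd i (pd i fun y => χ (‖y - c‖ ^ 2)) x =
      4 * χ'' (‖x - c‖ ^ 2) * (x i - c i) ^ 2 + 2 * χ' (‖x - c‖ ^ 2) := by
    intro i
    rw [funext (pd_radial hχ c i)]
    have h1 : DifferentiableAt ℝ (fun y : Space d => χ' (‖y - c‖ ^ 2)) x :=
      (hχ' _).differentiableAt.comp x
        ((differentiable_id.sub_const c).norm_sq ℝ).differentiableAt
    have h2 : DifferentiableAt ℝ (fun y : Space d => 2 * (y i - c i)) x := by fun_prop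
    have h3 := pd_smul (𝕜 := ℝ) (i := i) h1 h2
    simp only [smul_eq_mul] at h3
    rw [h3, pd_radial hχ' c i]
    have h4 : pd i (fun y : Space d => 2 * (y i - c i)) x = 2 := by
      have : HasFDerivAt (fun y : Space d => 2 * (y i - c i))
        ((2 : ℝ) • (EuclideanSpace.proj i : Space d →L[ℝ] ℝ)) x :=
        ((EuclideanSpace.proj i : Space d →L[ℝ] ℝ).hasFDerivAt.sub_const (c i)).const_mul 2
      rw [pd, this.fderiv]; simp
    rw [h4]; ring
  rw [Finset.sum_congr rfl fun i _ => h i, Finset.sum_add_distrib, ← Finset.mul_sum]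
  have h5 : ∑ i, (x i - c i) ^ 2 = ‖x - c‖ ^ 2 := by
    rw [EuclideanSpace.norm_sq_eq]; simp
  rw [h5]
  simp; ring

end Calculus

/-! ### Weakly harmonic functions (Weyl's lemma) -/

section Weyl

variable {d : ℕ}

/-- `h` is harmonic in `Ω` in the sense of distributions. -/
def IsWeaklyHarmonic (Ω : Set (Space d)) (h : Space d → ℂ) : Prop :=
  ∀ ψ : Space d → ℝ, ContDiff ℝ ∞ ψ → HasCompactSupport ψ → tsupport ψ ⊆ Ω →
    ∫ x in Ω, Laplacian.laplacian ψ x • h x = 0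

/-- A smooth decreasing function that vanishes on `[1, ∞)`. -/
def profile (s : ℝ) : ℝ := Real.smoothTransition (1 - s)

theorem contDiff_profile {n : ℕ∞} : ContDiff ℝ n profile :=
  Real.smoothTransition.contDiff.comp (contDiff_const.sub contDiff_id)

theorem profile_eq_zero {s : ℝ} (hs : 1 ≤ s) : profile s = 0 :=
  Real.smoothTransition.zero_of_nonpos (by linarith)

theorem contDiff_deriv_profile {n : ℕ∞} : ContDiff ℝ n (deriv profile) :=
  (contDiff_infty_iff_deriv.1 contDiff_profile).2.of_le (by exact_mod_cast le_top)

theorem hasDerivAt_profile (s : ℝ) : HasDerivAt profile (deriv profile s) s :=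
  ((contDiff_profile (n := 1)).differentiable (by simp) s).hasDerivAt

theorem hasDerivAt_deriv_profile (s : ℝ) :
    HasDerivAt (deriv profile) (deriv (deriv profile) s) s :=
  ((contDiff_deriv_profile (n := 1)).differentiable (by simp) s).hasDerivAt

theorem continuous_deriv_deriv_profile : Continuous (deriv (deriv profile)) :=
  (contDiff_deriv_profile (n := 1)).continuous_deriv (by simp)

theorem deriv_eq_zero_of_forall_ge {f : ℝ → ℝ} (hf : ∀ s, 1 ≤ s → f s = 0)
    (hc : Continuous (deriv f)) {s : ℝ} (hs : 1 ≤ s) : deriv f s = 0 := by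
  have h1 : EqOn (deriv f) (fun _ => 0) (Ioi 1) := fun t ht => by
    have : f =ᶠ[𝓝 t] fun _ => 0 := by
      filter_upwards [Ioi_mem_nhds (show (1 : ℝ) < t from ht)] with r hr using hf r (le_of_lt hr)
    rw [this.deriv_eq]; simp
  have h2 := h1.closure hc continuous_const
  rw [closure_Ioi] at h2
  exact h2 hs

theorem deriv_profile_eq_zero {s : ℝ} (hs : 1 ≤ s) : deriv profile s = 0 :=
  deriv_eq_zero_of_forall_ge (fun _ h => profile_eq_zero h)
    (contDiff_deriv_profile (n := 0)).continuous hs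

theorem deriv_deriv_profile_eq_zero {s : ℝ} (hs : 1 ≤ s) : deriv (deriv profile) s = 0 :=
  deriv_eq_zero_of_forall_ge (fun _ h => deriv_profile_eq_zero h) continuous_deriv_deriv_profile hs

theorem deriv_profile_nonpos (s : ℝ) : deriv profile s ≤ 0 := by
  have : Antitone profile := fun a b hab => Real.smoothTransition.monotone (by linarith)
  exact this.deriv_nonpos

theorem exists_bound_profile : ∃ C : ℝ, 0 ≤ C ∧ ∀ s, 0 ≤ s →
    |deriv profile s| ≤ C ∧ |s * deriv (deriv profile) s| ≤ C := by
  obtain ⟨C₁, h₁⟩ := (isCompact_Icc (a := (0 : ℝ)) (b := 1)).exists_bound_of_continuousOn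
    (contDiff_deriv_profile (n := 0)).continuous.continuousOn
  obtain ⟨C₂, h₂⟩ := (isCompact_Icc (a := (0 : ℝ)) (b := 1)).exists_bound_of_continuousOn
    (continuous_id.mul continuous_deriv_deriv_profile).continuousOn
  refine ⟨max 0 (max C₁ C₂), le_max_left _ _, fun s hs => ?_⟩
  rcases le_total s 1 with h | h
  · exact ⟨(h₁ s ⟨hs, h⟩).trans (by simp), (h₂ s ⟨hs, h⟩).trans (by simp)⟩
  · rw [deriv_profile_eq_zero h, deriv_deriv_profile_eq_zero h]; simp

/-- The radial function `χ'(σ² ‖z - x‖²)`, scaled by `σ^d`. -/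
def radialKernel (σ : ℝ) (x z : Space d) : ℝ := σ ^ d * deriv profile (σ ^ 2 * ‖z - x‖ ^ 2)

/-- The total mass of `radialKernel`. -/
def kernelMass (d : ℕ) : ℝ := ∫ y : Space d, deriv profile (‖y‖ ^ 2)

theorem continuous_radialKernel (σ : ℝ) (x : Space d) : Continuous (radialKernel σ x) := by
  have := (contDiff_deriv_profile (n := 0)).continuous
  unfold radialKernel
  fun_prop

theorem one_le_of_notMem_closedBall {σ : ℝ} (hσ : 0 < σ) {x z : Space d}
    (hz : z ∉ Metric.closedBall x (1 / σ)) : 1 ≤ σ ^ 2 * ‖z - x‖ ^ 2 := by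
  rw [mem_closedBall_iff_norm, not_le, div_lt_iff₀ hσ] at hz
  rw [← mul_pow]
  have : 1 ≤ σ * ‖z - x‖ := by linarith
  exact one_le_pow₀ this

theorem radialKernel_eq_zero {σ : ℝ} (hσ : 0 < σ) {x z : Space d}
    (hz : z ∉ Metric.closedBall x (1 / σ)) : radialKernel σ x z = 0 := by
  rw [radialKernel, deriv_profile_eq_zero (one_le_of_notMem_closedBall hσ hz), mul_zero]

/-- The integrand never changes sign, and it is not identically zero because the profile falls from
1 to 0. A positive dimension is needed to have points of every norm. -/
theorem kernelMass_ne_zero (hd : 0 < d) : kernelMass d ≠ 0 := by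
  have hc : Continuous fun y : Space d => -deriv profile (‖y‖ ^ 2) := by
    have := (contDiff_deriv_profile (n := 0)).continuous
    fun_prop
  have hs : HasCompactSupport fun y : Space d => -deriv profile (‖y‖ ^ 2) := by
    refine HasCompactSupport.intro (isCompact_closedBall (0 : Space d) 1) fun y hy => ?_
    have := one_le_of_notMem_closedBall (σ := 1) one_pos (x := (0 : Space d)) (z := y)
      (by simpa using hy)
    rw [deriv_profile_eq_zero (by simpa using this), neg_zero]
  have hne : ∃ s, 0 ≤ s ∧ deriv profile s ≠ 0 := by
    by_contra! h
    have : profile 1 = profile 0 := by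
      refine constant_of_has_deriv_right_zero (a := 0) (b := 1)
        (contDiff_profile (n := 0)).continuous.continuousOn (fun s hs => ?_) 1 (by simp)
      rw [← h s hs.1]
      exact (hasDerivAt_profile s).hasDerivWithinAt
    rw [profile_eq_zero le_rfl, profile] at this
    simp at this
  obtain ⟨s, hs0, hs1⟩ := hne
  have hpos := hc.integral_pos_of_hasCompactSupport_nonneg_nonzero (μ := volume)
    (x := EuclideanSpace.single ⟨0, hd⟩ (√s)) hs
    (fun y => by simpa using deriv_profile_nonpos _)
    (by simpa [Real.sq_sqrt hs0] using hs1)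
  rw [integral_neg] at hpos
  unfold kernelMass
  linarith

theorem integral_radialKernel {σ : ℝ} (hσ : 0 < σ) (x : Space d) :
    ∫ z, radialKernel σ x z = kernelMass d := by
  have h1 := integral_sub_right_eq_self (μ := (volume : Measure (Space d)))
    (fun z => σ ^ d * deriv profile (σ ^ 2 * ‖z‖ ^ 2)) x
  unfold radialKernel
  rw [h1, integral_const_mul]
  have h2 := Measure.integral_comp_smul (volume : Measure (Space d))
    (fun y => deriv profile (‖y‖ ^ 2)) σ
  simp only [norm_smul, mul_pow, Real.norm_eq_abs, sq_abs, finrank_euclideanSpace_fin] at h2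
  rw [h2, abs_of_pos (by positivity), kernelMass, smul_eq_mul, ← mul_assoc, mul_inv_cancel₀
    (by positivity),
    one_mul]

/-- The radial mean `∫ K_σ(x, z) h(z) dz`. -/
def radialMean (h : Space d → ℂ) (σ : ℝ) (x : Space d) : ℂ := ∫ z, radialKernel σ x z • h z

/-- The derivative of `radialKernel` in `σ`. -/
def radialKernelDeriv (σ : ℝ) (x z : Space d) : ℝ :=
  d * σ ^ (d - 1) * deriv profile (σ ^ 2 * ‖z - x‖ ^ 2) +
    σ ^ d * (deriv (deriv profile) (σ ^ 2 * ‖z - x‖ ^ 2) * (2 * σ * ‖z - x‖ ^ 2))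

theorem hasDerivAt_radialKernel (σ : ℝ) (x z : Space d) :
    HasDerivAt (fun σ => radialKernel σ x z) (radialKernelDeriv σ x z) σ := by
  have h1 : HasDerivAt (fun σ : ℝ => σ ^ 2 * ‖z - x‖ ^ 2) (2 * σ * ‖z - x‖ ^ 2) σ := by
    simpa using (hasDerivAt_pow 2 σ).mul_const (‖z - x‖ ^ 2)
  exact (hasDerivAt_pow d σ).mul ((hasDerivAt_deriv_profile _).comp σ h1)

/-- The point of the radial kernel: its derivative in σ is, up to a factor, the Laplacian of a
compactly supported function, so it integrates to 0 against a weakly harmonic one. -/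
theorem radialKernelDeriv_eq {σ : ℝ} (x z : Space d) :
    σ ^ d * Laplacian.laplacian (fun y => profile (σ ^ 2 * ‖y - x‖ ^ 2)) z =
      2 * σ ^ 3 * radialKernelDeriv σ x z := by
  have h1 : ∀ s, HasDerivAt (fun s => profile (σ ^ 2 * s)) (σ ^ 2 * deriv profile (σ ^ 2 * s)) s :=
    fun s => by
      have := (hasDerivAt_profile (σ ^ 2 * s)).comp s ((hasDerivAt_id s).const_mul (σ ^ 2))
      simpa [mul_comm, Function.comp_def] using this
  have h2 : ∀ s, HasDerivAt (fun s => σ ^ 2 * deriv profile (σ ^ 2 * s))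
      (σ ^ 2 * (σ ^ 2 * deriv (deriv profile) (σ ^ 2 * s))) s :=
    fun s => by
      have := ((hasDerivAt_deriv_profile (σ ^ 2 * s)).comp s
        ((hasDerivAt_id s).const_mul (σ ^ 2))).const_mul (σ ^ 2)
      simpa [mul_comm, Function.comp_def] using this
  have h3 : ContDiff ℝ 2 (fun s => profile (σ ^ 2 * s)) :=
    (contDiff_profile (n := 2)).comp (contDiff_const.mul contDiff_id)
  rw [laplacian_radial h1 h2 h3 x z, radialKernelDeriv]
  rcases Nat.eq_zero_or_pos d with hd | hd
  · subst hd; simp; ring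
  · obtain ⟨e, rfl⟩ : ∃ e, d = e + 1 := ⟨d - 1, by omega⟩
    simp only [Nat.add_sub_cancel]
    ring

theorem exists_bound_radialKernelDeriv (d : ℕ) {σ : ℝ} (hσ : 0 < σ) : ∃ B : ℝ, ∀ τ ∈ Ioo (σ / 2)
    (2 * σ),
    ∀ x z : Space d, |radialKernelDeriv τ x z| ≤ B := by
  obtain ⟨C, hC, hb⟩ := exists_bound_profile
  -- The second summand is rewritten with s χ''(s), s = τ² ‖z - x‖², which is bounded; the remaining
  -- factor 2 / τ is at most 4 / σ.
  refine ⟨d * (2 * σ) ^ (d - 1) * C + (2 * σ) ^ d * (4 / σ * C), fun τ hτ x z => ?_⟩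
  have hτ0 : 0 < τ := (by positivity : 0 < σ / 2).trans hτ.1
  have hτ1 : τ ≤ 2 * σ := hτ.2.le
  obtain ⟨b1, b2⟩ := hb (τ ^ 2 * ‖z - x‖ ^ 2) (by positivity)
  unfold radialKernelDeriv
  refine (abs_add_le _ _).trans (add_le_add ?_ ?_)
  · rw [abs_mul, abs_of_nonneg (by positivity : 0 ≤ (d : ℝ) * τ ^ (d - 1))]
    gcongr
  · rw [abs_mul, abs_of_nonneg (by positivity : 0 ≤ τ ^ d)]
    have e : deriv (deriv profile) (τ ^ 2 * ‖z - x‖ ^ 2) * (2 * τ * ‖z - x‖ ^ 2) =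
        2 / τ * (τ ^ 2 * ‖z - x‖ ^ 2 * deriv (deriv profile) (τ ^ 2 * ‖z - x‖ ^ 2)) := by
      field_simp
    have h3 : 2 / τ ≤ 4 / σ := by
      rw [div_le_div_iff₀ hτ0 hσ]; linarith [hτ.1]
    rw [e, abs_mul, abs_of_pos (by positivity : 0 < 2 / τ)]
    gcongr

theorem continuous_radialKernelDeriv (σ : ℝ) (x : Space d) :
    Continuous (radialKernelDeriv σ x) := by
  have := (contDiff_deriv_profile (n := 0)).continuous
  have := continuous_deriv_deriv_profile
  unfold radialKernelDeriv
  fun_prop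

theorem integrable_radialKernel_smul {h : Space d → ℂ} (hi : Integrable h) {σ : ℝ} (hσ : 0 < σ)
    (x : Space d) : Integrable (fun z => radialKernel σ x z • h z) := by
  have hc : HasCompactSupport (radialKernel σ x) :=
    HasCompactSupport.intro (isCompact_closedBall x (1 / σ)) fun z hz => radialKernel_eq_zero hσ hz
  obtain ⟨B, hB⟩ := hc.exists_bound_of_continuous (continuous_radialKernel σ x)
  exact hi.bdd_smul (𝕜 := ℝ) B (continuous_radialKernel σ x).aestronglyMeasurable (ae_of_all _ hB)

variable {Ω : Set (Space d)}

/-- The mean is constant in σ as long as the ball of radius 1/σ, which carries the kernel, stays in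
Ω. -/
theorem radialMean_eq_of_le (hΩ : IsOpen Ω) {h : Space d → ℂ} (hi : IntegrableOn h Ω)
    (hw : IsWeaklyHarmonic Ω h) {σ₁ σ₂ : ℝ} (hσ : 0 < σ₁) (hle : σ₁ ≤ σ₂) {x : Space d}
    (hx : Metric.closedBall x (1 / σ₁) ⊆ Ω) :
    radialMean (Ω.indicator h) σ₂ x = radialMean (Ω.indicator h) σ₁ x := by
  have hi0 : Integrable (Ω.indicator h) := (integrable_indicator_iff hΩ.measurableSet).2 hi
  have hder : ∀ σ, σ₁ ≤ σ → HasDerivAt (fun σ => radialMean (Ω.indicator h) σ x) 0 σ := by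
    intro σ hσ1
    have hσ0 : 0 < σ := hσ.trans_le hσ1
    obtain ⟨B, hB⟩ := exists_bound_radialKernelDeriv d hσ0
    have hd := (hasDerivAt_integral_of_dominated_loc_of_deriv_le (μ := (volume : Measure (Space d)))
      (F := fun σ z => radialKernel σ x z • Ω.indicator h z)
      (F' := fun σ z => radialKernelDeriv σ x z • Ω.indicator h z) (x₀ := σ)
      (s := Ioo (σ / 2) (2 * σ)) (bound := fun z => B * ‖Ω.indicator h z‖)
      (Ioo_mem_nhds (by linarith) (by linarith))
      (Eventually.of_forall fun τ =>
        (continuous_radialKernel τ x).aestronglyMeasurable.smul hi0.aestronglyMeasurable)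
      (integrable_radialKernel_smul hi0 hσ0 x)
      ((continuous_radialKernelDeriv σ x).aestronglyMeasurable.smul hi0.aestronglyMeasurable)
      (ae_of_all _ fun z τ hτ => by
        rw [norm_smul]
        exact mul_le_mul_of_nonneg_right (hB τ hτ x z) (norm_nonneg _))
      (hi0.norm.const_mul B)
      (ae_of_all _ fun z τ _ => (hasDerivAt_radialKernel τ x z).smul_const _)).2
    refine hd.congr_deriv ?_
    set ψ : Space d → ℝ := fun y => profile (σ ^ 2 * ‖y - x‖ ^ 2) with hψ
    have hψ1 : ContDiff ℝ ∞ ψ := contDiff_profile.comp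
      (contDiff_const.mul ((contDiff_id.sub contDiff_const).norm_sq ℝ))
    have hψ0 : ∀ z, z ∉ Metric.closedBall x (1 / σ) → ψ z = 0 := fun z hz =>
      profile_eq_zero (one_le_of_notMem_closedBall hσ0 hz)
    have hψ2 : tsupport ψ ⊆ Metric.closedBall x (1 / σ) :=
      closure_minimal (fun z hz => by by_contra h; exact hz (hψ0 z h)) Metric.isClosed_closedBall
    have hψ3 : HasCompactSupport ψ := HasCompactSupport.intro (isCompact_closedBall x (1 / σ)) hψ0
    have hψ4 : tsupport ψ ⊆ Ω := hψ2.trans ((Metric.closedBall_subset_closedBall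
      (one_div_le_one_div_of_le hσ hσ1)).trans hx)
    have h0 := hw ψ hψ1 hψ3 hψ4
    have e : ∀ z, radialKernelDeriv σ x z • Ω.indicator h z =
        (σ ^ d / (2 * σ ^ 3)) • Ω.indicator (fun z => Laplacian.laplacian ψ z • h z) z := by
      intro z
      have e1 : radialKernelDeriv σ x z = σ ^ d / (2 * σ ^ 3) * Laplacian.laplacian ψ z := by
        rw [div_mul_eq_mul_div, hψ, radialKernelDeriv_eq]; field_simp
      by_cases hz : z ∈ Ω
      · simp only [indicator_of_mem hz, e1, mul_smul]
      · simp only [indicator_of_notMem hz, smul_zero]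
    simp only [e]
    rw [integral_smul, integral_indicator hΩ.measurableSet, h0, smul_zero]
  exact constant_of_has_deriv_right_zero (f := fun σ => radialMean (Ω.indicator h) σ x)
    (fun σ hσ1 => (hder σ hσ1.1).continuousAt.continuousWithinAt)
    (fun σ hσ1 => (hder σ hσ1.1).hasDerivWithinAt) σ₂ ⟨hle, le_rfl⟩

/-- Lebesgue differentiation: the kernel lives on the ball of radius 1/σ and is bounded by C σ^d, so
the error is at most a constant times the mean oscillation on that ball. -/
theorem ae_tendsto_radialMean {h : Space d → ℂ} (hi : Integrable h) :
    ∀ᵐ x, Tendsto (fun σ => radialMean h σ x) atTop (𝓝 (kernelMass d • h x)) := by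
  obtain ⟨C, hC, hb⟩ := exists_bound_profile
  filter_upwards [IsUnifLocDoublingMeasure.ae_tendsto_average_norm_sub volume
    hi.locallyIntegrable 1] with x hx
  have hδ : Tendsto (fun σ : ℝ => 1 / σ) atTop (𝓝[>] 0) := by
    simpa [one_div] using tendsto_inv_atTop_nhdsGT_zero (𝕜 := ℝ)
  have h1 := hx (fun _ => x) (fun σ : ℝ => 1 / σ) hδ (by
    filter_upwards [eventually_gt_atTop 0] with σ hσ
    exact Metric.mem_closedBall_self (by positivity))
  set v := volume.real (Metric.closedBall (0 : Space d) 1) with hv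
  have h2 : Tendsto (fun σ : ℝ => C * v *
      ⨍ y in Metric.closedBall x (1 / σ), ‖h y - h x‖) atTop (𝓝 0) := by
    simpa using h1.const_mul (C * v)
  rw [tendsto_iff_norm_sub_tendsto_zero]
  refine squeeze_zero' (Eventually.of_forall fun _ => norm_nonneg _) ?_ h2
  filter_upwards [eventually_gt_atTop 0] with σ hσ
  have hkc : HasCompactSupport (radialKernel σ x) :=
    HasCompactSupport.intro (isCompact_closedBall x (1 / σ)) fun z hz => radialKernel_eq_zero hσ hz
  have hki : Integrable (radialKernel σ x) :=
    (continuous_radialKernel σ x).integrable_of_hasCompactSupport hkc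
  have e1 : radialMean h σ x - kernelMass d • h x =
      ∫ z in Metric.closedBall x (1 / σ), radialKernel σ x z • (h z - h x) := by
    rw [setIntegral_eq_integral_of_forall_compl_eq_zero fun z hz => by
      rw [radialKernel_eq_zero hσ hz, zero_smul]]
    simp only [smul_sub]
    rw [integral_sub (integrable_radialKernel_smul hi hσ x) (hki.smul_const _),
      integral_smul_const, integral_radialKernel hσ, radialMean]
  have hvol : volume.real (Metric.closedBall x (1 / σ)) = (1 / σ) ^ d * v := by
    rw [hv, measureReal_def, measureReal_def, Measure.addHaar_closedBall' _ _ (by positivity),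
      ENNReal.toReal_mul, ENNReal.toReal_ofReal (by positivity), finrank_euclideanSpace_fin]
  have hsub : IntegrableOn (fun z => ‖h z - h x‖) (Metric.closedBall x (1 / σ)) :=
    (hi.integrableOn.sub (integrableOn_const (by
      exact (isCompact_closedBall x (1 / σ)).measure_lt_top.ne))).norm
  rw [e1, setAverage_eq, hvol, smul_eq_mul]
  calc ‖∫ z in Metric.closedBall x (1 / σ), radialKernel σ x z • (h z - h x)‖
      ≤ ∫ z in Metric.closedBall x (1 / σ), σ ^ d * C * ‖h z - h x‖ := by
        refine norm_integral_le_of_norm_le (hsub.const_mul _) (ae_of_all _ fun z => ?_)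
        rw [norm_smul, radialKernel, norm_mul, Real.norm_eq_abs, Real.norm_eq_abs,
          abs_of_pos (by positivity : 0 < σ ^ d)]
        have := (hb (σ ^ 2 * ‖z - x‖ ^ 2) (by positivity)).1
        gcongr
    _ = σ ^ d * C * ∫ z in Metric.closedBall x (1 / σ), ‖h z - h x‖ := integral_const_mul _ _
    _ = C * v * (((1 / σ) ^ d * v)⁻¹ * ∫ z in Metric.closedBall x (1 / σ), ‖h z - h x‖) := by
        have hv0 : v ≠ 0 := by
          rw [hv, measureReal_def]
          exact (ENNReal.toReal_pos (Metric.measure_closedBall_pos _ _ one_pos).ne'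
            (isCompact_closedBall _ _).measure_lt_top.ne).ne'
        have hp : (1 / σ) ^ d = (σ ^ d)⁻¹ := by rw [one_div, inv_pow]
        rw [hp]
        field_simp

/-- For fixed σ the mean is a convolution with a smooth compactly supported kernel. -/
theorem contDiff_radialMean {h : Space d → ℂ} (hi : Integrable h) {σ : ℝ} (hσ : 0 < σ) :
    ContDiff ℝ ∞ (radialMean h σ) := by
  set κ : Space d → ℝ := fun y => radialKernel σ 0 y with hκ
  have hκ1 : ContDiff ℝ ∞ κ := by
    simp only [hκ]
    unfold radialKernel
    exact contDiff_const.mul (contDiff_deriv_profile.comp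
      (contDiff_const.mul ((contDiff_id.sub contDiff_const).norm_sq ℝ)))
  have hκ2 : HasCompactSupport κ :=
    HasCompactSupport.intro (isCompact_closedBall 0 (1 / σ)) fun z hz => radialKernel_eq_zero hσ hz
  have h1 := hκ2.contDiff_convolution_right (μ := (volume : Measure (Space d)))
    ((ContinuousLinearMap.lsmul ℝ ℝ : ℝ →L[ℝ] ℂ →L[ℝ] ℂ).flip) hi.locallyIntegrable (n := ⊤) hκ1
  have e : radialMean h σ = convolution h κ
      ((ContinuousLinearMap.lsmul ℝ ℝ : ℝ →L[ℝ] ℂ →L[ℝ] ℂ).flip) volume := funext fun x => ?_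
  · rw [e]; exact h1
  simp only [radialMean, convolution]
  refine integral_congr_ae (ae_of_all _ fun z => ?_)
  simp only [hκ, radialKernel, ContinuousLinearMap.flip_apply, ContinuousLinearMap.lsmul_apply,
    sub_zero, norm_sub_rev z x]

/-- Weyl's lemma. -/
theorem IsWeaklyHarmonic.exists_contDiffOn (hd : 0 < d) (hΩ : IsOpen Ω) {h : Space d → ℂ}
    (hi : IntegrableOn h Ω) (hw : IsWeaklyHarmonic Ω h) :
    ∃ g : Space d → ℂ, ContDiffOn ℝ ∞ g Ω ∧ h =ᵐ[volume.restrict Ω] g ∧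
      ∀ x ∈ Ω, Laplacian.laplacian g x = 0 := by
  have hi0 : Integrable (Ω.indicator h) := (integrable_indicator_iff hΩ.measurableSet).2 hi
  have hball : ∀ x ∈ Ω, ∃ r > 0, Metric.closedBall x r ⊆ Ω := fun x hx =>
    Metric.nhds_basis_closedBall.mem_iff.1 (hΩ.mem_nhds hx)
  choose! r hr0 hr using hball
  set c := (kernelMass d)⁻¹ with hc
  have hc0 := kernelMass_ne_zero hd
  -- The scale depends on x with no regularity at all; this is harmless because the mean does not
  -- depend on an admissible scale.
  set g : Space d → ℂ := fun x => c • radialMean (Ω.indicator h) (1 / r x) x with hg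
  have hgeq : ∀ x ∈ Ω, ∀ σ, 0 < σ → Metric.closedBall x (1 / σ) ⊆ Ω →
      g x = c • radialMean (Ω.indicator h) σ x := by
    intro x hx σ hσ hs
    have hr' := hr x hx
    have hr1 : 0 < 1 / r x := one_div_pos.2 (hr0 x hx)
    rw [← one_div_one_div (r x)] at hr'
    simp only [hg]
    congr 1
    rcases le_total (1 / r x) σ with hle | hle
    · exact (radialMean_eq_of_le hΩ hi hw hr1 hle hr').symm
    · exact radialMean_eq_of_le hΩ hi hw hσ hle hs
  have hgs : ContDiffOn ℝ ∞ g Ω := by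
    intro x hx
    have hρ : 0 < r x / 2 := by have := hr0 x hx; positivity
    -- Half the radius is admissible for all points y within that distance of x, so near x one fixed
    -- scale may be used.
    have hev : g =ᶠ[𝓝 x] fun y => c • radialMean (Ω.indicator h) (1 / (r x / 2)) y := by
      filter_upwards [Metric.ball_mem_nhds x hρ, hΩ.mem_nhds hx] with y hy hyΩ
      refine hgeq y hyΩ _ (by positivity) ?_
      rw [one_div_one_div]
      refine (Metric.closedBall_subset_closedBall' ?_).trans (hr x hx)
      have := (Metric.mem_ball.1 hy).le
      linarith
    exact (((contDiff_radialMean hi0 (by positivity)).const_smul c).contDiffAt.congr_of_eventuallyEq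
      hev).contDiffWithinAt
  have hae : h =ᵐ[volume.restrict Ω] g := by
    rw [Filter.EventuallyEq, ae_restrict_iff' hΩ.measurableSet]
    filter_upwards [ae_tendsto_radialMean hi0] with x hx hxΩ
    have h1 : Tendsto (fun σ => c • radialMean (Ω.indicator h) σ x) atTop (𝓝 (h x)) := by
      have := hx.const_smul c
      rwa [hc, smul_smul, inv_mul_cancel₀ hc0, one_smul, indicator_of_mem hxΩ] at this
    refine tendsto_nhds_unique h1 (tendsto_const_nhds.congr' ?_)
    have hrx := hr0 x hxΩ
    filter_upwards [eventually_ge_atTop (1 / r x)] with σ hσ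
    have hσ0 : 0 < σ := (one_div_pos.2 hrx).trans_le hσ
    refine hgeq x hxΩ σ hσ0 ((Metric.closedBall_subset_closedBall ?_).trans (hr x hxΩ))
    rw [div_le_iff₀ hσ0]
    rw [div_le_iff₀ hrx] at hσ
    linarith
  refine ⟨g, hgs, hae, ?_⟩
  have hg2 : ContDiffOn ℝ 2 g Ω := hgs.of_le ENat.LEInfty.out
  have hlc : ContinuousOn (Laplacian.laplacian g) Ω := by
    have : ContinuousOn (fun x => ∑ i, pd i (pd i g) x) Ω :=
      continuousOn_finsetSum _ fun i _ => (contDiffOn_pd (m := 0) hΩ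
        (contDiffOn_pd (m := 1) hΩ hg2 (by norm_num)) (by simp)).continuousOn
    exact this.congr fun x hx => laplacian_eq_sum_pd (hg2.contDiffAt (hΩ.mem_nhds hx))
  have hzero : ∀ᵐ x, x ∈ Ω → Laplacian.laplacian g x = 0 := by
    refine hΩ.ae_eq_zero_of_integral_contDiff_smul_eq_zero
      (hlc.locallyIntegrableOn hΩ.measurableSet) fun ψ hψ hψc hψs => ?_
    rw [← setIntegral_smul_of_tsupport hψs, ← integral_laplacian_smul hΩ
      (hψ.of_le ENat.LEInfty.out) hψc hψs hg2, ← hw ψ hψ hψc hψs]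
    refine integral_congr_ae ?_
    filter_upwards [hae] with x hx
    rw [hx]
  have := Measure.eqOn_open_of_ae_eq (μ := (volume : Measure (Space d)))
    (f := Laplacian.laplacian g) (g := fun _ => 0)
    ((ae_restrict_iff' hΩ.measurableSet).2 hzero) hΩ hlc continuousOn_const
  exact fun x hx => this hx

end Weyl

/-! ### The Sobolev space `H₀¹` and the inverse of the Dirichlet Laplacian -/

section Sobolev

variable {d : ℕ} {Ω : Set (Space d)}

/-- `φ` is smooth with compact support in `Ω`. -/
structure IsTestFunction {F : Type*} [NormedAddCommGroup F] [NormedSpace ℝ F] (Ω : Set (Space d))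
    (φ : Space d → F) : Prop where
  contDiff : ContDiff ℝ ∞ φ
  hasCompactSupport : HasCompactSupport φ
  tsupport_subset : tsupport φ ⊆ Ω

namespace IsTestFunction

variable {F : Type*} [NormedAddCommGroup F] [NormedSpace ℝ F] {φ ψ : Space d → F}

theorem continuous (hφ : IsTestFunction Ω φ) : Continuous φ := hφ.contDiff.continuous

theorem differentiable (hφ : IsTestFunction Ω φ) : Differentiable ℝ φ :=
  hφ.contDiff.differentiable (by simp)

theorem memLp (hφ : IsTestFunction Ω φ) (p : ℝ≥0∞) : MemLp φ p (volume.restrict Ω) :=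
  (hφ.continuous.memLp_of_hasCompactSupport hφ.hasCompactSupport).restrict Ω

theorem add (hφ : IsTestFunction Ω φ) (hψ : IsTestFunction Ω ψ) :
    IsTestFunction Ω (fun x => φ x + ψ x) where
  contDiff := hφ.contDiff.add hψ.contDiff
  hasCompactSupport := hφ.hasCompactSupport.add hψ.hasCompactSupport
  tsupport_subset := (tsupport_add φ ψ).trans (union_subset hφ.tsupport_subset hψ.tsupport_subset)

theorem const_smul {𝕜 : Type*} [NormedField 𝕜] [NormedAlgebra ℝ 𝕜] [NormedSpace 𝕜 F]
    [IsScalarTower ℝ 𝕜 F] (hφ : IsTestFunction Ω φ)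
    (c : 𝕜) : IsTestFunction Ω (fun x => c • φ x) where
  contDiff := hφ.contDiff.const_smul c
  hasCompactSupport := hφ.hasCompactSupport.comp_left (g := fun y => c • y) (smul_zero c)
  tsupport_subset := (closure_mono fun x hx => by
    contrapose! hx; simp only [Function.mem_support, not_not] at hx ⊢
    rw [hx, smul_zero]).trans hφ.tsupport_subset

theorem partialDeriv (hφ : IsTestFunction Ω φ) (i : Fin d) : IsTestFunction Ω (pd i φ) where
  contDiff := contDiff_pd hφ.contDiff (by simp)
  hasCompactSupport := hasCompactSupport_pd hφ.hasCompactSupport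
  tsupport_subset := (tsupport_pd_subset i φ).trans hφ.tsupport_subset

theorem ofReal {ψ : Space d → ℝ} (hψ : IsTestFunction Ω ψ) :
    IsTestFunction Ω (fun x => (ψ x : ℂ)) where
  contDiff := Complex.ofRealCLM.contDiff.comp hψ.contDiff
  hasCompactSupport := hψ.hasCompactSupport.comp_left (g := Complex.ofReal) rfl
  tsupport_subset := (closure_mono fun x hx => by
    contrapose! hx; simp only [Function.mem_support, not_not] at hx ⊢
    rw [hx, Complex.ofReal_zero]).trans hψ.tsupport_subset

theorem pd_ofReal {ψ : Space d → ℝ} (hψ : IsTestFunction Ω ψ) (i : Fin d) (x : Space d) :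
    pd i (fun x => (ψ x : ℂ)) x = ((pd i ψ x : ℝ) : ℂ) := by
  have := (Complex.ofRealCLM.hasFDerivAt.comp x (hψ.differentiable x).hasFDerivAt).fderiv
  unfold pd
  rw [show (fun x => (ψ x : ℂ)) = Complex.ofRealCLM ∘ ψ from rfl, this]
  rfl

end IsTestFunction

/-- The weak gradient of an element of `H₀¹`. -/
def gradV (Ω : Set (Space d)) : V Ω →L[ℂ] PiLp 2 (fun _ : Fin d => H Ω) :=
  (WithLp.sndL 2 ℂ (H Ω) (PiLp 2 (fun _ : Fin d => H Ω))).comp (H01Submodule Ω).subtypeL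

/-- `v` is the element of `H₀¹` that is given by the function `φ`. -/
def Represents (v : V Ω) (φ : Space d → ℂ) : Prop :=
  embVH Ω v =ᵐ[volume.restrict Ω] φ ∧ ∀ i, gradV Ω v i =ᵐ[volume.restrict Ω] pd i φ

theorem ext_V {v w : V Ω} (h : embVH Ω v = embVH Ω w) (h' : ∀ i, gradV Ω v i = gradV Ω w i) :
    v = w := by
  apply Subtype.ext
  apply WithLp.ofLp_injective
  refine Prod.ext h ?_
  exact PiLp.ext h'

theorem IsTestFunction.exists_represents {φ : Space d → ℂ} (hφ : IsTestFunction Ω φ) :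
    ∃ v : V Ω, Represents v φ := by
  let p : H1Ambient Ω := WithLp.toLp 2 ((hφ.memLp 2).toLp φ,
    WithLp.toLp 2 fun i => ((hφ.partialDeriv i).memLp 2).toLp (pd i φ))
  have h1 : p.fst =ᵐ[volume.restrict Ω] φ := (hφ.memLp 2).coeFn_toLp
  have h2 : ∀ i, p.snd i =ᵐ[volume.restrict Ω] pd i φ := fun i =>
    ((hφ.partialDeriv i).memLp 2).coeFn_toLp
  have hp : p ∈ testPairs Ω := ⟨φ, hφ.contDiff, hφ.hasCompactSupport, hφ.tsupport_subset, h1, h2⟩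
  exact ⟨⟨p, subset_closure (Submodule.subset_span hp)⟩, h1, h2⟩

/-- Test functions already form a subspace, so each element of V is the limit of a sequence of test
functions rather than of linear combinations of pairs. -/
theorem span_testPairs (Ω : Set (Space d)) :
    (Submodule.span ℂ (testPairs Ω) : Set (H1Ambient Ω)) = testPairs Ω := by
  refine Subset.antisymm (fun p hp => ?_) Submodule.subset_span
  induction hp using Submodule.span_induction with
  | mem p hp => exact hp
  | zero =>
    refine ⟨0, contDiff_const, HasCompactSupport.zero, by simp [tsupport], ?_, fun i => ?_⟩
    · exact Lp.coeFn_zero ..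
    · refine (Lp.coeFn_zero ..).trans ?_
      refine Eventually.of_forall fun x => ?_
      simp
  | add p q _ _ hp hq =>
    obtain ⟨φ, a1, a2, a3, a4, a5⟩ := hp
    obtain ⟨ψ, b1, b2, b3, b4, b5⟩ := hq
    have hφ : IsTestFunction Ω φ := ⟨a1, a2, a3⟩
    have hψ : IsTestFunction Ω ψ := ⟨b1, b2, b3⟩
    have h := hφ.add hψ
    refine ⟨_, h.1, h.2, h.3, ?_, fun i => ?_⟩
    · filter_upwards [Lp.coeFn_add p.fst q.fst, a4, b4] with x h1 h2 h3
      rw [WithLp.add_fst, h1, Pi.add_apply, h2, h3]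
    · filter_upwards [Lp.coeFn_add (p.snd i) (q.snd i), a5 i, b5 i] with x h1 h2 h3
      rw [WithLp.add_snd, PiLp.add_apply, h1, Pi.add_apply, h2, h3, fderiv_fun_add
        (hφ.differentiable x)
        (hψ.differentiable x)]
      rfl
  | smul c p _ hp =>
    obtain ⟨φ, a1, a2, a3, a4, a5⟩ := hp
    have hφ : IsTestFunction Ω φ := ⟨a1, a2, a3⟩
    have h := hφ.const_smul c
    refine ⟨_, h.1, h.2, h.3, ?_, fun i => ?_⟩
    · filter_upwards [Lp.coeFn_smul c p.fst, a4] with x h1 h2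
      rw [WithLp.smul_fst, h1, Pi.smul_apply, h2]
    · filter_upwards [Lp.coeFn_smul c (p.snd i), a5 i] with x h1 h2
      rw [WithLp.smul_snd, PiLp.smul_apply, h1, Pi.smul_apply, h2,
        fderiv_fun_const_smul (hφ.differentiable x)]
      rfl

theorem exists_tendsto_represents (v : V Ω) : ∃ (w : ℕ → V Ω) (φ : ℕ → Space d → ℂ),
    Tendsto w atTop (𝓝 v) ∧ ∀ n, IsTestFunction Ω (φ n) ∧ Represents (w n) (φ n) := by
  have hv : (v : H1Ambient Ω) ∈ closure (testPairs Ω) := by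
    rw [← span_testPairs]; exact v.2
  obtain ⟨p, hp, hlim⟩ := mem_closure_iff_seq_limit.1 hv
  choose φ h1 h2 h3 h4 h5 using hp
  refine ⟨fun n => ⟨p n, subset_closure (Submodule.subset_span
    ⟨φ n, h1 n, h2 n, h3 n, h4 n, h5 n⟩)⟩, φ, ?_, fun n => ⟨⟨h1 n, h2 n, h3 n⟩, h4 n, h5 n⟩⟩
  exact tendsto_subtype_rng.2 hlim

/-- Density argument: closed properties of elements of V need to be checked on test functions only.
-/
theorem V_induction {P : V Ω → Prop} (hP : IsClosed {v | P v})
    (h : ∀ v φ, IsTestFunction Ω φ → Represents v φ → P v) (v : V Ω) : P v := by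
  obtain ⟨w, φ, hw, hφ⟩ := exists_tendsto_represents v
  exact hP.mem_of_tendsto hw (Eventually.of_forall fun n => h _ _ (hφ n).1 (hφ n).2)

theorem inner_eq_integral_of_ae_eq {f h : H Ω} {g : Space d → ℂ}
    (hf : f =ᵐ[volume.restrict Ω] g) : inner ℂ f h = ∫ x in Ω, conj (g x) * h x := by
  rw [L2.inner_def]
  refine integral_congr_ae ?_
  filter_upwards [hf] with x hx
  rw [hx, RCLike.inner_apply, mul_comm]

theorem IsTestFunction.integral_smul_eq_inner {ψ : Space d → ℝ} (hψ : IsTestFunction Ω ψ)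
    (h : H Ω) : ∫ x in Ω, ψ x • h x = inner ℂ ((hψ.ofReal.memLp 2).toLp _) h := by
  rw [inner_eq_integral_of_ae_eq (hψ.ofReal.memLp 2).coeFn_toLp]
  simp

theorem IsTestFunction.continuous_integral_smul {ψ : Space d → ℝ} (hψ : IsTestFunction Ω ψ) :
    Continuous fun h : H Ω => ∫ x in Ω, ψ x • h x := by
  simp_rw [hψ.integral_smul_eq_inner]
  fun_prop

theorem integral_smul_gradV (hΩ : IsOpen Ω) {ψ : Space d → ℝ} (hψ : IsTestFunction Ω ψ)
    (i : Fin d) (v : V Ω) :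
    ∫ x in Ω, ψ x • gradV Ω v i x = -∫ x in Ω, pd i ψ x • embVH Ω v x := by
  induction v using V_induction with
  | hP =>
    refine isClosed_eq (hψ.continuous_integral_smul.comp ?_)
      ((hψ.partialDeriv i).continuous_integral_smul.comp (embVH Ω).continuous).neg
    exact (PiLp.continuous_apply 2 (fun _ : Fin d => H Ω) i).comp (gradV Ω).continuous
  | h v φ hφ hv =>
    have h1 : ∫ x in Ω, ψ x • gradV Ω v i x = ∫ x in Ω, ψ x • pd i φ x :=
      integral_congr_ae ((hv.2 i).mono fun x hx => by simp only [hx])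
    have h2 : ∫ x in Ω, pd i ψ x • embVH Ω v x = ∫ x in Ω, pd i ψ x • φ x :=
      integral_congr_ae (hv.1.mono fun x hx => by simp only [hx])
    rw [h1, h2, integral_pd_smul hΩ (hψ.contDiff.of_le (by simp)) hψ.hasCompactSupport
      hψ.tsupport_subset (hφ.contDiff.contDiffOn.of_le (by simp)) i, neg_neg]

theorem eq_zero_of_integral_test_smul (hΩ : IsOpen Ω) {h : H Ω}
    (h0 : ∀ ψ : Space d → ℝ, IsTestFunction Ω ψ → ∫ x in Ω, ψ x • h x = 0) : h = 0 := by
  rw [Lp.eq_zero_iff_ae_eq_zero, Filter.EventuallyEq, ae_restrict_iff' hΩ.measurableSet]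
  refine hΩ.ae_eq_zero_of_integral_contDiff_smul_eq_zero ?_ fun ψ hψ hψc hψs => ?_
  · exact locallyIntegrableOn_of_locallyIntegrable_restrict
      ((Lp.memLp h).locallyIntegrable (by norm_num))
  · rw [← setIntegral_smul_of_tsupport hψs]
    exact h0 ψ ⟨hψ, hψc, hψs⟩

/-- An element of V stores its gradient separately, but the gradient is determined by the function
through integration by parts. -/
theorem embVH_injective (hΩ : IsOpen Ω) : Function.Injective (embVH Ω) := by
  rw [injective_iff_map_eq_zero]
  intro v hv
  refine ext_V (by rw [hv, map_zero]) fun i => ?_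
  rw [map_zero]
  refine eq_zero_of_integral_test_smul hΩ fun ψ hψ => ?_
  rw [integral_smul_gradV hΩ hψ, hv, neg_eq_zero]
  refine integral_eq_zero_of_ae ?_
  filter_upwards [Lp.coeFn_zero ℂ 2 (volume.restrict Ω)] with x hx
  rw [hx]; simp

theorem embVH_denseRange (hΩ : IsOpen Ω) : DenseRange (embVH Ω) := by
  have : (LinearMap.range (embVH Ω).toLinearMap).topologicalClosure = ⊤ := by
    rw [Submodule.topologicalClosure_eq_top_iff, Submodule.eq_bot_iff]
    intro h hh
    refine eq_zero_of_integral_test_smul hΩ fun ψ hψ => ?_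
    obtain ⟨v, hv, -⟩ := hψ.ofReal.exists_represents
    have := Submodule.inner_right_of_mem_orthogonal (LinearMap.mem_range_self _ v) hh
    rw [ContinuousLinearMap.coe_coe, inner_eq_integral_of_ae_eq hv] at this
    simpa using this
  have h := Submodule.dense_iff_topologicalClosure_eq_top.2 this
  rwa [LinearMap.coe_range] at h

/-- The Gagliardo–Nirenberg–Sobolev inequality with both exponents 2. It requires 2 < d, which is
the reason for the bound on the dimension. -/
theorem exists_poincare (hd : 3 ≤ d) (hΩb : Bornology.IsBounded Ω) :
    ∃ c : ℝ, ∀ v : V Ω, ‖embVH Ω v‖ ≤ c * ‖gradV Ω v‖ := by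
  have hfr : Module.finrank ℝ (Space d) = d := by simp
  let C := MeasureTheory.eLpNormLESNormFDerivOfLeConst ℂ (volume : Measure (Space d)) Ω 2 2
  refine ⟨C * d, fun v => ?_⟩
  induction v using V_induction with
  | hP => exact isClosed_le (by fun_prop) (by fun_prop)
  | h v φ hφ hv =>
    have h1 : eLpNorm φ 2 volume ≤ C * eLpNorm (fderiv ℝ φ) 2 volume := by
      refine eLpNorm_le_eLpNorm_fderiv_of_le volume (p := 2) (q := 2)
        (hφ.contDiff.of_le (by simp)) (subset_closure.trans hφ.tsupport_subset) (by norm_num) ?_ ?_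
          hΩb
      · rw [hfr]
        have : (3 : NNReal) ≤ d := by exact_mod_cast hd
        exact lt_of_lt_of_le (by norm_num) this
      · rw [hfr]
        have : (0 : ℝ) ≤ (d : ℝ)⁻¹ := by positivity
        push_cast; linarith
    have h2 : eLpNorm (fderiv ℝ φ) 2 volume ≤ ∑ i, eLpNorm (pd i φ) 2 volume := by
      refine (eLpNorm_mono_real (g := fun x => ∑ i, ‖pd i φ x‖) fun x => ?_).trans ?_
      · refine ContinuousLinearMap.opNorm_le_bound _ (by positivity) fun y => ?_
        have hy : y = ∑ i, y i • EuclideanSpace.single i (1 : ℝ) := by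
          simpa using ((EuclideanSpace.basisFun (Fin d) ℝ).sum_repr y).symm
        conv_lhs => rw [hy, map_sum]
        rw [Finset.sum_mul]
        refine norm_sum_le_of_le _ fun i _ => ?_
        rw [map_smul, norm_smul, mul_comm]
        exact mul_le_mul_of_nonneg_left (PiLp.norm_apply_le y i) (norm_nonneg _)
      · rw [show (fun x => ∑ i, ‖pd i φ x‖) = ∑ i, fun x => ‖pd i φ x‖ by ext; simp]
        refine (eLpNorm_sum_le (fun i _ =>
          (hφ.partialDeriv i).continuous.norm.aestronglyMeasurable) (by norm_num)).trans ?_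
        simp_rw [eLpNorm_norm]
        rfl
    have h3 : ∀ i, eLpNorm (pd i φ) 2 volume ≤ ‖gradV Ω v‖ₑ := fun i => by
      rw [← eLpNorm_restrict_eq_of_support_subset (s := Ω)
        (subset_closure.trans (hφ.partialDeriv i).tsupport_subset), ← eLpNorm_congr_ae (hv.2 i),
        ← Lp.enorm_def]
      exact enorm_le_iff_norm_le.2 (PiLp.norm_apply_le (gradV Ω v) i)
    have h4 : ‖embVH Ω v‖ₑ ≤ C * (d * ‖gradV Ω v‖ₑ) := by
      rw [Lp.enorm_def, eLpNorm_congr_ae hv.1, eLpNorm_restrict_eq_of_support_subset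
        (subset_closure.trans hφ.tsupport_subset)]
      refine h1.trans (mul_le_mul_right (h2.trans ((Finset.sum_le_sum fun i _ => h3 i).trans ?_)) _)
      simp
    have h5 := ENNReal.toReal_mono (by simp [ENNReal.mul_eq_top]) h4
    simpa [mul_assoc] using h5

/-- The gradient, scaled so that `‖D v‖² = ½ ‖∇ v‖²`. -/
def halfGrad (Ω : Set (Space d)) : V Ω →L[ℂ] PiLp 2 (fun _ : Fin d => H Ω) :=
  ((√(1 / 2) : ℝ) : ℂ) • gradV Ω

theorem inner_halfGrad (v w : V Ω) :
    inner ℂ (halfGrad Ω v) (halfGrad Ω w) = 1 / 2 * ∑ i, inner ℂ (gradV Ω v i) (gradV Ω w i) := by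
  rw [halfGrad, smul_apply, smul_apply, inner_smul_left,
    inner_smul_right, Complex.conj_ofReal, ← mul_assoc, ← Complex.ofReal_mul,
    Real.mul_self_sqrt (by norm_num), PiLp.inner_apply]
  norm_num

/-- `G : H → V` is the solution operator of the Dirichlet problem for `-½ Δ`. -/
abbrev IsDirichletInverse (G : H Ω →L[ℂ] V Ω) : Prop :=
  IsSolutionOperator (H := H Ω) (V := V Ω) (Y := PiLp 2 fun _ : Fin d => H Ω) (embVH Ω)
    (halfGrad Ω) G

instance : CompleteSpace (V Ω) :=
  (Submodule.isClosed_topologicalClosure _).completeSpace_coe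

theorem exists_isDirichletInverse (hd : 3 ≤ d) (hΩ : IsOpen Ω) (hΩb : Bornology.IsBounded Ω) :
    ∃ G : H Ω →L[ℂ] V Ω, IsDirichletInverse G ∧ DenseRange G := by
  obtain ⟨c, hc⟩ := exists_poincare hd hΩb
  -- By Poincaré the full norm is at most (|c| + 1) ‖∇v‖; the factor √2 undoes the scaling of
  -- `halfGrad`.
  have h1 : ∀ v : V Ω, ‖v‖ ≤ ((|c| + 1) * √2) * ‖halfGrad Ω v‖ := fun v => by
    have e1 : ‖v‖ ^ 2 = ‖embVH Ω v‖ ^ 2 + ‖gradV Ω v‖ ^ 2 := WithLp.prod_norm_sq_eq_of_L2 v.1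
    have e2 : ‖gradV Ω v‖ = √2 * ‖halfGrad Ω v‖ := by
      rw [halfGrad, smul_apply, norm_smul, Complex.norm_real, Real.norm_of_nonneg (by positivity),
        ← mul_assoc, ← Real.sqrt_mul (by norm_num)]
      norm_num
    have e3 : ‖embVH Ω v‖ ≤ |c| * ‖gradV Ω v‖ :=
      (hc v).trans (mul_le_mul_of_nonneg_right (le_abs_self c) (norm_nonneg _))
    rw [mul_assoc, ← e2]
    refine abs_le_of_sq_le_sq' ?_ (by positivity) |>.2
    rw [e1]
    have := pow_le_pow_left₀ (norm_nonneg _) e3 2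
    nlinarith [mul_nonneg (abs_nonneg c) (sq_nonneg ‖gradV Ω v‖)]
  exact exists_solutionOperator (H := H Ω) (V := V Ω) (Y := PiLp 2 fun _ : Fin d => H Ω)
    (fun v hv => embVH_injective hΩ (hv.trans (map_zero _).symm)) (embVH_denseRange hΩ) h1

variable {G : H Ω →L[ℂ] V Ω}

theorem IsDirichletInverse.integral_test (hG : IsDirichletInverse G)
    (f : H Ω) {φ : Space d → ℂ} (hφ : IsTestFunction Ω φ) :
    1 / 2 * ∑ i, ∫ x in Ω, conj (pd i φ x) * gradV Ω (G f) i x = ∫ x in Ω, conj (φ x) * f x := by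
  obtain ⟨v, hv⟩ := hφ.exists_represents
  have := hG.inner_left f v
  rw [inner_halfGrad, inner_eq_integral_of_ae_eq hv.1] at this
  rw [this]
  simp_rw [inner_eq_integral_of_ae_eq (hv.2 _)]

theorem IsDirichletInverse.integral_laplacian (hΩ : IsOpen Ω) (hG : IsDirichletInverse G)
    (f : H Ω) {ψ : Space d → ℝ} (hψ : IsTestFunction Ω ψ) :
    ∫ x in Ω, Laplacian.laplacian ψ x • embVH Ω (G f) x = -2 * ∫ x in Ω, ψ x • f x := by
  have h1 := hG.integral_test f hψ.ofReal
  simp only [hψ.pd_ofReal, Complex.conj_ofReal] at h1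
  have h2 : ∀ i, ∫ x in Ω, ((pd i ψ x : ℝ) : ℂ) * gradV Ω (G f) i x
      = -∫ x in Ω, pd i (pd i ψ) x • embVH Ω (G f) x := fun i => by
    rw [← integral_smul_gradV hΩ (hψ.partialDeriv i)]
    simp
  have h3 : ∫ x in Ω, Laplacian.laplacian ψ x • embVH Ω (G f) x
      = ∑ i, ∫ x in Ω, pd i (pd i ψ) x • embVH Ω (G f) x := by
    rw [← integral_finsetSum]
    · refine integral_congr_ae (Eventually.of_forall fun x => ?_)
      simp only
      rw [laplacian_eq_sum_pd (hψ.contDiff.contDiffAt.of_le ENat.LEInfty.out), Finset.sum_smul]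
    · intro i _
      have h := ((hψ.partialDeriv i).partialDeriv i).memLp 2
      exact memLp_one_iff_integrable.1 ((Lp.memLp (embVH Ω (G f))).smul h)
  simp_rw [h2, Finset.sum_neg_distrib, ← h3] at h1
  have h4 : ∫ x in Ω, ψ x • f x = ∫ x in Ω, (ψ x : ℂ) * f x := by simp
  rw [h4, ← h1]
  ring

end Sobolev

/-! ### Barriers at the boundary -/

section Barrier

variable {d : ℕ} {Ω : Set (Space d)}

/-- The derivative is Lipschitz near x; apply the mean value inequality on the ball of radius ‖y -
x‖. -/
theorem exists_quadratic_bound {ρ : Space d → ℝ} {x : Space d} (hρ : ContDiffAt ℝ 2 ρ x) :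
    ∃ K δ : ℝ, 0 ≤ K ∧ 0 < δ ∧ ∀ y ∈ Metric.ball x δ,
      |ρ y - ρ x - fderiv ℝ ρ x (y - x)| ≤ K * ‖y - x‖ ^ 2 := by
  have h1 : ContDiffAt ℝ 1 (fderiv ℝ ρ) x := hρ.fderiv_right (by norm_num)
  obtain ⟨K, t, ht, hK⟩ := h1.exists_lipschitzOnWith
  have h2 : ∀ᶠ y in 𝓝 x, DifferentiableAt ℝ ρ y :=
    (hρ.eventually (by simp)).mono fun y hy => hy.differentiableAt (by simp)
  obtain ⟨δ, hδ, hb⟩ := Metric.mem_nhds_iff.1 (inter_mem ht h2)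
  refine ⟨K, δ, K.2, hδ, fun y hy => ?_⟩
  have hsub : Metric.closedBall x ‖y - x‖ ⊆ Metric.ball x δ := fun z hz => by
    rw [Metric.mem_closedBall] at hz
    rw [Metric.mem_ball, dist_eq_norm] at hy
    exact Metric.mem_ball.2 (hz.trans_lt hy)
  have := (convex_closedBall x ‖y - x‖).norm_image_sub_le_of_norm_hasFDerivWithin_le'
    (f := ρ) (f' := fderiv ℝ ρ) (φ := fderiv ℝ ρ x) (C := K * ‖y - x‖) (x := x) (y := y)
    (fun z hz => ((hb (hsub hz)).2).hasFDerivAt.hasFDerivWithinAt)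
    (fun z hz => by
      have := hK.norm_sub_le (hb (hsub hz)).1 (mem_of_mem_nhds ht)
      refine this.trans ?_
      rw [mem_closedBall_iff_norm] at hz
      gcongr) (by simp) (by simp [dist_eq_norm])
  rw [Real.norm_eq_abs] at this
  rwa [pow_two, ← mul_assoc]

/-- The gradient g of ρ points out of Ω, so the ball is centred at x₀ + r g/‖g‖. If it contained a
point y of Ω, then ‖y - x₀‖² < 2 (r/‖g‖) (g, y - x₀), while ρ(y) < 0 ≤ ρ(x₀) and Taylor's formula
give (g, y - x₀) < K ‖y - x₀‖². For small r these are incompatible. -/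
theorem HasSmoothBoundary.exists_exterior_ball (hΩ : IsOpen Ω) (hs : HasSmoothBoundary Ω)
    {x₀ : Space d} (hx₀ : x₀ ∈ frontier Ω) :
    ∃ (z : Space d) (r : ℝ), 0 < r ∧ ‖x₀ - z‖ = r ∧ ∀ y ∈ Ω, r ≤ ‖y - z‖ := by
  obtain ⟨U, ρ, hU, hxU, hρ, hD, hmem⟩ := hs x₀ hx₀
  obtain ⟨K, δ, hK, hδ, hb⟩ := exists_quadratic_bound
    ((hρ.contDiffAt (hU.mem_nhds hxU)).of_le ENat.LEInfty.out)
  obtain ⟨δ', hδ', hb'⟩ := Metric.mem_nhds_iff.1 (hU.mem_nhds hxU)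
  have hρ0 : 0 ≤ ρ x₀ := by
    by_contra h
    have := (hmem x₀ hxU).2 (not_le.1 h)
    rw [frontier, hΩ.interior_eq] at hx₀
    exact hx₀.2 this
  set g := (InnerProductSpace.toDual ℝ (Space d)).symm (fderiv ℝ ρ x₀) with hg
  have hgi : ∀ v, fderiv ℝ ρ x₀ v = inner ℝ g v := fun v => by
    rw [hg, InnerProductSpace.toDual_symm_apply]
  have hg0 : 0 < ‖g‖ := by
    rw [norm_pos_iff]; intro h
    apply hD; ext v; rw [hgi, h, inner_zero_left]; rfl
  -- The first two bounds keep the ball where Taylor's formula and the description by ρ hold; the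
  -- last makes r K/‖g‖ at most ½.
  set r := min (min (δ / 2) (δ' / 2)) (‖g‖ / (2 * (K + 1))) with hr
  have hr0 : 0 < r := by positivity
  have hrδ : 2 * r ≤ δ := by
    have := (min_le_left _ _).trans (min_le_left (δ / 2) (δ' / 2)) |>.trans_eq' hr; linarith
  have hrδ' : 2 * r ≤ δ' := by
    have := (min_le_left _ _).trans (min_le_right (δ / 2) (δ' / 2)) |>.trans_eq' hr; linarith
  have hrK : 2 * r * (K + 1) ≤ ‖g‖ := by
    have h := (min_le_right (min (δ / 2) (δ' / 2)) (‖g‖ / (2 * (K + 1)))).trans_eq' hr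
    rw [le_div_iff₀ (by positivity)] at h; linarith
  have hn : ‖(r / ‖g‖) • g‖ = r := by
    rw [norm_smul, Real.norm_of_nonneg (by positivity), div_mul_cancel₀ _ hg0.ne']
  refine ⟨x₀ + (r / ‖g‖) • g, r, hr0, by simpa [norm_neg] using hn, fun y hy => ?_⟩
  by_contra! hlt
  have h1 : ‖y - x₀‖ < 2 * r := by
    have : y - x₀ = (y - (x₀ + (r / ‖g‖) • g)) + (r / ‖g‖) • g := by abel
    rw [this]
    exact (norm_add_le _ _).trans_lt (by linarith)
  have h2 := hb y (by rw [Metric.mem_ball, dist_eq_norm]; linarith)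
  have h3 := (hmem y (hb' (by rw [Metric.mem_ball, dist_eq_norm]; linarith))).1 hy
  have h4 : ‖y - x₀‖ ^ 2 - 2 * (r / ‖g‖ * inner ℝ g (y - x₀)) + r ^ 2 < r ^ 2 := by
    have e : y - (x₀ + (r / ‖g‖) • g) = (y - x₀) - (r / ‖g‖) • g := by abel
    have := pow_lt_pow_left₀ hlt (norm_nonneg _) two_ne_zero
    rw [e, norm_sub_sq_real, hn, inner_smul_right, real_inner_comm] at this
    exact this
  rw [hgi] at h2
  have h5 := (abs_le.1 h2).1
  have h6 : r / ‖g‖ * inner ℝ g (y - x₀) < r / ‖g‖ * (K * ‖y - x₀‖ ^ 2) :=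
    mul_lt_mul_of_pos_left (by linarith) (by positivity)
  have h7 : r / ‖g‖ * (K * ‖y - x₀‖ ^ 2) ≤ ‖y - x₀‖ ^ 2 / 2 := by
    have : r * K / ‖g‖ ≤ 1 / 2 := by rw [div_le_iff₀ hg0]; linarith
    calc _ = (r * K / ‖g‖) * ‖y - x₀‖ ^ 2 := by ring
      _ ≤ (1 / 2) * ‖y - x₀‖ ^ 2 := by gcongr
      _ = _ := by ring
  linarith

/-- The barrier is a multiple of e^{-l r²} - e^{-l ‖x - z‖²}, with z the centre and r the radius of
an exterior ball; it is superharmonic on Ω once l is large. -/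
theorem HasSmoothBoundary.exists_barrier (hd : 0 < d) (hΩ : IsOpen Ω) (hΩb : Bornology.IsBounded Ω)
    (hs : HasSmoothBoundary Ω) {x₀ : Space d} (hx₀ : x₀ ∈ frontier Ω) {F : ℝ} (hF : 0 ≤ F) :
    ∃ b : Space d → ℝ, ContDiff ℝ ∞ b ∧ b x₀ = 0 ∧ (∀ x ∈ Ω, 0 ≤ b x) ∧
      ∀ x ∈ Ω, F ≤ -(1 / 2 * Laplacian.laplacian b x) := by
  obtain ⟨z, r, hr, hxz, hout⟩ := hs.exists_exterior_ball hΩ hx₀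
  obtain ⟨R, hR⟩ := hΩb.subset_closedBall z
  have hd' : (0 : ℝ) < d := by exact_mod_cast hd
  -- With this l one has l ‖x - z‖² ≥ d on Ω, so the factor 2 l ‖x - z‖² - d in -½Δ is at least d.
  -- Dividing by c then makes the lower bound equal to F.
  set l : ℝ := d / r ^ 2 with hl
  have hl0 : 0 < l := by positivity
  set c := d * l * Real.exp (-l * R ^ 2) with hc
  have hc0 : 0 < c := by positivity
  set χ : ℝ → ℝ := fun s => F / c * (Real.exp (-l * r ^ 2) - Real.exp (-l * s)) with hχ
  have h1 : ∀ s, HasDerivAt χ (F / c * (l * Real.exp (-l * s))) s := fun s => by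
    have := ((((hasDerivAt_id s).const_mul (-l)).exp).const_sub (Real.exp (-l * r ^ 2))).const_mul
      (F / c)
    simp only [id_eq] at this
    exact this.congr_deriv (by ring)
  have h2 : ∀ s, HasDerivAt (fun s => F / c * (l * Real.exp (-l * s)))
      (F / c * (-l ^ 2 * Real.exp (-l * s))) s := fun s => by
    have := ((((hasDerivAt_id s).const_mul (-l)).exp).const_mul l).const_mul (F / c)
    simp only [id_eq] at this
    exact this.congr_deriv (by ring)
  refine ⟨fun x => χ (‖x - z‖ ^ 2), ?_, ?_, fun x hx => ?_, fun x hx => ?_⟩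
  · have : ContDiff ℝ ∞ fun x : Space d => ‖x - z‖ ^ 2 := (contDiff_id.sub contDiff_const).norm_sq ℝ
    simp only [hχ]
    fun_prop
  · simp [hχ, hxz]
  · simp only [hχ]
    have : Real.exp (-l * ‖x - z‖ ^ 2) ≤ Real.exp (-l * r ^ 2) := by
      rw [Real.exp_le_exp, neg_mul, neg_mul, neg_le_neg_iff]
      have := hout x hx
      gcongr
    exact mul_nonneg (by positivity) (by linarith)
  · have hr2 : r ^ 2 ≤ ‖x - z‖ ^ 2 := by have := hout x hx; gcongr
    have hR2 : ‖x - z‖ ^ 2 ≤ R ^ 2 := by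
      have := mem_closedBall_iff_norm.1 (hR hx); gcongr
    rw [laplacian_radial h1 h2 (by simp only [hχ]; fun_prop)]
    have hE : Real.exp (-l * R ^ 2) ≤ Real.exp (-l * ‖x - z‖ ^ 2) := by
      rw [Real.exp_le_exp, neg_mul, neg_mul, neg_le_neg_iff]
      gcongr
    have hls : d ≤ l * ‖x - z‖ ^ 2 := by
      calc (d : ℝ) = l * r ^ 2 := by rw [hl]; field_simp
        _ ≤ _ := by gcongr
    calc F = F / c * c := by field_simp
      _ = F / c * (l * Real.exp (-l * R ^ 2) * d) := by rw [hc]; ring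
      _ ≤ F / c * (l * Real.exp (-l * ‖x - z‖ ^ 2) * (2 * (l * ‖x - z‖ ^ 2) - d)) := by
        gcongr; linarith
      _ = _ := by ring

end Barrier

/-! ### Comparison of weak solutions with barriers -/

section Comparison

variable {d : ℕ} {Ω : Set (Space d)}

/-- A smooth function that vanishes exactly on `(-∞, 0]`, with derivative in `[0, 1]`. -/
def smoothPosPart (s : ℝ) : ℝ := ∫ t in (0 : ℝ)..s, Real.smoothTransition t

theorem hasDerivAt_smoothPosPart (s : ℝ) :
    HasDerivAt smoothPosPart (Real.smoothTransition s) s :=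
  Real.smoothTransition.continuous.integral_hasStrictDerivAt 0 s |>.hasDerivAt

theorem contDiff_smoothPosPart : ContDiff ℝ ∞ smoothPosPart := by
  rw [contDiff_infty_iff_deriv]
  refine ⟨fun s => (hasDerivAt_smoothPosPart s).differentiableAt, ?_⟩
  rw [show deriv smoothPosPart = Real.smoothTransition from
    funext fun s => (hasDerivAt_smoothPosPart s).deriv]
  exact Real.smoothTransition.contDiff

theorem monotone_smoothPosPart : Monotone smoothPosPart :=
  monotone_of_hasDerivAt_nonneg hasDerivAt_smoothPosPart fun s => Real.smoothTransition.nonneg s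

theorem smoothPosPart_eq_zero {s : ℝ} (hs : s ≤ 0) : smoothPosPart s = 0 := by
  rw [smoothPosPart, intervalIntegral.integral_symm, neg_eq_zero]
  refine intervalIntegral.integral_zero_ae (Eventually.of_forall fun _ ht => ?_)
  rw [uIoc_of_le hs] at ht
  exact Real.smoothTransition.zero_of_nonpos ht.2

theorem smoothPosPart_nonneg (s : ℝ) : 0 ≤ smoothPosPart s := by
  rcases le_total s 0 with h | h
  · rw [smoothPosPart_eq_zero h]
  · rw [← smoothPosPart_eq_zero le_rfl]; exact monotone_smoothPosPart h

theorem smoothPosPart_pos {s : ℝ} (hs : 0 < s) : 0 < smoothPosPart s :=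
  intervalIntegral.intervalIntegral_pos_of_pos_on
    (Real.smoothTransition.continuous.intervalIntegrable 0 s)
    (fun _ ht => Real.smoothTransition.pos_of_pos ht.1) hs

theorem smoothPosPart_sub_le (s t : ℝ) : smoothPosPart s - smoothPosPart t ≤ |s - t| := by
  have := (convex_univ).norm_image_sub_le_of_norm_hasDerivWithin_le (f := smoothPosPart) (C := 1)
    (fun x _ => (hasDerivAt_smoothPosPart x).hasDerivWithinAt) (fun x _ => by
      rw [Real.norm_of_nonneg (Real.smoothTransition.nonneg x)]
      exact Real.smoothTransition.le_one x) (mem_univ t) (mem_univ s)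
  rw [one_mul, Real.norm_eq_abs, Real.norm_eq_abs] at this
  exact (le_abs_self _).trans this

theorem IsTestFunction.integrable_smul {E : Type*} [NormedAddCommGroup E] [NormedSpace ℝ E]
    {ψ : Space d → ℝ} (hψ : IsTestFunction Ω ψ) {h : Space d → E}
    (hh : MemLp h 2 (volume.restrict Ω)) : IntegrableOn (fun x => ψ x • h x) Ω :=
  memLp_one_iff_integrable.1 (hh.smul (hψ.memLp 2))

theorem IsTestFunction.re_integral_mul {ψ : Space d → ℝ} (hψ : IsTestFunction Ω ψ)
    {h : Space d → ℂ} (hh : MemLp h 2 (volume.restrict Ω)) :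
    (∫ x in Ω, (ψ x : ℂ) * h x).re = ∫ x in Ω, ψ x * (h x).re := by
  have := integral_re (𝕜 := ℂ) (hψ.ofReal.memLp 2 |>.integrable_mul hh)
  simp only [Pi.mul_apply, RCLike.re_eq_complex_re, Complex.re_ofReal_mul] at this
  exact this.symm

theorem norm_sq_eq_integral (h : H Ω) : ‖h‖ ^ 2 = ∫ x in Ω, ‖h x‖ ^ 2 := by
  have h1 := inner_self_eq_norm_sq_to_K (𝕜 := ℂ) h
  rw [inner_eq_integral_of_ae_eq (ae_eq_refl _)] at h1
  have h2 : ∀ x, conj (h x) * h x = ((‖h x‖ ^ 2 : ℝ) : ℂ) := fun x => by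
    rw [Complex.conj_mul']; push_cast; rfl
  simp_rw [h2] at h1
  rw [integral_complex_ofReal] at h1
  refine Complex.ofReal_injective ?_
  rw [h1]; push_cast; rfl

theorem IsTestFunction.integrable_smul_continuous {ψ : Space d → ℝ} (hψ : IsTestFunction Ω ψ)
    {g : Space d → ℝ} (hg : Continuous g) : IntegrableOn (fun x => ψ x * g x) Ω :=
  ((hψ.continuous.mul hg).integrable_of_hasCompactSupport
    hψ.hasCompactSupport.mul_right).integrableOn

/-- The part of `Re φ` above `b`, cut off smoothly, is again a test function. -/
theorem IsTestFunction.smoothPosPart_sub (hΩ : IsOpen Ω) {φ : Space d → ℂ}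
    (hφ : IsTestFunction Ω φ) {b : Space d → ℝ} (hb : ContDiff ℝ ∞ b) (hb0 : ∀ x ∈ Ω, 0 ≤ b x) :
    IsTestFunction Ω (Ω.indicator fun x => smoothPosPart ((φ x).re - b x)) := by
  have hsup : tsupport (Ω.indicator fun x => smoothPosPart ((φ x).re - b x)) ⊆ tsupport φ := by
    refine closure_mono fun x hx => ?_
    contrapose! hx
    rw [Function.notMem_support] at hx ⊢
    by_cases h : x ∈ Ω
    · rw [indicator_of_mem h, hx]
      exact smoothPosPart_eq_zero (by simpa using hb0 x h)
    · exact indicator_of_notMem h _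
  refine ⟨contDiff_iff_contDiffAt.2 fun x => ?_, hφ.hasCompactSupport.mono'
    (subset_closure.trans hsup),
    hsup.trans hφ.tsupport_subset⟩
  by_cases hx : x ∈ tsupport (Ω.indicator fun x => smoothPosPart ((φ x).re - b x))
  swap
  · exact contDiffAt_const.congr_of_eventuallyEq (notMem_tsupport_iff_eventuallyEq.1 hx)
  have hxΩ := hφ.tsupport_subset (hsup hx)
  have h1 : ContDiff ℝ ∞ fun x => smoothPosPart ((φ x).re - b x) :=
    contDiff_smoothPosPart.comp ((Complex.reCLM.contDiff.comp hφ.contDiff).sub hb)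
  refine h1.contDiffAt.congr_of_eventuallyEq ?_
  filter_upwards [hΩ.mem_nhds hxΩ] with y hy
  exact indicator_of_mem hy _

theorem pd_smoothPosPart_sub (hΩ : IsOpen Ω) {φ : Space d → ℂ}
    (hφ : IsTestFunction Ω φ) {b : Space d → ℝ} (hb : ContDiff ℝ ∞ b) (i : Fin d) {x : Space d}
    (hx : x ∈ Ω) : pd i (Ω.indicator fun x => smoothPosPart ((φ x).re - b x)) x =
      Real.smoothTransition ((φ x).re - b x) * ((pd i φ x).re - pd i b x) := by
  have h0 : Ω.indicator (fun x => smoothPosPart ((φ x).re - b x)) =ᶠ[𝓝 x]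
      fun x => smoothPosPart ((φ x).re - b x) := by
    filter_upwards [hΩ.mem_nhds hx] with y hy
    exact indicator_of_mem hy _
  have h1 := (Complex.reCLM.hasFDerivAt.comp x (hφ.differentiable x).hasFDerivAt)
  have h2 := h1.sub ((hb.differentiable (by simp)) x).hasFDerivAt
  have h3 := (hasDerivAt_smoothPosPart ((φ x).re - b x)).comp_hasFDerivAt x h2
  rw [pd, h0.fderiv_eq]
  have h4 : fderiv ℝ (fun x => smoothPosPart ((φ x).re - b x)) x = _ := h3.fderiv
  rw [h4]
  rfl

variable {G : H Ω →L[ℂ] V Ω}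

/-- Test both -½Δ(G f) = f and the barrier inequality with k, the smoothed positive part of Re φ -
b. The surplus 1 in F + 1 leaves ∫ k on one side. On the other stands a gradient term that would
have a sign if φ were G f; completing the square bounds the discrepancy by the distance of w to G f
in V. -/
theorem IsDirichletInverse.integral_smoothPosPart_le (hΩ : IsOpen Ω) (hG : IsDirichletInverse G)
    {f : H Ω} {F : ℝ} (hf : ∀ᵐ x ∂volume.restrict Ω, ‖f x‖ ≤ F) {b : Space d → ℝ}
    (hb : ContDiff ℝ ∞ b) (hb0 : ∀ x ∈ Ω, 0 ≤ b x)
    (hbΔ : ∀ x ∈ Ω, F + 1 ≤ -(1 / 2 * Laplacian.laplacian b x))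
    {φ : Space d → ℂ} (hφ : IsTestFunction Ω φ) {w : V Ω} (hw : Represents w φ) :
    ∫ x in Ω, smoothPosPart ((φ x).re - b x) ≤ 1 / 8 * ‖gradV Ω (w - G f)‖ ^ 2 := by
  set k := Ω.indicator fun x => smoothPosPart ((φ x).re - b x) with hk
  have hkt : IsTestFunction Ω k := hφ.smoothPosPart_sub hΩ hb hb0
  have hk0 : ∀ x, 0 ≤ k x := fun x => indicator_nonneg (fun x _ => smoothPosPart_nonneg _) x
  set g : Fin d → Space d → ℝ := fun i x => (gradV Ω (G f) i x).re with hg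
  have hgL : ∀ i, MemLp (g i) 2 (volume.restrict Ω) := fun i => (Lp.memLp (gradV Ω (G f) i)).re
  have hfL : MemLp (fun x => (f x).re) 2 (volume.restrict Ω) := (Lp.memLp f).re
  -- the equation for `G f`
  have e1 : 1 / 2 * ∑ i, ∫ x in Ω, pd i k x * g i x = ∫ x in Ω, k x * (f x).re := by
    have h := congrArg Complex.re (hG.integral_test f hkt.ofReal)
    simp only [hkt.pd_ofReal, Complex.conj_ofReal] at h
    rw [show (1 / 2 : ℂ) = ((1 / 2 : ℝ) : ℂ) by norm_num, Complex.re_ofReal_mul, Complex.re_sum,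
      hkt.re_integral_mul (Lp.memLp f)] at h
    rw [← h]
    exact congrArg _ (Finset.sum_congr rfl fun i _ =>
      ((hkt.partialDeriv i).re_integral_mul (Lp.memLp (gradV Ω (G f) i))).symm)
  -- the inequality for the barrier
  have hpb : ∀ i, ContDiff ℝ 1 (pd i b) := fun i => (contDiff_pd (m := ∞) hb (by simp)).of_le
    (by simp)
  have e2 : ∀ i, ∫ x in Ω, pd i k x * pd i b x = -∫ x in Ω, k x * pd i (pd i b) x := fun i =>
    integral_pd_smul (𝕜 := ℝ) hΩ (hkt.contDiff.of_le (by simp)) hkt.hasCompactSupport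
      hkt.tsupport_subset
      (hpb i).contDiffOn i
  have e3 : ∀ i, Integrable (fun x => pd i k x * pd i b x) (volume.restrict Ω) := fun i =>
    (hkt.partialDeriv i).integrable_smul_continuous (hpb i).continuous
  have e4 : ∀ i, Integrable (fun x => k x * pd i (pd i b) x) (volume.restrict Ω) := fun i =>
    hkt.integrable_smul_continuous (contDiff_pd (m := 0) (hpb i) (by simp)).continuous
  have e5 : Integrable k (volume.restrict Ω) := memLp_one_iff_integrable.1 (hkt.memLp 1)
  have e6 : ∀ i, Integrable (fun x => pd i k x * g i x) (volume.restrict Ω) := fun i =>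
    (hkt.partialDeriv i).integrable_smul (hgL i)
  have e7 : ∫ x in Ω, k x * (f x).re ≤ ∫ x in Ω, k x * F := by
    refine integral_mono_ae (hkt.integrable_smul hfL) (e5.mul_const F) ?_
    filter_upwards [hf] with x hx
    exact mul_le_mul_of_nonneg_left ((Complex.re_le_norm _).trans hx) (hk0 x)
  have e8 : 1 / 2 * ∑ i, ∫ x in Ω, k x * pd i (pd i b) x ≤ -∫ x in Ω, k x * (F + 1) := by
    rw [← integral_finsetSum _ fun i _ => e4 i, ← integral_const_mul, ← integral_neg]
    refine setIntegral_mono_on ((integrable_finsetSum _ fun i _ => e4 i).const_mul _)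
      (e5.mul_const _).neg hΩ.measurableSet fun x hx => ?_
    have := hbΔ x hx
    rw [laplacian_eq_sum_pd (hb.contDiffAt.of_le ENat.LEInfty.out)] at this
    rw [← Finset.mul_sum]
    nlinarith [hk0 x]
  -- Pointwise, with s in [0, 1]: s (p - q) (g - q) ≥ s² (p - q)² - s (p - q) (p - g) ≥ -(p - g)²/4.
  have e9 : ∀ i, -(1 / 4) * ‖gradV Ω (w - G f) i‖ ^ 2 ≤
      ∫ x in Ω, (pd i k x * g i x - pd i k x * pd i b x) := fun i => by
    have h1 : ‖gradV Ω (w - G f) i‖ ^ 2 = ∫ x in Ω, ‖gradV Ω (w - G f) i x‖ ^ 2 :=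
      norm_sq_eq_integral _
    rw [h1, ← integral_const_mul]
    refine integral_mono_ae (((Lp.memLp _).integrable_norm_pow two_ne_zero).const_mul _)
      ((e6 i).sub (e3 i)) ?_
    have h2 : gradV Ω (w - G f) i = gradV Ω w i - gradV Ω (G f) i := by rw [map_sub]; rfl
    rw [h2]
    filter_upwards [Lp.coeFn_sub (gradV Ω w i) (gradV Ω (G f) i), hw.2 i,
      ae_restrict_mem hΩ.measurableSet] with x h3 h4 hx
    rw [h3, Pi.sub_apply, h4]
    have h5 := pd_smoothPosPart_sub hΩ hφ hb i hx
    rw [← hk] at h5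
    set s := Real.smoothTransition ((φ x).re - b x)
    have hs0 : 0 ≤ s := Real.smoothTransition.nonneg _
    have hs1 : s ≤ 1 := Real.smoothTransition.le_one _
    have h6 : ((pd i φ x).re - g i x) ^ 2 ≤ ‖pd i φ x - gradV Ω (G f) i x‖ ^ 2 := by
      rw [← sq_abs]
      gcongr
      exact (Complex.abs_re_le_norm (pd i φ x - gradV Ω (G f) i x))
    rw [h5]
    set p := (pd i φ x).re
    set q := pd i b x
    nlinarith [mul_nonneg (mul_nonneg hs0 (sub_nonneg.2 hs1)) (sq_nonneg (p - q)),
      sq_nonneg (s * (p - q) - (p - g i x) / 2)]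
  have e10 : ‖gradV Ω (w - G f)‖ ^ 2 = ∑ i, ‖gradV Ω (w - G f) i‖ ^ 2 := PiLp.norm_sq_eq_of_L2 _ _
  have e11 := Finset.sum_le_sum fun i (_ : i ∈ Finset.univ) => e9 i
  rw [← Finset.mul_sum, ← e10] at e11
  simp_rw [fun i => integral_sub (e6 i) (e3 i), e2] at e11
  simp only [Finset.sum_sub_distrib, Finset.sum_neg_distrib] at e11
  have e12 : ∫ x in Ω, smoothPosPart ((φ x).re - b x) = ∫ x in Ω, k x :=
    setIntegral_congr_fun hΩ.measurableSet fun x hx => by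
      rw [hk, indicator_of_mem hx]
  rw [integral_mul_const] at e7 e8
  rw [e12]
  linarith

theorem exists_integral_norm_le (hΩb : Bornology.IsBounded Ω) :
    ∃ c : ℝ, ∀ h : H Ω, ∫ x in Ω, ‖h x‖ ≤ c * ‖h‖ := by
  refine ⟨(volume Ω ^ (1 / 2 : ℝ)).toReal, fun h => ?_⟩
  have h1 := eLpNorm_le_eLpNorm_mul_rpow_measure_univ (p := 1) (q := 2) (by norm_num)
    (Lp.memLp h).aestronglyMeasurable
  rw [Measure.restrict_apply_univ, eLpNorm_one_eq_lintegral_enorm, ← Lp.enorm_def] at h1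
  norm_num at h1
  rw [integral_norm_eq_lintegral_enorm (Lp.memLp h).aestronglyMeasurable, mul_comm]
  have h2 : ‖h‖ₑ * volume Ω ^ (1 / 2 : ℝ) ≠ ⊤ :=
    ENNReal.mul_ne_top (by simp) (ENNReal.rpow_ne_top_of_nonneg (by norm_num)
      hΩb.measure_lt_top.ne)
  have h3 := ENNReal.toReal_mono h2 h1
  rwa [ENNReal.toReal_mul, toReal_enorm] at h3

/-- Let the test functions tend to G f in V: the integral of the smoothed positive part of Re G f -
b must be 0. Boundary values enter only through the approximation by compactly supported functions.
-/
theorem IsDirichletInverse.re_le_barrier (hΩ : IsOpen Ω) (hΩb : Bornology.IsBounded Ω)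
    (hG : IsDirichletInverse G)
    {f : H Ω} {F : ℝ} (hf : ∀ᵐ x ∂volume.restrict Ω, ‖f x‖ ≤ F) {b : Space d → ℝ}
    (hb : ContDiff ℝ ∞ b) (hb0 : ∀ x ∈ Ω, 0 ≤ b x)
    (hbΔ : ∀ x ∈ Ω, F + 1 ≤ -(1 / 2 * Laplacian.laplacian b x)) :
    ∀ᵐ x ∂volume.restrict Ω, (embVH Ω (G f) x).re ≤ b x := by
  have : IsFiniteMeasure (volume.restrict Ω) := ⟨by
    rw [Measure.restrict_apply_univ]; exact hΩb.measure_lt_top⟩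
  set u := embVH Ω (G f) with hu
  obtain ⟨w, φ, hlim, hw⟩ := exists_tendsto_represents (G f)
  obtain ⟨c, hc⟩ := exists_integral_norm_le hΩb
  have hbi : IntegrableOn b Ω :=
    (hb.continuous.continuousOn.integrableOn_compact hΩb.isCompact_closure).mono_set subset_closure
  have hi : ∀ h : H Ω, Integrable (fun x => smoothPosPart ((h x).re - b x))
      (volume.restrict Ω) := fun h => by
    have h1 := ((Lp.memLp h).integrable (by norm_num)).re.sub hbi
    refine h1.mono (contDiff_smoothPosPart.continuous.comp_aestronglyMeasurable
      h1.aestronglyMeasurable) (Eventually.of_forall fun x => ?_)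
    have := smoothPosPart_sub_le ((h x).re - b x) 0
    rw [smoothPosPart_eq_zero le_rfl, sub_zero, sub_zero] at this
    rwa [Real.norm_of_nonneg (smoothPosPart_nonneg _)]
  have h1 : ∀ n, ∫ x in Ω, smoothPosPart ((u x).re - b x) ≤
      1 / 8 * ‖gradV Ω (w n - G f)‖ ^ 2 + c * ‖embVH Ω (w n - G f)‖ := fun n => by
    have a1 := hG.integral_smoothPosPart_le hΩ hf hb hb0 hbΔ (hw n).1 (hw n).2
    have a2 : ∫ x in Ω, smoothPosPart ((φ n x).re - b x) =
        ∫ x in Ω, smoothPosPart ((embVH Ω (w n) x).re - b x) :=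
      integral_congr_ae ((hw n).2.1.mono fun x hx => by simp only [hx])
    have a3 := hc (embVH Ω (w n - G f))
    have a4 : ∫ x in Ω, smoothPosPart ((u x).re - b x) ≤ ∫ x in Ω,
        (smoothPosPart ((embVH Ω (w n) x).re - b x) + ‖embVH Ω (w n - G f) x‖) := by
      refine integral_mono_ae (hi u) ((hi _).add
        ((Lp.memLp (embVH Ω (w n - G f))).integrable (by norm_num)).norm) ?_
      rw [map_sub]
      filter_upwards [Lp.coeFn_sub (embVH Ω (w n)) (embVH Ω (G f))] with x hx
      rw [hx, Pi.sub_apply, norm_sub_rev]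
      have a5 := smoothPosPart_sub_le ((u x).re - b x) ((embVH Ω (w n) x).re - b x)
      have a6 := Complex.abs_re_le_norm (u x - embVH Ω (w n) x)
      rw [sub_sub_sub_cancel_right, ← Complex.sub_re] at a5
      linarith
    rw [integral_add (hi _)
      ((Lp.memLp (embVH Ω (w n - G f))).integrable (by norm_num)).norm] at a4
    linarith
  have h2 : ∫ x in Ω, smoothPosPart ((u x).re - b x) ≤ 0 := by
    have a1 : Tendsto (fun n => w n - G f) atTop (𝓝 0) := by
      simpa using hlim.sub_const (G f)
    have a2 := ((gradV Ω).continuous.tendsto 0).comp a1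
    have a3 := ((embVH Ω).continuous.tendsto 0).comp a1
    simp only [map_zero] at a2 a3
    have := ((a2.norm.pow 2).const_mul (1 / 8)).add (a3.norm.const_mul c)
    simp only [norm_zero, ne_eq, OfNat.ofNat_ne_zero, not_false_eq_true, zero_pow, mul_zero,
      add_zero] at this
    exact ge_of_tendsto' this h1
  have h3 := (integral_eq_zero_iff_of_nonneg (fun x => smoothPosPart_nonneg _) (hi u)).1
    (le_antisymm h2 (integral_nonneg fun x => smoothPosPart_nonneg _))
  filter_upwards [h3] with x hx
  by_contra! h
  exact (smoothPosPart_pos (sub_pos.2 h)).ne' hx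

/-- Near a boundary point, the solution with a bounded right-hand side is dominated by a function
that vanishes there. -/
theorem IsDirichletInverse.exists_bound_at_frontier (hd : 0 < d) (hΩ : IsOpen Ω)
    (hΩb : Bornology.IsBounded Ω) (hs : HasSmoothBoundary Ω) (hG : IsDirichletInverse G)
    {f : H Ω} {F : ℝ} (hf : ∀ᵐ x ∂volume.restrict Ω, ‖f x‖ ≤ F) {x₀ : Space d}
    (hx₀ : x₀ ∈ frontier Ω) : ∃ b : Space d → ℝ, Continuous b ∧ b x₀ = 0 ∧
      ∀ᵐ x ∂volume.restrict Ω, ‖embVH Ω (G f) x‖ ≤ b x := by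
  obtain ⟨b, hb, hb0, hbp, hbΔ⟩ := hs.exists_barrier hd hΩ hΩb hx₀ (F := |F| + 1) (by positivity)
  -- Rotating f by ±1 and ±i bounds the real and imaginary parts from both sides by b, hence the
  -- modulus by 2 b.
  have key : ∀ c : ℂ, ‖c‖ = 1 →
      ∀ᵐ x ∂volume.restrict Ω, (c * embVH Ω (G f) x).re ≤ b x := fun c hc => by
    have h1 : ∀ᵐ x ∂volume.restrict Ω, ‖(c • f) x‖ ≤ |F| := by
      filter_upwards [Lp.coeFn_smul c f, hf] with x h2 h3
      rw [h2, Pi.smul_apply, norm_smul, hc, one_mul]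
      exact h3.trans (le_abs_self F)
    have h2 := hG.re_le_barrier hΩ hΩb h1 hb hbp hbΔ
    rw [map_smul, map_smul] at h2
    filter_upwards [h2, Lp.coeFn_smul c (embVH Ω (G f))] with x h3 h4
    rwa [h4] at h3
  refine ⟨fun x => 2 * b x, continuous_const.mul hb.continuous, by simp [hb0], ?_⟩
  filter_upwards [key 1 (by simp), key (-1) (by simp), key Complex.I (by simp),
    key (-Complex.I) (by simp)] with x h1 h2 h3 h4
  simp only [one_mul, neg_mul, Complex.neg_re, Complex.I_mul_re, neg_neg] at h1 h2 h3 h4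
  refine (Complex.norm_le_abs_re_add_abs_im _).trans ?_
  have := abs_le.2 ⟨by linarith, h1⟩
  have := abs_le.2 ⟨by linarith, h4⟩
  linarith

end Comparison

/-! ### The maximum principle -/

section MaximumPrinciple

variable {d : ℕ} {Ω : Set (Space d)}

/-- Were it positive, the second derivative test would make the point a local minimum along the
coordinate line too. The restriction would then be locally constant, with second derivative 0. -/
theorem IsLocalMax.pd_pd_nonpos {v : Space d → ℝ} {x : Space d} (hv : ContDiffAt ℝ 2 v x)
    (hx : IsLocalMax v x) (i : Fin d) : pd i (pd i v) x ≤ 0 := by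
  by_contra! hpos
  set e : Space d := EuclideanSpace.single i (1 : ℝ) with he
  set γ : ℝ → Space d := fun s => x + s • e with hγ
  have hγd : ∀ s, HasDerivAt γ e s := fun s => by
    have := ((hasDerivAt_id s).smul_const e).const_add x
    rwa [one_smul] at this
  have hγ0 : γ 0 = x := by simp [hγ]
  have hγc : Tendsto γ (𝓝 0) (𝓝 x) := by
    have := (hγd 0).continuousAt.tendsto
    rwa [hγ0] at this
  have h1 : ∀ᶠ y in 𝓝 x, DifferentiableAt ℝ v y :=
    (hv.eventually (by simp)).mono fun y hy => hy.differentiableAt (by simp)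
  have h2 : ∀ᶠ s in 𝓝 (0 : ℝ), HasDerivAt (v ∘ γ) (pd i v (γ s)) s := by
    filter_upwards [hγc.eventually h1] with s hs
    exact hs.hasFDerivAt.comp_hasDerivAt s (hγd s)
  have h3 : deriv (v ∘ γ) =ᶠ[𝓝 0] pd i v ∘ γ := h2.mono fun s hs => hs.deriv
  have h4 : HasDerivAt (pd i v ∘ γ) (pd i (pd i v) x) 0 := by
    have h5 : DifferentiableAt ℝ (pd i v) (γ 0) := by
      rw [hγ0]
      exact ((hv.fderiv_right (m := 1) (by norm_num)).clm_apply contDiffAt_const).differentiableAt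
        (by simp)
    have := h5.hasFDerivAt.comp_hasDerivAt (0 : ℝ) (hγd 0)
    rwa [hγ0] at this
  have hmax : IsLocalMax (v ∘ γ) 0 := by
    have := hγc.eventually hx
    filter_upwards [this] with s hs
    simpa [hγ0] using hs
  have hd0 : deriv (v ∘ γ) 0 = 0 := hmax.deriv_eq_zero
  have hd2 : deriv (deriv (v ∘ γ)) 0 = pd i (pd i v) x := by
    rw [h3.deriv_eq, h4.deriv]
  have hmin : IsLocalMin (v ∘ γ) 0 := isLocalMin_of_deriv_deriv_pos (by rw [hd2]; exact hpos) hd0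
    h2.self_of_nhds.continuousAt
  have hconst : v ∘ γ =ᶠ[𝓝 0] fun _ => (v ∘ γ) 0 := by
    filter_upwards [hmax, hmin] with s a b using le_antisymm a b
  have h6 : deriv (v ∘ γ) =ᶠ[𝓝 0] fun _ => 0 := by
    simpa using hconst.deriv
  rw [h6.deriv_eq, deriv_const] at hd2
  exact hpos.ne hd2

/-- Adding ε ‖x‖² makes the Laplacian equal to 2 d ε > 0, which excludes an interior maximum. With ε
R² < v x₁ the maximum cannot lie on the boundary either. -/
theorem le_zero_of_laplacian_eq_zero (hd : 0 < d) (hΩ : IsOpen Ω) (hΩb : Bornology.IsBounded Ω)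
    {v : Space d → ℝ} (hc : ContinuousOn v (closure Ω)) (h0 : ∀ x ∈ frontier Ω, v x = 0)
    (hv : ContDiffOn ℝ 2 v Ω) (hΔ : ∀ x ∈ Ω, Laplacian.laplacian v x = 0) :
    ∀ x ∈ Ω, v x ≤ 0 := by
  intro x₁ hx₁
  by_contra! hpos
  obtain ⟨R, hR⟩ := hΩb.closure.subset_closedBall (0 : Space d)
  have hR' : ∀ x ∈ closure Ω, ‖x‖ ^ 2 ≤ R ^ 2 := fun x hx => by
    have := mem_closedBall_zero_iff.1 (hR hx); gcongr
  set ε := v x₁ / (2 * (R ^ 2 + 1)) with hε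
  have hε0 : 0 < ε := by positivity
  have hεR : ε * R ^ 2 < v x₁ := by
    rw [hε, div_mul_eq_mul_div, div_lt_iff₀ (by positivity)]
    nlinarith [sq_nonneg R]
  have hqd : ContDiff ℝ 2 fun x : Space d => ε * ‖x - 0‖ ^ 2 :=
    contDiff_const.mul ((contDiff_id.sub contDiff_const).norm_sq ℝ)
  obtain ⟨y, hy, hmax⟩ := hΩb.isCompact_closure.exists_isMaxOn
    (f := fun x => v x + ε * ‖x - 0‖ ^ 2) ⟨x₁, subset_closure hx₁⟩
      (hc.add hqd.continuous.continuousOn)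
  have hyΩ : y ∈ Ω := by
    by_contra hn
    have hyf : y ∈ frontier Ω := by rw [frontier, hΩ.interior_eq]; exact ⟨hy, hn⟩
    have h1 := hmax (subset_closure hx₁)
    simp only [mem_ofPred_eq, h0 y hyf, sub_zero] at h1
    have h2 := hR' y hy
    nlinarith [mul_nonneg hε0.le (sq_nonneg ‖x₁‖), mul_le_mul_of_nonneg_left h2 hε0.le]
  have hloc : IsLocalMax (fun x => v x + ε * ‖x - 0‖ ^ 2) y :=
    hmax.isLocalMax (mem_of_superset (hΩ.mem_nhds hyΩ) subset_closure)
  have hvy := hv.contDiffAt (hΩ.mem_nhds hyΩ)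
  have hs : ContDiffAt ℝ 2 (fun x => v x + ε * ‖x - 0‖ ^ 2) y := hvy.add hqd.contDiffAt
  have h1 : Laplacian.laplacian (fun x => v x + ε * ‖x - 0‖ ^ 2) y ≤ 0 := by
    rw [laplacian_eq_sum_pd hs]
    exact Finset.sum_nonpos fun i _ => IsLocalMax.pd_pd_nonpos hs hloc i
  have h2 : Laplacian.laplacian (fun x => v x + ε * ‖x - 0‖ ^ 2) y = Laplacian.laplacian v y +
    Laplacian.laplacian (fun x : Space d => ε * ‖x - 0‖ ^ 2) y := hvy.laplacian_add hqd.contDiffAt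
  rw [h2, hΔ y hyΩ, laplacian_radial (χ := fun s => ε * s)
    (χ' := fun _ => ε) (χ'' := fun _ => 0) (fun s => by simpa using (hasDerivAt_id s).const_mul ε)
    (fun s => hasDerivAt_const s ε) (by fun_prop)] at h1
  have : (0 : ℝ) < d := by exact_mod_cast hd
  have : 0 < 2 * d * ε := by positivity
  linarith

theorem laplacian_re_mul {h : Space d → ℂ} {x : Space d} (hh : ContDiffAt ℝ 2 h x) (c : ℂ) :
    Laplacian.laplacian (fun y => (c * h y).re) x = (c * Laplacian.laplacian h x).re := by
  let l : ℂ →L[ℝ] ℝ := Complex.reCLM.comp (ContinuousLinearMap.mul ℝ ℂ c)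
  exact hh.laplacian_CLM_comp_left (l := l)

theorem eq_zero_of_laplacian_eq_zero (hd : 0 < d) (hΩ : IsOpen Ω) (hΩb : Bornology.IsBounded Ω)
    {h : Space d → ℂ} (hc : ContinuousOn h (closure Ω)) (h0 : ∀ x ∈ frontier Ω, h x = 0)
    (hh : ContDiffOn ℝ 2 h Ω) (hΔ : ∀ x ∈ Ω, Laplacian.laplacian h x = 0) :
    ∀ x ∈ Ω, h x = 0 := by
  have key : ∀ c : ℂ, ∀ x ∈ Ω, (c * h x).re ≤ 0 := fun c => by
    let l : ℂ →L[ℝ] ℝ := Complex.reCLM.comp (ContinuousLinearMap.mul ℝ ℂ c)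
    refine le_zero_of_laplacian_eq_zero hd hΩ hΩb (l.continuous.comp_continuousOn hc)
      (fun x hx => by simp [h0 x hx]) (l.contDiff.comp_contDiffOn hh) fun x hx => ?_
    rw [laplacian_re_mul (hh.contDiffAt (hΩ.mem_nhds hx)), hΔ x hx, mul_zero, Complex.zero_re]
  intro x hx
  have h1 := key (conj (h x)) x hx
  rw [Complex.conj_mul', ← Complex.ofReal_pow, Complex.ofReal_re] at h1
  exact norm_eq_zero.1 (pow_eq_zero_iff two_ne_zero |>.1 (le_antisymm h1 (sq_nonneg _)))

end MaximumPrinciple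

/-! ### Classical solutions of the Dirichlet problem -/

section Classical

variable {d : ℕ} {Ω : Set (Space d)} {G : H Ω →L[ℂ] V Ω}

theorem continuousOn_closure_of_le (hΩ : IsOpen Ω) {φ : Space d → ℂ} (hφ : ContinuousOn φ Ω)
    (h0 : ∀ x ∈ frontier Ω, φ x = 0) (hb : ∀ x₀ ∈ frontier Ω, ∃ b : Space d → ℝ,
      ContinuousWithinAt b (closure Ω) x₀ ∧ b x₀ = 0 ∧ ∀ x ∈ Ω, ‖φ x‖ ≤ b x) :
    ContinuousOn φ (closure Ω) := by
  intro x hx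
  by_cases hxΩ : x ∈ Ω
  · exact (hφ.continuousAt (hΩ.mem_nhds hxΩ)).continuousWithinAt
  have hxf : x ∈ frontier Ω := by rw [frontier, hΩ.interior_eq]; exact ⟨hx, hxΩ⟩
  obtain ⟨b, hbc, hbx, hle⟩ := hb x hxf
  rw [ContinuousWithinAt, h0 x hxf]
  refine squeeze_zero_norm' (a := fun y => |b y|) ?_ ?_
  · filter_upwards [self_mem_nhdsWithin] with y hy
    by_cases hyΩ : y ∈ Ω
    · exact (hle y hyΩ).trans (le_abs_self _)
    · rw [h0 y (by rw [frontier, hΩ.interior_eq]; exact ⟨hy, hyΩ⟩), norm_zero]; exact abs_nonneg _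
  · have := hbc.abs
    rw [ContinuousWithinAt, hbx, abs_zero] at this
    exact this

theorem le_of_ae_le_of_continuousOn (hΩ : IsOpen Ω) {f g : Space d → ℝ} (hf : ContinuousOn f Ω)
    (hg : ContinuousOn g Ω) (h : ∀ᵐ x ∂volume.restrict Ω, f x ≤ g x) : ∀ x ∈ Ω, f x ≤ g x := by
  have h1 : (fun x => max (f x) (g x)) =ᵐ[volume.restrict Ω] g :=
    h.mono fun x hx => max_eq_right hx
  have h2 := Measure.eqOn_open_of_ae_eq h1 hΩ (hf.sup hg) hg
  exact fun x hx => max_eq_right_iff.1 (h2 hx)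

theorem integrable_of_isBounded (hΩb : Bornology.IsBounded Ω) (h : H Ω) : IntegrableOn h Ω := by
  have : IsFiniteMeasure (volume.restrict Ω) := ⟨by
    rw [Measure.restrict_apply_univ]; exact hΩb.measure_lt_top⟩
  exact (Lp.memLp h).integrable (by norm_num)

theorem IsTestFunction.laplacian {ψ : Space d → ℝ} (hψ : IsTestFunction Ω ψ) :
    IsTestFunction Ω (Laplacian.laplacian ψ) := by
  have h : Laplacian.laplacian ψ = fun x => ∑ i, pd i (pd i ψ) x := funext fun x =>
    laplacian_eq_sum_pd (hψ.contDiff.contDiffAt.of_le ENat.LEInfty.out)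
  have hsup : tsupport (Laplacian.laplacian ψ) ⊆ tsupport ψ := by
    rw [h]
    refine closure_minimal (fun x hx => ?_) (isClosed_tsupport ψ)
    by_contra hn
    refine hx (Finset.sum_eq_zero fun i _ => ?_)
    exact pd_eq_zero_of_notMem_tsupport fun h' => hn (tsupport_pd_subset i ψ h')
  refine ⟨?_, hψ.hasCompactSupport.mono' (subset_closure.trans hsup), hsup.trans hψ.tsupport_subset⟩
  rw [h]
  exact ContDiff.sum fun i _ => ((hψ.partialDeriv i).partialDeriv i).contDiff

/-- The solution differs from any function with the same Laplacian by a harmonic function. -/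
theorem IsDirichletInverse.exists_harmonic_sub (hd : 0 < d) (hΩ : IsOpen Ω)
    (hΩb : Bornology.IsBounded Ω) (hG : IsDirichletInverse G) {f : H Ω} {w : Space d → ℂ}
    (hw : ContDiffOn ℝ 2 w Ω) (hwi : IntegrableOn w Ω)
    (hf : f =ᵐ[volume.restrict Ω] fun x => -(1 / 2) * Laplacian.laplacian w x) :
    ∃ g : Space d → ℂ, ContDiffOn ℝ ∞ g Ω ∧ (∀ x ∈ Ω, Laplacian.laplacian g x = 0) ∧
      embVH Ω (G f) =ᵐ[volume.restrict Ω] fun x => w x + g x := by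
  have hi := integrable_of_isBounded hΩb (embVH Ω (G f))
  have hharm : IsWeaklyHarmonic Ω (fun x => embVH Ω (G f) x - w x) := fun ψ h1 h2 h3 => by
    have hψ : IsTestFunction Ω ψ := ⟨h1, h2, h3⟩
    have hΔψ : IsTestFunction Ω (Laplacian.laplacian ψ) := hψ.laplacian
    have e1 : ContDiff ℝ 2 ψ := hψ.contDiff.of_le ENat.LEInfty.out
    have e2 : ∫ x in Ω, ψ x • f x = -(1 / 2) * ∫ x in Ω, ψ x • Laplacian.laplacian w x := by
      rw [← integral_const_mul]
      refine integral_congr_ae (hf.mono fun x hx => ?_)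
      simp only [hx, Complex.real_smul]; ring
    simp_rw [smul_sub]
    rw [integral_sub (hΔψ.integrable_smul (Lp.memLp _)) (integrable_smul_of_tsupport hΩ
      hΔψ.continuous hΔψ.hasCompactSupport hΔψ.tsupport_subset hw.continuousOn).integrableOn,
      hG.integral_laplacian hΩ f hψ, integral_laplacian_smul hΩ e1 h2 h3 hw, e2]
    ring
  obtain ⟨g, hg, hae, hΔ⟩ := hharm.exists_contDiffOn hd hΩ (hi.sub hwi)
  refine ⟨g, hg, hΔ, ?_⟩
  filter_upwards [hae] with x hx
  rw [← hx, Pi.sub_apply]; ring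

/-- `φ` is the classical solution of the Dirichlet problem with right-hand side `f`. -/
def IsClassicalSolution (G : H Ω →L[ℂ] V Ω) (f : H Ω) (φ : Space d → ℂ) : Prop :=
  IsSpaceFactor Ω φ ∧ embVH Ω (G f) =ᵐ[volume.restrict Ω] φ ∧
    f =ᵐ[volume.restrict Ω] fun x => -(1 / 2) * Laplacian.laplacian φ x

/-- With f = -½Δφ the difference g of G f and φ is harmonic by Weyl's lemma. It tends to 0 at the
boundary, because φ does and the barrier dominates G f; the maximum principle gives g = 0. -/
theorem IsDirichletInverse.exists_source (hd : 0 < d) (hΩ : IsOpen Ω)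
    (hΩb : Bornology.IsBounded Ω) (hs : HasSmoothBoundary Ω) (hG : IsDirichletInverse G)
    {φ : Space d → ℂ} (hφ : IsSpaceFactor Ω φ) : ∃ f, IsClassicalSolution G f φ := by
  obtain ⟨h1, h2, h3, F, h4, h5⟩ := id hφ
  have hK := hΩb.isCompact_closure
  obtain ⟨C, hC⟩ := hK.exists_bound_of_continuousOn h4
  have : IsFiniteMeasure (volume.restrict Ω) := ⟨by
    rw [Measure.restrict_apply_univ]; exact hΩb.measure_lt_top⟩
  have hFm : AEStronglyMeasurable F (volume.restrict Ω) :=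
    (h4.mono subset_closure).aestronglyMeasurable hΩ.measurableSet
  have hL : MemLp (fun x => -(1 / 2) * F x) 2 (volume.restrict Ω) := by
    refine (MemLp.of_bound hFm C ?_).const_mul _
    exact (ae_restrict_mem hΩ.measurableSet).mono fun x hx => hC x (subset_closure hx)
  set f : H Ω := hL.toLp _ with hfdef
  have hf : f =ᵐ[volume.restrict Ω] fun x => -(1 / 2) * F x := hL.coeFn_toLp
  have hf' : f =ᵐ[volume.restrict Ω] fun x => -(1 / 2) * Laplacian.laplacian φ x := by
    filter_upwards [hf, ae_restrict_mem hΩ.measurableSet] with x hx hxΩ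
    rw [hx, h5 x hxΩ]
  have hfb : ∀ᵐ x ∂volume.restrict Ω, ‖f x‖ ≤ C := by
    filter_upwards [hf, ae_restrict_mem hΩ.measurableSet] with x hx hxΩ
    have := hC x (subset_closure hxΩ)
    rw [hx, norm_mul]; norm_num
    linarith [norm_nonneg (F x)]
  obtain ⟨g, hg, hgΔ, hgae⟩ := hG.exists_harmonic_sub hd hΩ hΩb h1
    ((h2.integrableOn_compact hK).mono_set subset_closure) hf'
  -- Weyl's lemma determines g only inside Ω; the indicator prescribes the value 0 on the boundary.
  have hg0 : ∀ x ∈ Ω, Ω.indicator g x = 0 := by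
    have hEq : ∀ x ∈ Ω, Ω.indicator g =ᶠ[𝓝 x] g := fun x hx => by
      filter_upwards [hΩ.mem_nhds hx] with y hy using indicator_of_mem hy g
    have hfr : ∀ x ∈ frontier Ω, Ω.indicator g x = 0 := fun x hx => by
      rw [frontier, hΩ.interior_eq] at hx
      exact indicator_of_notMem hx.2 g
    have hcd : ContDiffOn ℝ 2 (Ω.indicator g) Ω :=
      (hg.of_le ENat.LEInfty.out).congr fun x hx => indicator_of_mem hx g
    refine eq_zero_of_laplacian_eq_zero hd hΩ hΩb (continuousOn_closure_of_le hΩ hcd.continuousOn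
      hfr fun x₀ hx₀ => ?_) hfr hcd fun x hx => ?_
    · obtain ⟨b, hb, hb0, hle⟩ := hG.exists_bound_at_frontier hd hΩ hΩb hs hfb hx₀
      refine ⟨fun x => b x + ‖φ x‖, hb.continuousWithinAt.add
        (h2 x₀ (frontier_subset_closure hx₀)).norm, by simp [hb0, h3 x₀ hx₀], ?_⟩
      refine le_of_ae_le_of_continuousOn hΩ hcd.continuousOn.norm (hb.continuousOn.add
        (h2.mono subset_closure).norm) ?_
      filter_upwards [hle, hgae, ae_restrict_mem hΩ.measurableSet] with x a1 a2 hx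
      rw [indicator_of_mem hx, show g x = embVH Ω (G f) x - φ x by rw [a2]; ring]
      exact (norm_sub_le _ _).trans (by gcongr)
    · rw [(InnerProductSpace.laplacian_congr_nhds (hEq x hx)).eq_of_nhds]
      exact hgΔ x hx
  refine ⟨f, hφ, ?_, hf'⟩
  filter_upwards [hgae, ae_restrict_mem hΩ.measurableSet] with x hx hxΩ
  have := hg0 x hxΩ
  rw [indicator_of_mem hxΩ] at this
  rw [hx, this, add_zero]

/-- For a source -½Δw with w smooth on the whole space, G f is w plus a harmonic function, hence
smooth inside Ω; barriers provide the boundary values. -/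
theorem IsDirichletInverse.exists_classicalSolution (hd : 0 < d) (hΩ : IsOpen Ω)
    (hΩb : Bornology.IsBounded Ω) (hs : HasSmoothBoundary Ω) (hG : IsDirichletInverse G)
    {w : Space d → ℂ} (hw : ContDiff ℝ ∞ w) {f : H Ω}
    (hf : f =ᵐ[volume.restrict Ω] fun x => -(1 / 2) * Laplacian.laplacian w x) :
    ∃ φ, IsClassicalSolution G f φ := by
  have hw2 : ContDiff ℝ 2 w := hw.of_le ENat.LEInfty.out
  have hK := hΩb.isCompact_closure
  have hΔc : Continuous (Laplacian.laplacian w) := by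
    rw [show Laplacian.laplacian w = fun x => ∑ i, pd i (pd i w) x from funext fun x =>
      laplacian_eq_sum_pd hw2.contDiffAt]
    exact continuous_finsetSum _ fun i _ => (contDiff_pd (m := 0)
      (contDiff_pd (m := 1) hw2 (by norm_num)) (by simp)).continuous
  obtain ⟨C, hC⟩ := hK.exists_bound_of_continuousOn hΔc.continuousOn
  have hfb : ∀ᵐ x ∂volume.restrict Ω, ‖f x‖ ≤ C := by
    filter_upwards [hf, ae_restrict_mem hΩ.measurableSet] with x hx hxΩ
    have := hC x (subset_closure hxΩ)
    rw [hx, norm_mul]; norm_num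
    linarith [norm_nonneg (Laplacian.laplacian w x)]
  obtain ⟨g, hg, hgΔ, hgae⟩ := hG.exists_harmonic_sub hd hΩ hΩb hw2.contDiffOn
    ((hw.continuous.continuousOn.integrableOn_compact hK).mono_set subset_closure) hf
  set φ := Ω.indicator fun x => w x + g x with hφ
  have hEq : ∀ x ∈ Ω, φ =ᶠ[𝓝 x] fun x => w x + g x := fun x hx => by
    filter_upwards [hΩ.mem_nhds hx] with y hy using indicator_of_mem hy _
  have hfr : ∀ x ∈ frontier Ω, φ x = 0 := fun x hx => by
    rw [frontier, hΩ.interior_eq] at hx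
    exact indicator_of_notMem hx.2 _
  have hg2 : ContDiffOn ℝ 2 g Ω := hg.of_le ENat.LEInfty.out
  have hcd : ContDiffOn ℝ 2 φ Ω :=
    (hw2.contDiffOn.add hg2).congr fun x hx => indicator_of_mem hx _
  have hΔ : ∀ x ∈ Ω, Laplacian.laplacian φ x = Laplacian.laplacian w x := fun x hx => by
    rw [(InnerProductSpace.laplacian_congr_nhds (hEq x hx)).eq_of_nhds]
    have h1 : Laplacian.laplacian (fun x => w x + g x) x = Laplacian.laplacian w x +
      Laplacian.laplacian g x := hw2.contDiffAt.laplacian_add (hg2.contDiffAt (hΩ.mem_nhds hx))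
    rw [h1, hgΔ x hx, add_zero]
  have hae : embVH Ω (G f) =ᵐ[volume.restrict Ω] φ := by
    filter_upwards [hgae, ae_restrict_mem hΩ.measurableSet] with x hx hxΩ
    rw [hx, hφ, indicator_of_mem hxΩ]
  refine ⟨φ, ⟨hcd, continuousOn_closure_of_le hΩ hcd.continuousOn hfr fun x₀ hx₀ => ?_, hfr,
    _, hΔc.continuousOn, hΔ⟩, hae, ?_⟩
  · obtain ⟨b, hb, hb0, hle⟩ := hG.exists_bound_at_frontier hd hΩ hΩb hs hfb hx₀
    refine ⟨b, hb.continuousWithinAt, hb0, le_of_ae_le_of_continuousOn hΩ hcd.continuousOn.norm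
      hb.continuousOn ?_⟩
    filter_upwards [hle, hae] with x a1 a2
    rwa [← a2]
  · filter_upwards [hf, ae_restrict_mem hΩ.measurableSet] with x hx hxΩ
    rw [hx, hΔ x hxΩ]

end Classical

/-! ### Density of the right-hand sides of classical solutions -/

section Density

open scoped FourierTransform RealInnerProductSpace

variable {d : ℕ} {Ω : Set (Space d)} {G : H Ω →L[ℂ] V Ω}

/-- The plane wave `x ↦ e^{i k · x}`. -/
def planeWave (k x : Space d) : ℂ := Complex.exp (Complex.I * (⟪k, x⟫ : ℝ))

theorem contDiff_planeWave (k : Space d) : ContDiff ℝ ∞ (planeWave k) :=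
  (contDiff_const.mul (Complex.ofRealCLM.contDiff.comp (contDiff_const.inner ℝ contDiff_id))).cexp

theorem norm_planeWave (k x : Space d) : ‖planeWave k x‖ = 1 := by
  rw [planeWave, mul_comm]; exact Complex.norm_exp_ofReal_mul_I _

theorem hasFDerivAt_planeWave (k x : Space d) :
    HasFDerivAt (planeWave k) ((innerSL ℝ k).smulRight (Complex.I * planeWave k x)) x := by
  have h1 : HasFDerivAt (fun y : Space d => Complex.I * ((⟪k, y⟫ : ℝ) : ℂ))
      (Complex.I • Complex.ofRealCLM.comp (innerSL ℝ k)) x :=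
    (Complex.ofRealCLM.hasFDerivAt.comp x (innerSL ℝ k).hasFDerivAt).const_mul Complex.I
  refine h1.cexp.congr_fderiv ?_
  ext y
  simp [planeWave]
  ring

theorem pd_planeWave (k : Space d) (i : Fin d) :
    pd i (planeWave k) = fun x => (Complex.I * k i) * planeWave k x := by
  ext x
  rw [pd, (hasFDerivAt_planeWave k x).fderiv]
  simp [EuclideanSpace.inner_single_right]
  ring

theorem laplacian_planeWave (k x : Space d) :
    Laplacian.laplacian (planeWave k) x = -(‖k‖ ^ 2 : ℝ) * planeWave k x := by
  have h1 : ContDiff ℝ 2 (planeWave k) := (contDiff_planeWave k).of_le ENat.LEInfty.out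
  have h2 : ∀ i, pd i (pd i (planeWave k)) x = -((k i ^ 2 : ℝ) : ℂ) * planeWave k x := fun i => by
    rw [pd_planeWave, pd, fderiv_const_mul (hasFDerivAt_planeWave k x).differentiableAt]
    change (Complex.I * k i) * pd i (planeWave k) x = _
    rw [pd_planeWave]
    push_cast
    linear_combination (k i : ℂ) ^ 2 * planeWave k x * Complex.I_sq
  rw [laplacian_eq_sum_pd h1.contDiffAt, Finset.sum_congr rfl fun i _ => h2 i, ← Finset.sum_mul,
    Finset.sum_neg_distrib, ← Complex.ofReal_sum, EuclideanSpace.norm_sq_eq]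
  simp

theorem fourier_indicator (hΩ : IsOpen Ω) (h : Space d → ℂ) (w : Space d) :
    𝓕 (Ω.indicator h) w = ∫ x in Ω, conj (planeWave ((2 * Real.pi) • w) x) * h x := by
  rw [Real.fourier_eq', ← integral_indicator hΩ.measurableSet]
  congr 1; ext x
  by_cases hx : x ∈ Ω
  · rw [indicator_of_mem hx, indicator_of_mem hx, planeWave, ← Complex.exp_conj, smul_eq_mul,
      inner_smul_left, real_inner_comm]
    congr 2
    have : conj (2 : ℂ) = 2 := map_ofNat _ 2
    simp [this]
    ring
  · rw [indicator_of_notMem hx, indicator_of_notMem hx, smul_zero]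

theorem integral_smul_fourier {f g : Space d → ℂ} (hf : Integrable f) (hg : Integrable g) :
    ∫ w, 𝓕 f w • g w = ∫ x, f x • 𝓕 g x := by
  have := VectorFourier.integral_fourierIntegral_smul_eq_flip (μ := (volume : Measure (Space d)))
    (ν := (volume : Measure (Space d))) (e := Real.fourierChar) (L := innerₗ (Space d))
    Real.continuous_fourierChar continuous_inner hf hg
  rw [show (innerₗ (Space d)).flip = innerₗ (Space d) from flip_innerₗ _] at this
  exact this

/-- Every test function is the Fourier transform of a Schwartz function, so the transform can be
moved onto h. The excluded frequency 0 is a null set. -/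
theorem eq_zero_of_fourier_eq_zero (hd : 0 < d) (hΩ : IsOpen Ω) (hΩb : Bornology.IsBounded Ω)
    {h : H Ω} (hh : ∀ w : Space d, w ≠ 0 → 𝓕 (Ω.indicator h) w = 0) : h = 0 := by
  refine eq_zero_of_integral_test_smul hΩ fun ψ hψ => ?_
  have : Nonempty (Fin d) := ⟨⟨0, hd⟩⟩
  set S : SchwartzMap (Space d) ℂ := hψ.ofReal.hasCompactSupport.toSchwartzMap hψ.ofReal.contDiff
    with hS
  set R : SchwartzMap (Space d) ℂ := 𝓕⁻ S with hR
  have h1 : ∀ x, 𝓕 (R : Space d → ℂ) x = (ψ x : ℂ) := fun x => by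
    have h0 : (𝓕 R : SchwartzMap (Space d) ℂ) = S := FourierTransform.fourier_fourierInv_eq S
    have := congrArg (fun T : SchwartzMap (Space d) ℂ => T x) h0
    exact this
  have h2 : ∫ x in Ω, ψ x • h x = ∫ x, 𝓕 (R : Space d → ℂ) x • Ω.indicator h x := by
    rw [← integral_indicator hΩ.measurableSet]
    congr 1; ext x
    rw [h1]
    by_cases hx : x ∈ Ω
    · simp [indicator_of_mem hx]
    · simp [indicator_of_notMem hx]
  rw [h2, integral_smul_fourier R.integrable
    ((integrable_indicator_iff hΩ.measurableSet).2 (integrable_of_isBounded hΩb h))]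
  refine integral_eq_zero_of_ae ?_
  filter_upwards [compl_mem_ae_iff.2 (measure_singleton (0 : Space d))] with w hw
  rw [hh w hw, smul_zero]; rfl

/-- For k ≠ 0 the plane wave equals -½Δ applied to 2/‖k‖² times itself, so it is a source. A vector
orthogonal to all sources has a Fourier transform that vanishes off the origin. -/
theorem IsDirichletInverse.dense_span_source (hd : 0 < d) (hΩ : IsOpen Ω)
    (hΩb : Bornology.IsBounded Ω) (hs : HasSmoothBoundary Ω) (hG : IsDirichletInverse G) :
    Dense (Submodule.span ℂ {f : H Ω | ∃ φ, IsClassicalSolution G f φ} : Set (H Ω)) := by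
  rw [Submodule.dense_iff_topologicalClosure_eq_top, Submodule.topologicalClosure_eq_top_iff,
    Submodule.eq_bot_iff]
  intro h hh
  refine eq_zero_of_fourier_eq_zero hd hΩ hΩb fun w hw => ?_
  have : IsFiniteMeasure (volume.restrict Ω) := ⟨by
    rw [Measure.restrict_apply_univ]; exact hΩb.measure_lt_top⟩
  rw [fourier_indicator hΩ]
  set k := (2 * Real.pi) • w
  have hk : k ≠ 0 := smul_ne_zero (by positivity) hw
  have hk' : (‖k‖ : ℂ) ≠ 0 := by exact_mod_cast norm_ne_zero_iff.2 hk
  have hL : MemLp (planeWave k) 2 (volume.restrict Ω) :=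
    MemLp.of_bound (contDiff_planeWave k).continuous.aestronglyMeasurable 1
      (Eventually.of_forall fun x => (norm_planeWave k x).le)
  have hw2 : ContDiff ℝ 2 (planeWave k) := (contDiff_planeWave k).of_le ENat.LEInfty.out
  obtain ⟨φ, hφ⟩ := hG.exists_classicalSolution hd hΩ hΩb hs (f := hL.toLp _)
    (w := (2 / ‖k‖ ^ 2 : ℂ) • planeWave k) (contDiff_const.smul (contDiff_planeWave k)) (by
      filter_upwards [hL.coeFn_toLp] with x hx
      rw [hx, InnerProductSpace.laplacian_smul _ hw2.contDiffAt, laplacian_planeWave, smul_eq_mul]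
      push_cast
      field_simp)
  have hmem : hL.toLp _ ∈ Submodule.span ℂ {f : H Ω | ∃ φ, IsClassicalSolution G f φ} :=
    Submodule.subset_span ⟨φ, hφ⟩
  have := Submodule.inner_right_of_mem_orthogonal hmem hh
  rwa [inner_eq_integral_of_ae_eq hL.coeFn_toLp] at this

end Density

/-! ### The potential as a family of operators -/

section Potential

variable {d : ℕ} {Ω : Set (Space d)} {T : ℝ} {𝒱 : ℝ → Space d → ℝ}

/-- `A t` is multiplication by `𝒱 t`, for `t ∈ (0, T)`. -/
def IsMultiplication (T : ℝ) (𝒱 : ℝ → Space d → ℝ) (A : ℝ → H Ω →L[ℂ] H Ω) : Prop :=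
  ∀ t ∈ Ioo 0 T, ∀ φ : H Ω, A t φ =ᵐ[volume.restrict Ω] fun x => (𝒱 t x : ℂ) * φ x

theorem PotentialAssumption.exists_operator (h : PotentialAssumption T Ω 𝒱) :
    ∃ (A : ℝ → H Ω →L[ℂ] H Ω) (M : ℝ), IsMultiplication T 𝒱 A ∧ ∀ t ∈ Ioo 0 T, ‖A t‖ ≤ M := by
  obtain ⟨C, hC⟩ := h.bounded
  have key : ∀ t ∈ Ioo 0 T, ∃ A : H Ω →L[ℂ] H Ω,
      (∀ φ : H Ω, A φ =ᵐ[volume.restrict Ω] fun x => (𝒱 t x : ℂ) * φ x) ∧ ‖A‖ ≤ |C| := by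
    intro t ht
    have hL : ∀ φ : H Ω, MemLp (fun x => (𝒱 t x : ℂ) * φ x) 2 (volume.restrict Ω) := fun φ =>
      ⟨(Complex.continuous_ofReal.comp_aestronglyMeasurable
        (h.aestronglyMeasurable_slice t ht)).mul (Lp.aestronglyMeasurable φ),
        (hC t ht φ).trans_lt ENNReal.ofReal_lt_top⟩
    let L : H Ω →ₗ[ℂ] H Ω :=
      { toFun := fun φ => (hL φ).toLp _
        map_add' := fun φ ψ => by
          refine Lp.ext ?_
          filter_upwards [(hL (φ + ψ)).coeFn_toLp, Lp.coeFn_add ((hL φ).toLp _) ((hL ψ).toLp _),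
            (hL φ).coeFn_toLp, (hL ψ).coeFn_toLp, Lp.coeFn_add φ ψ] with x h1 h2 h3 h4 h5
          rw [h1, h2, Pi.add_apply, h3, h4, h5, Pi.add_apply, mul_add]
        map_smul' := fun c φ => by
          refine Lp.ext ?_
          filter_upwards [(hL (c • φ)).coeFn_toLp, Lp.coeFn_smul c ((hL φ).toLp _),
            (hL φ).coeFn_toLp, Lp.coeFn_smul c φ] with x h1 h2 h3 h4
          rw [h1, RingHom.id_apply, h2, Pi.smul_apply, h3, h4, Pi.smul_apply, smul_eq_mul,
            smul_eq_mul, mul_left_comm] }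
    have hLb : ∀ φ, ‖L φ‖ ≤ |C| * ‖φ‖ := fun φ => by
      change ‖(hL φ).toLp _‖ ≤ _
      rw [Lp.norm_toLp]
      refine ENNReal.toReal_le_of_le_ofReal (by positivity) ((hC t ht φ).trans ?_)
      gcongr
      exact le_abs_self C
    exact ⟨L.mkContinuous |C| hLb, fun φ => (hL φ).coeFn_toLp,
      L.mkContinuous_norm_le (abs_nonneg C) hLb⟩
  choose A hA hM using key
  refine ⟨fun t => if ht : t ∈ Ioo 0 T then A t ht else 0, |C|, fun t ht φ => ?_, fun t ht => ?_⟩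
  · simp only [dif_pos ht]; exact hA t ht φ
  · simp only [dif_pos ht]; exact hM t ht

theorem IsMultiplication.isLipschitzPotential {A : ℝ → H Ω →L[ℂ] H Ω}
    (hA : IsMultiplication T 𝒱 A) (h : PotentialAssumption T Ω 𝒱) {M : ℝ}
    (hM : ∀ t ∈ Ioo 0 T, ‖A t‖ ≤ M) : ∃ C, IsLipschitzPotential T A C M := by
  obtain ⟨C, hC⟩ := h.differentiable
  have hform : ∀ t ∈ Ioo 0 T, ∀ φ ψ : H Ω,
      ∫ x in Ω, (𝒱 t x : ℂ) * φ x * conj (ψ x) = inner ℂ ψ (A t φ) := fun t ht φ ψ => by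
    rw [inner_eq_integral_of_ae_eq (ae_eq_refl _)]
    refine integral_congr_ae ?_
    filter_upwards [hA t ht φ] with x hx
    rw [hx, mul_comm]
  refine ⟨|C|, fun s hs t ht => ?_, fun t ht φ ψ => ?_, hM⟩
  · refine ContinuousLinearMap.opNorm_le_bound _ (by positivity) fun φ => ?_
    -- Pairing with the increment itself turns the bound on the derivatives of the forms into an
    -- operator norm bound, by the mean value inequality.
    set y := (A s - A t) φ with hy
    choose! D hD using fun t (ht : t ∈ Ioo 0 T) => hC t ht φ y
    have h1 := (convex_Ioo (0 : ℝ) T).norm_image_sub_le_of_norm_hasDerivWithin_le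
      (C := |C| * ‖φ‖ * ‖y‖) (fun r hr => (hD r hr).1.hasDerivWithinAt) (fun r hr =>
        (hD r hr).2.trans (by gcongr; exact le_abs_self C)) ht hs
    rw [hform s hs, hform t ht, ← inner_sub_right, ← sub_apply, ← hy,
      inner_self_eq_norm_sq_to_K] at h1
    have h2 : ‖y‖ ^ 2 ≤ |C| * ‖φ‖ * ‖y‖ * |s - t| := by simpa using h1
    rcases eq_or_ne ‖y‖ 0 with h0 | h0
    · rw [h0]; positivity
    · have := (norm_nonneg y).lt_of_ne' h0
      refine le_of_mul_le_mul_right ?_ this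
      linarith
  · rw [inner_eq_integral_of_ae_eq (hA t ht φ), inner_eq_integral_of_ae_eq (ae_eq_refl φ)]
    refine integral_congr_ae ?_
    filter_upwards [hA t ht ψ] with x hx
    rw [hx, map_mul, Complex.conj_ofReal]
    ring

end Potential

/-! ### Ultra-weak solutions -/

section UltraWeak

variable {d : ℕ} {Ω : Set (Space d)} {T C M : ℝ} {𝒱 : ℝ → Space d → ℝ}
  {G : H Ω →L[ℂ] V Ω} {A : ℝ → H Ω →L[ℂ] H Ω} {u₀ : H Ω} {u : U T Ω}

/-- `S^* (θ φ)`, where `φ = J G x`. -/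
def testCurve (G : H Ω →L[ℂ] V Ω) (A : ℝ → H Ω →L[ℂ] H Ω) (θ : ℝ → ℂ) (x : H Ω) (t : ℝ) : H Ω :=
  (Complex.I * deriv θ t) • embVH Ω (G x) - θ t • x - θ t • A t (embVH Ω (G x))

theorem adjointSchrodinger_mul (hΩ : IsOpen Ω) {θ : ℝ → ℂ} {φ : Space d → ℂ}
    (hφ : ContDiffOn ℝ 2 φ Ω) (t : ℝ) {x : Space d} (hx : x ∈ Ω) :
    adjointSchrodinger 𝒱 (fun t x => θ t * φ x) t x =
      Complex.I * deriv θ t * φ x + θ t * (1 / 2 * Laplacian.laplacian φ x)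
        - θ t * (𝒱 t x * φ x) := by
  have h1 : Laplacian.laplacian (fun y => θ t * φ y) x = θ t * Laplacian.laplacian φ x :=
    InnerProductSpace.laplacian_smul (θ t) (hφ.contDiffAt (hΩ.mem_nhds hx))
  rw [adjointSchrodinger, h1, deriv_mul_const_field]
  ring

theorem testCurve_ae_eq (hΩ : IsOpen Ω) (hA : IsMultiplication T 𝒱 A) {θ : ℝ → ℂ} {x : H Ω}
    {φ : Space d → ℂ} (hφ : IsClassicalSolution G x φ) {t : ℝ} (ht : t ∈ Ioo 0 T) :
    testCurve G A θ x t =ᵐ[volume.restrict Ω]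
      adjointSchrodinger 𝒱 (fun t x => θ t * φ x) t := by
  set y := embVH Ω (G x) with hy
  filter_upwards [Lp.coeFn_sub ((Complex.I * deriv θ t) • y - θ t • x) (θ t • A t y),
    Lp.coeFn_sub ((Complex.I * deriv θ t) • y) (θ t • x),
    Lp.coeFn_smul (Complex.I * deriv θ t) y, Lp.coeFn_smul (θ t) x, Lp.coeFn_smul (θ t) (A t y),
    hA t ht y, hφ.2.1, hφ.2.2, ae_restrict_mem hΩ.measurableSet] with z h1 h2 h3 h4 h5 h6 h7 h8 hz
  rw [adjointSchrodinger_mul hΩ hφ.1.1 t hz, testCurve, ← hy, h1, Pi.sub_apply, h2, Pi.sub_apply,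
    h3, h4, h5, Pi.smul_apply, Pi.smul_apply, Pi.smul_apply, h6, h8, h7]
  simp only [smul_eq_mul]
  ring

theorem exists_triple (hT : 0 < T) (hΩ : IsOpen Ω) (hA : IsMultiplication T 𝒱 A)
    (hL : IsLipschitzPotential T A C M) {θ : ℝ → ℂ} (hθ : IsTimeFactor T θ) {x : H Ω}
    {φ : Space d → ℂ} (hφ : IsClassicalSolution G x φ) :
    ∃ p : U T Ω × U T Ω × H Ω,
      (∀ᵐ t ∂timeMeasure T, p.1 t =ᵐ[volume.restrict Ω] fun x => θ t * φ x) ∧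
      (∀ᵐ t ∂timeMeasure T, p.2.1 t =ᵐ[volume.restrict Ω]
        adjointSchrodinger 𝒱 (fun t x => θ t * φ x) t) ∧
      p.2.2 =ᵐ[volume.restrict Ω] (fun x => θ 0 * φ x) ∧
      (∀ᵐ t ∂timeMeasure T, p.2.1 t = testCurve G A θ x t) ∧ p.2.2 = θ 0 • embVH Ω (G x) := by
  set y := embVH Ω (G x) with hy
  have h1 : MemLp (fun t => θ t • y) 2 (timeMeasure T) :=
    MemLp.smul (p := ⊤) (q := 2) (f := fun _ => y) (memLp_const _) hθ.memLp
  have h2 : MemLp (testCurve G A θ x) 2 (timeMeasure T) := hθ.memLp_test hT hL y x y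
  refine ⟨⟨h1.toLp _, h2.toLp _, θ 0 • y⟩, ?_, ?_, ?_, h2.coeFn_toLp, rfl⟩
  · filter_upwards [h1.coeFn_toLp] with t ht
    rw [ht]
    filter_upwards [Lp.coeFn_smul (θ t) y, hφ.2.1] with z h3 h4
    rw [h3, Pi.smul_apply, h4, smul_eq_mul]
  · filter_upwards [h2.coeFn_toLp, ae_restrict_mem measurableSet_Ioo] with t ht htI
    rw [ht]
    exact testCurve_ae_eq hΩ hA hφ htI
  · filter_upwards [Lp.coeFn_smul (θ 0) y, hφ.2.1] with z h3 h4
    rw [h3, Pi.smul_apply, h4, smul_eq_mul]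

theorem inner_eq_integral_testCurve {θ : ℝ → ℂ} {x : H Ω} {q : U T Ω}
    (hq : ∀ᵐ t ∂timeMeasure T, q t = testCurve G A θ x t) (u : U T Ω) :
    inner ℂ q u = ∫ t in Ioo 0 T, inner ℂ (testCurve G A θ x t) (u t) := by
  rw [L2.inner_def]
  exact integral_congr_ae (hq.mono fun t ht => by simp only [ht])

/-- Shows that the left-hand side of the weak form depends continuously on x, so that it may be
tested on a dense set. -/
theorem exists_integral_testCurve_eq_inner (hT : 0 < T) (hL : IsLipschitzPotential T A C M)
    {θ : ℝ → ℂ} (hθ : IsTimeFactor T θ) (u : U T Ω) : ∃ z : H Ω, ∀ x : H Ω,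
      ∫ t in Ioo 0 T, inner ℂ (testCurve G A θ x t) (u t) = inner ℂ x z := by
  have hu := Lp.memLp u
  have hc : ∀ {f : ℝ → ℂ}, MemLp f ⊤ (timeMeasure T) →
      MemLp (fun t => conj (f t)) ⊤ (timeMeasure T) := fun hf => hf.star
  set a : ℝ → H Ω := fun t => conj (Complex.I * deriv θ t) • u t - conj (θ t) • A t (u t) with ha
  set b : ℝ → H Ω := fun t => conj (θ t) • u t with hb
  have haL : MemLp a 2 (timeMeasure T) :=
    (MemLp.smul (p := ⊤) (q := 2) hu (hc ((hθ.memLp_deriv hT).const_mul Complex.I))).sub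
      (MemLp.smul (p := ⊤) (q := 2) (hL.memLp hu) (hc hθ.memLp))
  have hbL : MemLp b 2 (timeMeasure T) := MemLp.smul (p := ⊤) (q := 2) hu (hc hθ.memLp)
  have hai := haL.integrable (by norm_num)
  have hbi := hbL.integrable (by norm_num)
  refine ⟨ContinuousLinearMap.adjoint ((embVH Ω).comp G) (∫ t in Ioo 0 T, a t)
    - ∫ t in Ioo 0 T, b t, fun x => ?_⟩
  rw [inner_sub_right, ContinuousLinearMap.adjoint_inner_right, ← integral_inner hai,
    ← integral_inner hbi, ← integral_sub (hai.const_inner _) (hbi.const_inner _)]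
  refine setIntegral_congr_fun measurableSet_Ioo fun t ht => ?_
  simp only [testCurve, ha, hb, ContinuousLinearMap.comp_apply, inner_sub_left, inner_sub_right,
    inner_smul_left, inner_smul_right, hL.symm t ht]
  ring

/-- For a source x of a classical solution φ, the weak form is the ultra-weak one tested with θ φ.
Both sides are continuous and antilinear in x, and the sources span a dense subspace. -/
theorem IsUltraWeakSolution.isWeakSolution (hT : 0 < T) (hΩ : IsOpen Ω)
    (hA : IsMultiplication T 𝒱 A) (hL : IsLipschitzPotential T A C M)
    (hdense : Dense (Submodule.span ℂ {f : H Ω | ∃ φ, IsClassicalSolution G f φ} : Set (H Ω)))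
    (hu : IsUltraWeakSolution 𝒱 u₀ u) :
    IsWeakSolution T ((embVH Ω).comp G) A u₀ u := by
  intro θ hθ x
  obtain ⟨z, hz⟩ := exists_integral_testCurve_eq_inner (G := G) hT hL hθ u
  have hz0 : z = (Complex.I * conj (θ 0)) • ContinuousLinearMap.adjoint ((embVH Ω).comp G) u₀ := by
    rw [← sub_eq_zero]
    suffices key : ∀ f ∈ Submodule.span ℂ {f : H Ω | ∃ φ, IsClassicalSolution G f φ},
        inner ℂ f (z - (Complex.I * conj (θ 0)) •
          ContinuousLinearMap.adjoint ((embVH Ω).comp G) u₀) = 0 from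
      hdense.eq_zero_of_inner_right ℂ key
    intro f hf
    induction hf using Submodule.span_induction with
    | mem f hf =>
      obtain ⟨φ, hφ⟩ := hf
      obtain ⟨p, h1, h2, h3, h4, h5⟩ := exists_triple hT hΩ hA hL hθ hφ
      have hp : p ∈ testSpace T Ω 𝒱 := subset_closure
        ⟨_, Submodule.subset_span ⟨θ, φ, hθ, hφ.1, rfl⟩, h1, h2, h3⟩
      have := hu p hp
      rw [inner_eq_integral_testCurve h4, hz, h5, inner_smul_left] at this
      rw [inner_sub_right, this, inner_smul_right, ContinuousLinearMap.adjoint_inner_right,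
        ContinuousLinearMap.comp_apply]
      ring
    | zero => exact inner_zero_left _
    | add f g _ _ h1 h2 => rw [inner_add_left, h1, h2, add_zero]
    | smul c f _ h1 => rw [inner_smul_left, h1, mul_zero]
  change ∫ t in Ioo 0 T, inner ℂ (testCurve G A θ x t) (u t) = _
  rw [hz, hz0, inner_smul_right, inner_smul_left, ContinuousLinearMap.adjoint_inner_right]
  ring

/-- The regularity of the elements of the classical domain. -/
def IsRegular (T : ℝ) (Ω : Set (Space d)) (v : ℝ → Space d → ℂ) : Prop :=
  ∀ t ∈ Ioo 0 T, ∀ x ∈ Ω, DifferentiableAt ℝ (fun s => v s x) t ∧ ContDiffAt ℝ 2 (v t) x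

theorem adjointSchrodinger_add {v w : ℝ → Space d → ℂ} (hv : IsRegular T Ω v)
    (hw : IsRegular T Ω w) {t : ℝ} (ht : t ∈ Ioo 0 T) {x : Space d} (hx : x ∈ Ω) :
    adjointSchrodinger 𝒱 (v + w) t x =
      adjointSchrodinger 𝒱 v t x + adjointSchrodinger 𝒱 w t x := by
  have h1 : deriv (fun s => (v + w) s x) t = deriv (fun s => v s x) t + deriv (fun s => w s x) t :=
    deriv_fun_add (hv t ht x hx).1 (hw t ht x hx).1
  have h2 : Laplacian.laplacian ((v + w) t) x =
      Laplacian.laplacian (v t) x + Laplacian.laplacian (w t) x :=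
    (hv t ht x hx).2.laplacian_add (hw t ht x hx).2
  rw [adjointSchrodinger, h1, h2]
  simp only [adjointSchrodinger, Pi.add_apply]
  ring

theorem adjointSchrodinger_smul {v : ℝ → Space d → ℂ} (hv : IsRegular T Ω v) (c : ℂ) {t : ℝ}
    (ht : t ∈ Ioo 0 T) {x : Space d} (hx : x ∈ Ω) :
    adjointSchrodinger 𝒱 (c • v) t x = c * adjointSchrodinger 𝒱 v t x := by
  have h1 : deriv (fun s => (c • v) s x) t = c * deriv (fun s => v s x) t :=
    deriv_const_mul_field c
  have h2 : Laplacian.laplacian ((c • v) t) x = c * Laplacian.laplacian (v t) x :=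
    InnerProductSpace.laplacian_smul c (hv t ht x hx).2
  rw [adjointSchrodinger, h1, h2]
  simp only [adjointSchrodinger, Pi.smul_apply, smul_eq_mul]
  ring

/-- The induction over the span carries regularity along, because the pointwise operator is additive
only where the derivatives exist. -/
theorem IsWeakSolution.exists_pairing (hT : 0 < T) (hΩ : IsOpen Ω)
    (hA : IsMultiplication T 𝒱 A) (hL : IsLipschitzPotential T A C M)
    (hsource : ∀ φ, IsSpaceFactor Ω φ → ∃ f, IsClassicalSolution G f φ)
    (hu : IsWeakSolution T ((embVH Ω).comp G) A u₀ u) {v : ℝ → Space d → ℂ}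
    (hv : v ∈ classicalDomain T Ω) :
    IsRegular T Ω v ∧ ∃ q : U T Ω × H Ω,
      (∀ᵐ t ∂timeMeasure T, q.1 t =ᵐ[volume.restrict Ω] adjointSchrodinger 𝒱 v t) ∧
      q.2 =ᵐ[volume.restrict Ω] v 0 ∧ inner ℂ q.1 u = Complex.I * inner ℂ q.2 u₀ := by
  induction hv using Submodule.span_induction with
  | mem v hv =>
    obtain ⟨θ, φ, hθ, hφ, rfl⟩ := hv
    obtain ⟨f, hf⟩ := hsource φ hφ
    obtain ⟨p, h1, h2, h3, h4, h5⟩ := exists_triple hT hΩ hA hL hθ hf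
    refine ⟨fun t ht x hx => ⟨(hθ.hasDerivAt ht).differentiableAt.mul_const _,
      contDiffAt_const.mul (hφ.1.contDiffAt (hΩ.mem_nhds hx))⟩, p.2, h2, h3, ?_⟩
    rw [inner_eq_integral_testCurve h4, h5]
    exact hu θ hθ f
  | zero =>
    refine ⟨fun t _ x _ => ⟨differentiableAt_const 0, contDiffAt_const⟩, 0, ?_, ?_, by simp⟩
    · filter_upwards [Lp.coeFn_zero (H Ω) 2 (timeMeasure T)] with t ht
      change (0 : U T Ω) t =ᵐ[_] _
      rw [ht]
      refine (Lp.coeFn_zero ..).trans (Eventually.of_forall fun x => ?_)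
      have : Laplacian.laplacian (0 : Space d → ℂ) x = 0 :=
        congrFun (InnerProductSpace.laplacian_const (c := (0 : ℂ))) x
      simp [adjointSchrodinger, this]
    · exact Lp.coeFn_zero ..
  | add v w _ _ hv hw =>
    obtain ⟨hv0, q, hv1, hv2, hv3⟩ := hv
    obtain ⟨hw0, r, hw1, hw2, hw3⟩ := hw
    refine ⟨fun t ht x hx => ⟨(hv0 t ht x hx).1.add (hw0 t ht x hx).1,
      (hv0 t ht x hx).2.add (hw0 t ht x hx).2⟩, q + r, ?_, ?_, ?_⟩
    · filter_upwards [hv1, hw1, Lp.coeFn_add q.1 r.1, ae_restrict_mem measurableSet_Ioo] with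
        t h1 h2 h3 ht
      rw [Prod.fst_add, h3, Pi.add_apply]
      filter_upwards [h1, h2, Lp.coeFn_add (q.1 t) (r.1 t), ae_restrict_mem hΩ.measurableSet] with
        x h4 h5 h6 hx
      rw [h6, Pi.add_apply, h4, h5, adjointSchrodinger_add hv0 hw0 ht hx]
    · filter_upwards [hv2, hw2, Lp.coeFn_add q.2 r.2] with x h1 h2 h3
      rw [Prod.snd_add, h3, Pi.add_apply, h1, h2]; rfl
    · rw [Prod.fst_add, Prod.snd_add, inner_add_left, inner_add_left, hv3, hw3, mul_add]
  | smul c v _ hv =>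
    obtain ⟨hv0, q, hv1, hv2, hv3⟩ := hv
    refine ⟨fun t ht x hx => ⟨(hv0 t ht x hx).1.const_smul c,
      (hv0 t ht x hx).2.const_smul c⟩, c • q, ?_, ?_, ?_⟩
    · filter_upwards [hv1, Lp.coeFn_smul c q.1, ae_restrict_mem measurableSet_Ioo] with t h1 h3 ht
      rw [Prod.smul_fst, h3, Pi.smul_apply]
      filter_upwards [h1, Lp.coeFn_smul c (q.1 t), ae_restrict_mem hΩ.measurableSet] with
        x h4 h6 hx
      rw [h6, Pi.smul_apply, h4, adjointSchrodinger_smul hv0 c ht hx, smul_eq_mul]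
    · filter_upwards [hv2, Lp.coeFn_smul c q.2] with x h1 h3
      rw [Prod.smul_snd, h3, Pi.smul_apply, h1]; rfl
    · rw [Prod.smul_fst, Prod.smul_snd, inner_smul_left, inner_smul_left, hv3]; ring

theorem IsWeakSolution.isUltraWeakSolution (hT : 0 < T) (hΩ : IsOpen Ω)
    (hA : IsMultiplication T 𝒱 A) (hL : IsLipschitzPotential T A C M)
    (hsource : ∀ φ, IsSpaceFactor Ω φ → ∃ f, IsClassicalSolution G f φ)
    (hu : IsWeakSolution T ((embVH Ω).comp G) A u₀ u) : IsUltraWeakSolution 𝒱 u₀ u := by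
  have hclosed : IsClosed {p : U T Ω × U T Ω × H Ω |
      inner ℂ p.2.1 u = Complex.I * inner ℂ p.2.2 u₀} :=
    isClosed_eq (by fun_prop) (by fun_prop)
  refine fun p hp => closure_minimal (fun p hp => ?_) hclosed hp
  obtain ⟨v, hv, -, h2, h3⟩ := hp
  obtain ⟨-, q, q1, q2, q3⟩ := hu.exists_pairing hT hΩ hA hL hsource hv
  have e1 : p.2.1 = q.1 := Lp.ext (by
    filter_upwards [h2, q1] with t a b using Lp.ext (a.trans b.symm))
  have e2 : p.2.2 = q.2 := Lp.ext (h3.trans q2.symm)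
  change inner ℂ p.2.1 u = Complex.I * inner ℂ p.2.2 u₀
  rw [e1, e2, q3]

end UltraWeak

end Schrodinger

end

/-! ### Assembly of the result -/

theorem mainTheorem5 (N : ℕ) (hN : 1 ≤ N) (T : ℝ) (hT : 0 < T)
    (Ω : Set (Schrodinger.Space (3 * N))) (hΩ_open : IsOpen Ω)
    (hΩ_bounded : Bornology.IsBounded Ω) (hΩ_smooth : Schrodinger.HasSmoothBoundary Ω)
    (𝒱 : ℝ → Schrodinger.Space (3 * N) → ℝ) (h𝒱 : Schrodinger.PotentialAssumption T Ω 𝒱)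
    (u₀ : Schrodinger.V Ω) :
    ∃ u : Schrodinger.U T Ω,
      Schrodinger.IsUltraWeakSolution 𝒱 (Schrodinger.embVH Ω u₀) u ∧
      (∀ w : Schrodinger.U T Ω,
        Schrodinger.IsUltraWeakSolution 𝒱 (Schrodinger.embVH Ω u₀) w → w = u) ∧
      Schrodinger.MemL2V u ∧ Schrodinger.MemH1V' u ∧
      ∃ ψ : ℝ → Schrodinger.H Ω,
        (∀ᵐ t ∂Schrodinger.timeMeasure T, ψ t = u t) ∧
        Schrodinger.IsNormPreserving T ψ ∧ ψ 0 = Schrodinger.embVH Ω u₀ ∧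
        ∀ t ∈ Set.Icc 0 T, ‖ψ t‖ = ‖Schrodinger.embVH Ω u₀‖ := by
  -- N ≥ 1 enters here, through the dimension required by the Poincaré inequality.
  have hd : 3 ≤ 3 * N := by omega
  have hd0 : 0 < 3 * N := by omega
  obtain ⟨G, hG, hGd⟩ := Schrodinger.exists_isDirichletInverse hd hΩ_open hΩ_bounded
  obtain ⟨A, M, hA, hM⟩ := h𝒱.exists_operator
  obtain ⟨C, hL⟩ := hA.isLipschitzPotential h𝒱 hM
  have hK := hG.isPosDense
  have hdense := hG.dense_span_source hd0 hΩ_open hΩ_bounded hΩ_smooth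
  have hsource : ∀ φ, Schrodinger.IsSpaceFactor Ω φ →
      ∃ f, Schrodinger.IsClassicalSolution G f φ :=
    fun φ hφ => hG.exists_source hd0 hΩ_open hΩ_bounded hΩ_smooth hφ
  obtain ⟨W, hW⟩ := Schrodinger.exists_weakSolution hT hG hL u₀
  have hJW : MeasureTheory.MemLp (fun t => Schrodinger.embVH Ω (W t)) 2
      (Schrodinger.timeMeasure T) :=
    (Schrodinger.embVH Ω).comp_memLp' (MeasureTheory.Lp.memLp W)
  set u : Schrodinger.U T Ω := hJW.toLp _ with hu
  have hue : ∀ᵐ t ∂Schrodinger.timeMeasure T, u t = Schrodinger.embVH Ω (W t) := hJW.coeFn_toLp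
  have hsol : Schrodinger.IsWeakSolution T ((Schrodinger.embVH Ω).comp G) A
      (Schrodinger.embVH Ω u₀) u := fun θ hθ x => by
    rw [← hW θ hθ x]
    exact MeasureTheory.integral_congr_ae (hue.mono fun t ht => by simp only [ht])
  obtain ⟨ψ, hψu, hψc, hψ0, hψn⟩ :=
    hsol.exists_continuous hT hK hL (MeasureTheory.Lp.memLp u)
  refine ⟨u, hsol.isUltraWeakSolution hT hΩ_open hA hL hsource, fun w hw => ?_,
    ⟨W, hue.mono fun t ht => ht.symm⟩, ?_, ψ, hψu, ⟨hψc, fun t ht => ?_⟩, hψ0, hψn⟩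
  · exact MeasureTheory.Lp.ext ((hw.isWeakSolution hT hΩ_open hA hL hdense).ae_eq hT hK hL
      (MeasureTheory.Lp.memLp w) (MeasureTheory.Lp.memLp u) hsol)
  · obtain ⟨w, hw⟩ := Schrodinger.exists_weakTimeDeriv hG hGd hL W hW
    refine ⟨w, fun θ h1 h2 h3 => ?_⟩
    rw [← hw θ h1 h2 h3]
    exact MeasureTheory.integral_congr_ae (hue.mono fun t ht => by
      simp only [ht]; rfl)
  · rw [hψn t ht, hψ0]
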